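/- Let $\{f_\theta:\theta\in\Theta\}$, $\Theta\subseteq\mathbb R^p$, be a family of probability densities with respect to a $\sigma$-finite measure $\mu$, let $\gamma\in[0,1]$, $\lambda\in\mathbb R$, $\beta\ge 0$, and let $X_1,X_2,\dots$ be i.i.d. with density $f_{\theta_0}$. Let $\Theta_0=\{\theta\in\Theta: h(\theta)=0\}$, where $h$ has $r$ real components, is $C^1$ near $\theta_0$, and its $p\times r$ matrix $H=\partial h/\partial\theta$ has rank $r$ at $\theta_0$. Assume $H_0$ is true: $h(\theta_0)=0$. Write $u_\theta=\nabla_\theta\log f_\theta$ and $$J_\beta(\theta)=\int u_\theta u_\theta^T f_\theta^{1+\beta}d\mu,\quad \xi_\beta(\theta)=\int u_\theta f_\theta^{1+\beta}d\mu,\quad V_\beta(\theta)=\int u_\theta u_\theta^T f_\theta^{1+2\beta}d\mu-\xi_\beta\xi_\beta^T,$$ $$A_\gamma(\theta)=(1+\gamma)\int u_\theta u_\theta^T f_\theta^{1+\gamma}d\mu,\qquad P_\beta=J_\beta^{-1}-J_\beta^{-1}H(H^TJ_\beta^{-1}H)^{-1}H^TJ_\beta^{-1},$$ $$\widetilde\Sigma_\beta=[J_\beta^{-1}-P_\beta]V_\beta[J_\beta^{-1}-P_\beta].$$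 With $A=1+\lambda(1-\gamma)$ and $B=\gamma-\lambda(1-\gamma)$, the $S$-divergence is $$S_{(\gamma,\lambda)}(g,f)=\frac1A\int f^{1+\gamma}d\mu-\frac{1+\gamma}{AB}\int f^Bg^Ad\mu+\frac1B\int g^{1+\gamma}d\mu\qquad(A,B\neq0),$$ and, in the limiting cases, $\int f^{1+\gamma}\log\frac fg\,d\mu-\frac1{1+\gamma}\int(f^{1+\gamma}-g^{1+\gamma})d\mu$ if $A=0$ and $\int g^{1+\gamma}\log\frac gf\,d\mu-\frac1{1+\gamma}\int(g^{1+\gamma}-f^{1+\gamma})d\mu$ if $B=0$. Put $V_\theta(x)=\int f_\theta^{1+\beta}d\mu-(1+\tfrac1\beta)f_\theta(x)^\beta$ if $\beta>0$ and $V_\theta(x)=-\log f_\theta(x)$ if $\beta=0$. Assume the following. 1. (Lehmann conditions) On some open $\omega$ with $\theta_0\in\omega\subseteq\Theta$: for almost all $x$, $f_\theta(x)$ has three derivatives in $\theta$; for all $\theta\in\omega$, $E_\theta[u_\theta]=0$ and $E_\theta[u_\theta u_\theta^T]=-E_\theta[\nabla^2\log f_\theta]$, all finite; the Fisher information is positive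 definite on $\omega$; and the third derivatives of $\log f_\theta(x)$ are bounded on $\omega$ by functions $M_{jkl}(x)$ with $E_{\theta_0}M_{jkl}<\infty$. 2. (Basu et al. conditions) The set $\{f_\theta>0\}$ does not depend on $\theta\in\Theta$, and on some open $\omega$ with $\theta_0\in\omega\subseteq\Theta$: for almost all $x$, $f_\theta(x)$ is three times continuously differentiable in $\theta$; the integrals $\int f_\theta^{1+\beta}d\mu$ and $\int f_\theta^\beta f_{\theta_0}d\mu$ (for $\beta=0$, the latter replaced by $\int f_{\theta_0}\log f_\theta\,d\mu$) can be differentiated three times under the integral sign; $J_\beta(\theta_0)$ is positive definite; and the third derivatives of $V_\theta(x)$ are bounded on $\omega$ by functions $M_{jkl}(x)$ with $E_{\theta_0}M_{jkl}<\infty$. 3. $\int u_{\theta_0}u_{\theta_0}^Tf_{\theta_0}^{1+2\beta}d\mu$ is finite (so that $V_\beta(\theta_0)$ exists). 4. For $\theta_1,\theta_2$ near $\theta_0$, the integral $\int f_{\theta_1}^{1+\gamma}d\mu$ and the cross integral of $S_{(\gamma,\lambda)}(f_{\theta_1},f_{\theta_2})$ (that is, $\int f_{\theta_2}^{B}f_{\theta_1}^{A}d\mu$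 if $A,B\ne0$, $\int f_{\theta_2}^{1+\gamma}\log\frac{f_{\theta_2}}{f_{\theta_1}}d\mu$ if $A=0$, $\int f_{\theta_1}^{1+\gamma}\log\frac{f_{\theta_1}}{f_{\theta_2}}d\mu$ if $B=0$) are finite and can be differentiated twice under the integral sign. An (unrestricted) MDPDE $\widehat\theta_\beta$ is a consistent sequence of measurable functions of the sample with values in $\Theta$ which, with probability tending to one, solve the estimating equation $$\Psi_n(\theta):=\frac1n\sum_{i=1}^nu_\theta(X_i)f_\theta(X_i)^\beta-\int u_\theta f_\theta^{1+\beta}d\mu=0$$ or minimize, at least locally, $\frac1n\sum_{i=1}^nV_\theta(X_i)$ over $\Theta$. A restricted MDPDE $\widetilde\theta_\beta$ is the same with $\Theta_0$ in place of $\Theta$ and the restricted estimating equations $\Psi_n(\theta)+H(\theta)m=0$ (for some $m\in\mathbb R^r$), $h(\theta)=0$. Then unrestricted and restricted MDPDEs exist, $$\operatorname{rank}\bigl(V_\beta[J_\beta^{-1}-P_\beta]A_\gamma[J_\beta^{-1}-P_\beta]V_\beta\bigr)(\theta_0)=r,$$ the matrix $A_\gamma(\theta_0)\widetilde\Sigma_\beta(\theta_0)$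 has exactly $r$ nonzero eigenvalues $\widetilde\zeta_1,\dots,\widetilde\zeta_r$ (counted with multiplicity; all of them real), and for all such $\widehat\theta_\beta,\widetilde\theta_\beta$, $$2n\,S_{(\gamma,\lambda)}\bigl(f_{\widehat\theta_\beta},f_{\widetilde\theta_\beta}\bigr)\ \xrightarrow{\ \mathcal D\ }\ \sum_{i=1}^r\widetilde\zeta_iZ_i^2,\qquad Z_1,\dots,Z_r\ \text{i.i.d. } N(0,1).$$ -/

import Mathlib

open MeasureTheory ProbabilityTheory Filter Topology Matrix

noncomputable section

namespace SDT

/-! ### Differentiation under the integral sign -/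

/-- Partial derivative in the `j`-th coordinate. -/
def pderiv {p : ℕ} (j : Fin p) (F : EuclideanSpace ℝ (Fin p) → ℝ)
    (θ : EuclideanSpace ℝ (Fin p)) : ℝ :=
  fderiv ℝ F θ (EuclideanSpace.single j 1)

/-- On the set `ω`, the integral `θ ↦ ∫ F θ x dμ(x)` exists, can be differentiated `k` times, and
all its derivatives up to order `k` exist as integrals and are obtained by differentiating under
the integral sign. -/
def DiffUnderIntegral {𝒳 E : Type*} [MeasurableSpace 𝒳] [NormedAddCommGroup E] [NormedSpace ℝ E]
    (μ : Measure 𝒳) (ω : Set E) : ℕ → (E → 𝒳 → ℝ) → Prop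
  | 0, F => ∀ θ ∈ ω, Integrable (F θ) μ
  | k + 1, F =>
      (∀ θ ∈ ω, Integrable (F θ) μ) ∧
      DifferentiableOn ℝ (fun θ => ∫ x, F θ x ∂μ) ω ∧
      ∀ v : E,
        (∀ θ ∈ ω, fderiv ℝ (fun t => ∫ x, F t x ∂μ) θ v
            = ∫ x, fderiv ℝ (fun t => F t x) θ v ∂μ) ∧
        DiffUnderIntegral μ ω k (fun θ x => fderiv ℝ (fun t => F t x) θ v)

section Model

variable {𝒳 : Type*} [MeasurableSpace 𝒳] {p : ℕ}

/-! ### Parametric models and the usual matrices -/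

/-- `f θ`, for `θ ∈ Θ`, are probability densities with respect to `μ`, jointly measurable. -/
structure IsDensityFamily (μ : Measure 𝒳) (f : EuclideanSpace ℝ (Fin p) → 𝒳 → ℝ)
    (Θ : Set (EuclideanSpace ℝ (Fin p))) : Prop where
  measurable : Measurable (fun q : Θ × 𝒳 => f q.1 q.2)
  nonneg : ∀ θ ∈ Θ, ∀ x, 0 ≤ f θ x
  lintegral_eq_one : ∀ θ ∈ Θ, ∫⁻ x, ENNReal.ofReal (f θ x) ∂μ = 1

/-- The likelihood score `u_θ(x) = ∇_θ log f_θ(x)`. -/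
def score (f : EuclideanSpace ℝ (Fin p) → 𝒳 → ℝ) (θ : EuclideanSpace ℝ (Fin p)) (x : 𝒳) :
    Fin p → ℝ :=
  fun j => pderiv j (fun t => Real.log (f t x)) θ

/-- `J_β(θ) = ∫ u_θ u_θᵀ f_θ^{1+β}`; for `β = 0` this is the Fisher information. -/
def Jmat (μ : Measure 𝒳) (f : EuclideanSpace ℝ (Fin p) → 𝒳 → ℝ) (β : ℝ)
    (θ : EuclideanSpace ℝ (Fin p)) : Matrix (Fin p) (Fin p) ℝ :=
  Matrix.of fun j k => ∫ x, score f θ x j * score f θ x k * f θ x ^ (1 + β) ∂μ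

/-- `ξ_β(θ) = ∫ u_θ f_θ^{1+β}`. -/
def xiVec (μ : Measure 𝒳) (f : EuclideanSpace ℝ (Fin p) → 𝒳 → ℝ) (β : ℝ)
    (θ : EuclideanSpace ℝ (Fin p)) : Fin p → ℝ :=
  fun j => ∫ x, score f θ x j * f θ x ^ (1 + β) ∂μ

/-- `V_β(θ) = ∫ u_θ u_θᵀ f_θ^{1+2β} - ξ_β(θ) ξ_β(θ)ᵀ`. -/
def Vmat (μ : Measure 𝒳) (f : EuclideanSpace ℝ (Fin p) → 𝒳 → ℝ) (β : ℝ)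
    (θ : EuclideanSpace ℝ (Fin p)) : Matrix (Fin p) (Fin p) ℝ :=
  Jmat μ f (2 * β) θ - Matrix.vecMulVec (xiVec μ f β θ) (xiVec μ f β θ)

/-- `A_γ(θ) = (1+γ) ∫ u_θ u_θᵀ f_θ^{1+γ}`, the Hessian at `t = θ` of the divergence
`t ↦ S_{(γ,λ)}(f_t, f_θ)`, for every `λ`. -/
def Amat (μ : Measure 𝒳) (f : EuclideanSpace ℝ (Fin p) → 𝒳 → ℝ) (γ : ℝ)
    (θ : EuclideanSpace ℝ (Fin p)) : Matrix (Fin p) (Fin p) ℝ :=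
  (1 + γ) • Jmat μ f γ θ

/-- The `p × r` matrix `H(θ) = ∂h(θ)/∂θ`, with entries `∂h_k/∂θ_j`. -/
def Hmat {r : ℕ} (h : EuclideanSpace ℝ (Fin p) → EuclideanSpace ℝ (Fin r))
    (θ : EuclideanSpace ℝ (Fin p)) : Matrix (Fin p) (Fin r) ℝ :=
  Matrix.of fun j k => (fderiv ℝ h θ (EuclideanSpace.single j 1)) k

/-- `P_β(θ) = J⁻¹ - J⁻¹ H (Hᵀ J⁻¹ H)⁻¹ Hᵀ J⁻¹`. -/
def Pmat {r : ℕ} (μ : Measure 𝒳) (f : EuclideanSpace ℝ (Fin p) → 𝒳 → ℝ)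
    (h : EuclideanSpace ℝ (Fin p) → EuclideanSpace ℝ (Fin r)) (β : ℝ)
    (θ : EuclideanSpace ℝ (Fin p)) : Matrix (Fin p) (Fin p) ℝ :=
  (Jmat μ f β θ)⁻¹ - (Jmat μ f β θ)⁻¹ * Hmat h θ *
    ((Hmat h θ)ᵀ * (Jmat μ f β θ)⁻¹ * Hmat h θ)⁻¹ * (Hmat h θ)ᵀ * (Jmat μ f β θ)⁻¹

/-- `Σ̃_β(θ) = [J_β⁻¹ - P_β] V_β [J_β⁻¹ - P_β]`. -/
def SigmaTilde {r : ℕ} (μ : Measure 𝒳) (f : EuclideanSpace ℝ (Fin p) → 𝒳 → ℝ)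
    (h : EuclideanSpace ℝ (Fin p) → EuclideanSpace ℝ (Fin r)) (β : ℝ)
    (θ : EuclideanSpace ℝ (Fin p)) : Matrix (Fin p) (Fin p) ℝ :=
  ((Jmat μ f β θ)⁻¹ - Pmat μ f h β θ) * Vmat μ f β θ * ((Jmat μ f β θ)⁻¹ - Pmat μ f h β θ)

/-! ### The `S`-divergence -/

/-- `A = 1 + λ (1 - γ)`. -/
def expA (γ lam : ℝ) : ℝ := 1 + lam * (1 - γ)

/-- `B = γ - λ (1 - γ)`. -/
def expB (γ lam : ℝ) : ℝ := γ - lam * (1 - γ)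

/-- The integrand of the cross term of `S_{(γ,λ)}(g, f)` at values `a = g(x)`, `b = f(x)`:
`b^B a^A` if `A, B ≠ 0`, and `b^{1+γ} log (b/a)`, `a^{1+γ} log (a/b)` in the limiting cases
`A = 0`, `B = 0`. -/
def crossTerm (γ lam a b : ℝ) : ℝ :=
  if expA γ lam = 0 then b ^ (1 + γ) * Real.log (b / a)
  else if expB γ lam = 0 then a ^ (1 + γ) * Real.log (a / b)
  else b ^ expB γ lam * a ^ expA γ lam

/-- The divergence `S_{(γ,λ)}(g, f)`; at `A = 0` and at `B = 0` the continuous limits of the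
general formula. -/
def sDiv (μ : Measure 𝒳) (γ lam : ℝ) (g f : 𝒳 → ℝ) : ℝ :=
  if expA γ lam = 0 then
    ∫ x, crossTerm γ lam (g x) (f x) ∂μ
      - 1 / (1 + γ) * (∫ x, f x ^ (1 + γ) ∂μ - ∫ x, g x ^ (1 + γ) ∂μ)
  else if expB γ lam = 0 then
    ∫ x, crossTerm γ lam (g x) (f x) ∂μ
      - 1 / (1 + γ) * (∫ x, g x ^ (1 + γ) ∂μ - ∫ x, f x ^ (1 + γ) ∂μ)
  else
    1 / expA γ lam * ∫ x, f x ^ (1 + γ) ∂μ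
      - (1 + γ) / (expA γ lam * expB γ lam) * ∫ x, crossTerm γ lam (g x) (f x) ∂μ
      + 1 / expB γ lam * ∫ x, g x ^ (1 + γ) ∂μ

/-- The integrals that make up `S_{(γ,λ)}(f_θ₁, f_θ₂)` are finite and can be differentiated twice
under the integral sign for `θ₁, θ₂` near `θ₀`. -/
def SDivRegular (μ : Measure 𝒳) (f : EuclideanSpace ℝ (Fin p) → 𝒳 → ℝ) (γ lam : ℝ)
    (θ₀ : EuclideanSpace ℝ (Fin p)) : Prop :=
  ∃ U : Set (EuclideanSpace ℝ (Fin p)), IsOpen U ∧ θ₀ ∈ U ∧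
    DiffUnderIntegral μ U 2 (fun θ x => f θ x ^ (1 + γ)) ∧
    DiffUnderIntegral μ (U ×ˢ U) 2 (fun q x => crossTerm γ lam (f q.1 x) (f q.2 x))

/-! ### Regularity conditions on the model -/

/-- The standard (Lehmann) conditions of likelihood asymptotics at the true parameter `θ₀`. -/
def LehmannConditions (μ : Measure 𝒳) (f : EuclideanSpace ℝ (Fin p) → 𝒳 → ℝ)
    (Θ : Set (EuclideanSpace ℝ (Fin p))) (θ₀ : EuclideanSpace ℝ (Fin p)) : Prop :=
  ∃ ω : Set (EuclideanSpace ℝ (Fin p)), IsOpen ω ∧ ω ⊆ Θ ∧ θ₀ ∈ ω ∧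
    -- third derivatives exist
    (∀ᵐ x ∂μ, DifferentiableOn ℝ (fun θ => f θ x) ω ∧
      (∀ j, DifferentiableOn ℝ (pderiv j (fun θ => f θ x)) ω) ∧
      ∀ j k, DifferentiableOn ℝ (pderiv j (pderiv k (fun θ => f θ x))) ω) ∧
    -- the score is centred and the information identity holds
    (∀ θ ∈ ω, ∀ j, Integrable (fun x => score f θ x j * f θ x) μ ∧
      ∫ x, score f θ x j * f θ x ∂μ = 0) ∧
    (∀ θ ∈ ω, ∀ j k,
      Integrable (fun x => pderiv j (pderiv k (fun t => Real.log (f t x))) θ * f θ x) μ ∧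
      ∫ x, score f θ x j * score f θ x k * f θ x ∂μ
        = ∫ x, -pderiv j (pderiv k (fun t => Real.log (f t x))) θ * f θ x ∂μ) ∧
    -- the Fisher information is finite and positive definite
    (∀ θ ∈ ω, (∀ j k, Integrable (fun x => score f θ x j * score f θ x k * f θ x) μ) ∧
      (Jmat μ f 0 θ).PosDef) ∧
    -- third log-derivatives are dominated
    (∃ M : Fin p → Fin p → Fin p → 𝒳 → ℝ,
      (∀ j k l, ∀ᵐ x ∂μ, ∀ θ ∈ ω,
        |pderiv j (pderiv k (pderiv l (fun t => Real.log (f t x)))) θ| ≤ M j k l x) ∧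
      ∀ j k l, Integrable (fun x => M j k l x * f θ₀ x) μ)

/-- `V_θ(x) = ∫ f_θ^{1+β} - (1 + 1/β) f_θ(x)^β` for `β ≠ 0`, and `-log f_θ(x)` for `β = 0`. -/
def dpdLoss (μ : Measure 𝒳) (f : EuclideanSpace ℝ (Fin p) → 𝒳 → ℝ) (β : ℝ)
    (θ : EuclideanSpace ℝ (Fin p)) (x : 𝒳) : ℝ :=
  if β = 0 then -Real.log (f θ x)
  else ∫ y, f θ y ^ (1 + β) ∂μ - (1 + 1 / β) * f θ x ^ β

/-- The (Basu et al.) conditions of minimum density power divergence estimation with tuning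
parameter `β`, when the data come from the model density `f θ₀`. -/
def BasuConditions (μ : Measure 𝒳) (f : EuclideanSpace ℝ (Fin p) → 𝒳 → ℝ) (β : ℝ)
    (Θ : Set (EuclideanSpace ℝ (Fin p))) (θ₀ : EuclideanSpace ℝ (Fin p)) : Prop :=
  -- common support
  (∀ θ ∈ Θ, ∀ θ' ∈ Θ, ∀ x, 0 < f θ x ↔ 0 < f θ' x) ∧
  ∃ ω : Set (EuclideanSpace ℝ (Fin p)), IsOpen ω ∧ ω ⊆ Θ ∧ θ₀ ∈ ω ∧
    -- three continuous derivatives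
    (∀ᵐ x ∂μ, ContDiffOn ℝ 3 (fun θ => f θ x) ω) ∧
    -- three derivatives under the integral sign, for `∫ f_θ^{1+β}` and `∫ f_θ^β g`
    -- with `g = f_θ₀` (`∫ g log f_θ` if `β = 0`)
    DiffUnderIntegral μ ω 3 (fun θ x => f θ x ^ (1 + β)) ∧
    DiffUnderIntegral μ ω 3
      (fun θ x => (if β = 0 then Real.log (f θ x) else f θ x ^ β) * f θ₀ x) ∧
    -- `J_β(θ₀)` is positive definite
    (Jmat μ f β θ₀).PosDef ∧
    -- third derivatives of `V_θ(x)` are dominated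
    (∃ M : Fin p → Fin p → Fin p → 𝒳 → ℝ,
      (∀ j k l, ∀ᵐ x ∂μ, ∀ θ ∈ ω,
        |pderiv j (pderiv k (pderiv l (fun t => dpdLoss μ f β t x))) θ| ≤ M j k l x) ∧
      ∀ j k l, Integrable (fun x => M j k l x * f θ₀ x) μ)

/-! ### Minimum density power divergence estimators -/

/-- The empirical density power divergence objective, `n⁻¹ ∑ V_θ(X_i)`. -/
def dpdObjective (μ : Measure 𝒳) (f : EuclideanSpace ℝ (Fin p) → 𝒳 → ℝ) (β : ℝ) {n : ℕ}
    (X : Fin n → 𝒳) (θ : EuclideanSpace ℝ (Fin p)) : ℝ :=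
  (1 / (n : ℝ)) * ∑ i, dpdLoss μ f β θ (X i)

/-- The estimating function `n⁻¹ ∑ u_θ(X_i) f_θ(X_i)^β - ∫ u_θ f_θ^{1+β}`. -/
def dpdEstFun (μ : Measure 𝒳) (f : EuclideanSpace ℝ (Fin p) → 𝒳 → ℝ) (β : ℝ) {n : ℕ}
    (X : Fin n → 𝒳) (θ : EuclideanSpace ℝ (Fin p)) : Fin p → ℝ :=
  fun j => (1 / (n : ℝ)) * ∑ i, score f θ (X i) j * f θ (X i) ^ β - xiVec μ f β θ j

variable {Ω : Type*} [MeasurableSpace Ω]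

/-- A consistent sequence of unrestricted MDPDEs, as functions of the sample: with probability
tending to one, a root of the estimating equation or a (possibly only local) minimizer over `Θ`
of the empirical density power divergence. -/
structure IsMDPDE (P : Measure Ω) (X : ℕ → Ω → 𝒳) (μ : Measure 𝒳)
    (f : EuclideanSpace ℝ (Fin p) → 𝒳 → ℝ) (β : ℝ) (Θ : Set (EuclideanSpace ℝ (Fin p)))
    (θ₀ : EuclideanSpace ℝ (Fin p))
    (est : (n : ℕ) → (Fin n → 𝒳) → EuclideanSpace ℝ (Fin p)) : Prop where
  measurable : ∀ n, Measurable (est n)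
  mem : ∀ n x, est n x ∈ Θ
  isEstimator : Tendsto (fun n => P {w |
      ¬ (dpdEstFun μ f β (fun i : Fin n => X i w) (est n (fun i => X i w)) = 0 ∨
        IsLocalMinOn (dpdObjective μ f β (fun i : Fin n => X i w)) Θ
          (est n (fun i => X i w)))}) atTop (𝓝 0)
  consistent : TendstoInMeasure P (fun n w => est n (fun i => X i w)) atTop (fun _ => θ₀)

/-- A consistent sequence of restricted MDPDEs under `Θ₀ = {θ ∈ Θ | h θ = 0}`: with probability
tending to one, a root (with Lagrange multipliers) of the restricted estimating equations or a
(possibly only local) minimizer over `Θ₀` of the empirical density power divergence. -/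
structure IsRestrictedMDPDE {r : ℕ} (P : Measure Ω) (X : ℕ → Ω → 𝒳) (μ : Measure 𝒳)
    (f : EuclideanSpace ℝ (Fin p) → 𝒳 → ℝ)
    (h : EuclideanSpace ℝ (Fin p) → EuclideanSpace ℝ (Fin r)) (β : ℝ)
    (Θ : Set (EuclideanSpace ℝ (Fin p))) (θ₀ : EuclideanSpace ℝ (Fin p))
    (est : (n : ℕ) → (Fin n → 𝒳) → EuclideanSpace ℝ (Fin p)) : Prop where
  measurable : ∀ n, Measurable (est n)
  mem : ∀ n x, est n x ∈ Θ ∧ h (est n x) = 0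
  isEstimator : Tendsto (fun n => P {w |
      ¬ ((∃ m : Fin r → ℝ,
            dpdEstFun μ f β (fun i : Fin n => X i w) (est n (fun i => X i w))
              + Hmat h (est n (fun i => X i w)) *ᵥ m = 0) ∨
        IsLocalMinOn (dpdObjective μ f β (fun i : Fin n => X i w)) {θ | θ ∈ Θ ∧ h θ = 0}
          (est n (fun i => X i w)))}) atTop (𝓝 0)
  consistent : TendstoInMeasure P (fun n w => est n (fun i => X i w)) atTop (fun _ => θ₀)

/-- `X 0, X 1, …` are independent with common density `f θ₀` with respect to `μ`. -/
structure IsSample (P : Measure Ω) (X : ℕ → Ω → 𝒳) (μ : Measure 𝒳)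
    (f : EuclideanSpace ℝ (Fin p) → 𝒳 → ℝ) (θ₀ : EuclideanSpace ℝ (Fin p)) : Prop where
  measurable : ∀ i, Measurable (X i)
  indep : iIndepFun X P
  law : ∀ i, P.map (X i) = μ.withDensity (fun x => ENNReal.ofReal (f θ₀ x))

end Model

/-- `ζ` lists the nonzero eigenvalues of `M`, with multiplicity: the remaining `p - r` roots of
the characteristic polynomial are zero. -/
def IsNonzeroEigenvalues {p r : ℕ} (M : Matrix (Fin p) (Fin p) ℝ) (ζ : Fin r → ℝ) : Prop :=
  r ≤ p ∧ (∀ i, ζ i ≠ 0) ∧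
    M.charpoly = Polynomial.X ^ (p - r) * ∏ i, (Polynomial.X - Polynomial.C (ζ i))

end SDT

end

/-! Write `J`, `V`, `A` for the three matrices at `θ₀`, `Q = J⁻¹ - P_β` (this is `projMat J H`), and
`ψ` for the estimating function at the true parameter (`psiMean`).

The gradient of the empirical objective at `θ₀` is `-(1+β)ψ`, its Hessian is close to `(1+β)J` by
the law of large numbers, and its third derivatives are dominated. Hence the unrestricted estimator
satisfies `θ̂ - θ₀ = J⁻¹ψ + o(‖ψ‖)`. Solving the linearised system with Lagrange multipliers gives
`θ̃ - θ₀ = (J⁻¹ - Q)ψ + o(‖ψ‖)` for the restricted one (`LocalModel.restricted_representation`). The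
difference of the estimators is `Qψ + o(‖ψ‖)`.

The divergence and its gradient vanish on the diagonal, and its second-order term at `(θ₀, θ₀)` is
the form `A` in the difference of the two parameters, whatever `lam` is (`crossTerm_derivs`,
`LocalModel.exists_sDiv_expansion`). So twice the divergence is `ψᵀ Q A Q ψ + o(‖ψ‖²)`. All errors
are measured relative to `ψ`; no rate is proved for the estimators themselves, and tightness of `√n
ψ` enters only in `tendstoInDistribution_of_quadratic_approx`.

By the central limit theorem `√n ψ` is asymptotically `N(0, V)`. With `V = BᵀB` the limit of the
form is a standard Gaussian form with matrix `B Q A Q Bᵀ`. This matrix is symmetric of rank `r`, and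
it has the characteristic polynomial of `A Q V Q`, which is `A_γ Σ̃_β` (`exists_weights`). The rank
count needs `A` and `V` to be positive definite; both follow from positive definiteness of the
Fisher information (`LocalModel.Amat_posDef`, `LocalModel.Vmat_posDef`).

For existence, the objective is minimized over a small compact piece of the constraint set, with a
measurable choice of minimizer. A point of that piece whose loss does not exceed the loss at `θ₀`
lies within a multiple of `‖ψ‖` of `θ₀` (`exists_norm_le_gradient`), so the minimizer is consistent
and eventually off the boundary of the ball. The unrestricted case is the restricted one with `r =
0`. -/

namespace SDT

/-! ### Linear algebra: ranks, diagonalisation, perturbation of the multiplier system. -/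

section LinearAlgebra

variable {p r : ℕ}

/-- `J⁻¹ H (Hᵀ J⁻¹ H)⁻¹ Hᵀ J⁻¹`. -/
noncomputable def projMat (J : Matrix (Fin p) (Fin p) ℝ) (H : Matrix (Fin p) (Fin r) ℝ) :
    Matrix (Fin p) (Fin p) ℝ :=
  J⁻¹ * H * (Hᵀ * J⁻¹ * H)⁻¹ * Hᵀ * J⁻¹

lemma mulVec_injective_of_rank {H : Matrix (Fin p) (Fin r) ℝ} (hH : H.rank = r) :
    Function.Injective H.mulVec := by
  rw [Matrix.mulVec_injective_iff]
  have := Matrix.rank_eq_finrank_span_cols H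
  rw [hH] at this
  rw [linearIndependent_iff_card_eq_finrank_span, Fintype.card_fin]
  exact this

lemma posDef_gram {J : Matrix (Fin p) (Fin p) ℝ} (hJ : J.PosDef) {H : Matrix (Fin p) (Fin r) ℝ}
    (hH : H.rank = r) : (Hᵀ * J⁻¹ * H).PosDef := by
  have := hJ.inv.conjTranspose_mul_mul_same (B := H) (mulVec_injective_of_rank hH)
  simpa using this

open scoped MatrixOrder in
lemma exists_factor {J : Matrix (Fin p) (Fin p) ℝ} (hJ : J.PosDef) :
    ∃ B : Matrix (Fin p) (Fin p) ℝ, IsUnit B.det ∧ J = Bᵀ * B := by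
  obtain ⟨B, hB⟩ := CStarAlgebra.nonneg_iff_eq_star_mul_self.1 hJ.posSemidef.nonneg
  rw [star_eq_conjTranspose] at hB
  refine ⟨B, ?_, by simpa using hB⟩
  have h := hJ.det_pos
  rw [hB, det_mul] at h
  exact isUnit_iff_ne_zero.2 (right_ne_zero_of_mul h.ne')

lemma isUnit_det_of_posDef {J : Matrix (Fin p) (Fin p) ℝ} (hJ : J.PosDef) : IsUnit J.det :=
  isUnit_iff_ne_zero.2 hJ.det_pos.ne'

lemma transpose_eq_of_posDef {J : Matrix (Fin p) (Fin p) ℝ} (hJ : J.PosDef) : Jᵀ = J := by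
  have := hJ.isHermitian.eq
  simpa using this

lemma projMat_transpose {J : Matrix (Fin p) (Fin p) ℝ} (hJ : J.PosDef)
    (H : Matrix (Fin p) (Fin r) ℝ) : (projMat J H)ᵀ = projMat J H := by
  have h : J⁻¹ᵀ = J⁻¹ := by rw [transpose_nonsing_inv, transpose_eq_of_posDef hJ]
  simp only [projMat, transpose_mul, h, transpose_nonsing_inv, transpose_transpose, Matrix.mul_assoc]

/-- Factoring the inverse of `Hᵀ J⁻¹ H` as `Bᵀ * B` exhibits `projMat` as a Gram matrix of `B * Hᵀ`
between two invertible factors, and a real Gram matrix has the rank of its factor. -/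
lemma rank_projMat {J : Matrix (Fin p) (Fin p) ℝ} (hJ : J.PosDef)
    {H : Matrix (Fin p) (Fin r) ℝ} (hH : H.rank = r) : (projMat J H).rank = r := by
  have hu : IsUnit (J⁻¹).det := isUnit_det_of_posDef hJ.inv
  obtain ⟨B, hB, hBe⟩ := exists_factor (posDef_gram hJ hH).inv
  have : projMat J H = J⁻¹ * ((B * Hᵀ)ᵀ * (B * Hᵀ)) * J⁻¹ := by
    rw [projMat, hBe]
    simp only [transpose_mul, transpose_transpose, Matrix.mul_assoc]
  rw [this, rank_mul_eq_left_of_isUnit_det _ _ hu, rank_mul_eq_right_of_isUnit_det _ _ hu,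
    rank_transpose_mul_self, rank_mul_eq_right_of_isUnit_det _ _ hB, rank_transpose, hH]

/-- `V` is only required to be invertible because the lemma serves twice: with the covariance matrix
itself, for the rank claim of the theorem, and with a factor of it, in `exists_weights`. -/
lemma rank_sandwich {J A V : Matrix (Fin p) (Fin p) ℝ} (hJ : J.PosDef) (hA : A.PosDef)
    {H : Matrix (Fin p) (Fin r) ℝ} (hH : H.rank = r) (hV : IsUnit V.det) :
    (Vᵀ * projMat J H * A * projMat J H * V).rank = r := by
  obtain ⟨C, hC, rfl⟩ := exists_factor hA
  have : Vᵀ * projMat J H * (Cᵀ * C) * projMat J H * V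
      = (C * projMat J H * V)ᵀ * (C * projMat J H * V) := by
    simp only [transpose_mul, projMat_transpose hJ, Matrix.mul_assoc]
  rw [this, rank_transpose_mul_self, rank_mul_eq_left_of_isUnit_det _ _ hV,
    rank_mul_eq_right_of_isUnit_det _ _ hC, rank_projMat hJ hH]

/-- Diagonalisation of a symmetric matrix of rank `r`, keeping only the nonzero eigenvalues. -/
lemma exists_nonzero_diagonalization {N : Matrix (Fin p) (Fin p) ℝ} (hN : N.IsHermitian)
    (hr : N.rank = r) :
    ∃ (ζ : Fin r → ℝ) (O : Matrix (Fin r) (Fin p) ℝ), IsNonzeroEigenvalues N ζ ∧ O * Oᵀ = 1 ∧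
      ∀ z, z ⬝ᵥ N *ᵥ z = ∑ i, ζ i * (O *ᵥ z) i ^ 2 := by
  classical
  have hcard := hN.rank_eq_card_non_zero_eigs
  rw [hr] at hcard
  let e : Fin r ≃ {i // hN.eigenvalues i ≠ 0} := (Fintype.equivFinOfCardEq hcard.symm).symm
  let U : Matrix (Fin p) (Fin p) ℝ := hN.eigenvectorUnitary
  have hU : Uᵀ * U = 1 := by
    have := Matrix.mem_unitaryGroup_iff'.1 hN.eigenvectorUnitary.2
    simpa [star_eq_conjTranspose] using this
  have hspec : N = U * diagonal hN.eigenvalues * Uᵀ := by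
    have := hN.spectral_theorem
    simpa [Unitary.conjStarAlgAut_apply, star_eq_conjTranspose, Function.comp_def, U] using this
  -- The rows of `O` are the orthonormal eigenvectors with nonzero eigenvalue. The remaining ones
  -- contribute nothing to the form and a factor `X` each to the characteristic polynomial.
  refine ⟨fun i => hN.eigenvalues (e i), of fun i => Uᵀ (e i), ⟨?_, fun i => (e i).2, ?_⟩, ?_, ?_⟩
  · have := Fintype.card_subtype_le (fun i => hN.eigenvalues i ≠ 0)
    rw [hcard]; simp only [Fintype.card_fin] at this; exact this
  · rw [hN.charpoly_eq, ← Fintype.prod_subtype_mul_prod_subtype (fun i => hN.eigenvalues i = 0),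
      ← e.prod_comp (fun i => (Polynomial.X - Polynomial.C ((RCLike.ofReal (hN.eigenvalues i) : ℝ))))]
    congr 1
    rw [Finset.prod_congr rfl (g := fun _ => Polynomial.X) (fun i _ => by simp [i.2])]
    rw [Finset.prod_const, Finset.card_univ]
    congr 1
    have := Fintype.card_subtype_compl (fun i => hN.eigenvalues i = 0)
    have h2 := Fintype.card_subtype_le (fun i => hN.eigenvalues i = 0)
    simp only [Fintype.card_fin] at this h2
    simp only [ne_eq] at hcard
    omega
  · ext i j
    have := congrFun (congrFun hU (e i)) (e j)
    rw [Matrix.mul_apply] at this ⊢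
    simp only [transpose_apply, of_apply] at this ⊢
    rw [this]
    simp [Matrix.one_apply, Subtype.ext_iff.symm]
  · intro z
    have h1 : z ⬝ᵥ N *ᵥ z = ∑ i, hN.eigenvalues i * (Uᵀ *ᵥ z) i ^ 2 := by
      conv_lhs => rw [hspec]
      rw [← mulVec_mulVec, ← mulVec_mulVec, dotProduct_mulVec, ← mulVec_transpose]
      simp only [dotProduct, mulVec_diagonal]
      exact Finset.sum_congr rfl fun i _ => by ring
    rw [h1, ← Fintype.sum_subtype_add_sum_subtype (fun i => hN.eigenvalues i = 0),
      ← e.sum_comp (fun i => hN.eigenvalues i * (Uᵀ *ᵥ z) i ^ 2)]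
    rw [Finset.sum_eq_zero (fun i _ => by rw [i.2, zero_mul]), zero_add]
    rfl

/-- With `V = Bᵀ B`, the substitution `z = Bᵀ y` turns the form `Q A Q` into the symmetric matrix `B
Q A Q Bᵀ`. Since `X Y` and `Y X` have the same characteristic polynomial, its eigenvalues are those
of the non-symmetric `A Q V Q`, which are therefore real. `T` is the whitening map `(Bᵀ)⁻¹` followed
by projection to the eigenvectors that matter. -/
lemma exists_weights {J A V : Matrix (Fin p) (Fin p) ℝ} (hJ : J.PosDef) (hA : A.PosDef)
    (hV : V.PosDef) {H : Matrix (Fin p) (Fin r) ℝ} (hH : H.rank = r) :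
    ∃ (ζ : Fin r → ℝ) (T : Matrix (Fin r) (Fin p) ℝ),
      IsNonzeroEigenvalues (A * (projMat J H * V * projMat J H)) ζ ∧ T * V * Tᵀ = 1 ∧
      ∀ z, z ⬝ᵥ (projMat J H * A * projMat J H) *ᵥ z = ∑ i, ζ i * (T *ᵥ z) i ^ 2 := by
  obtain ⟨B, hB, hVB⟩ := exists_factor hV
  have hBt : IsUnit (Bᵀ).det := by rwa [det_transpose]
  set Q := projMat J H with hQ
  have hN : (B * Q * A * Q * Bᵀ).IsHermitian := by
    rw [IsHermitian, conjTranspose_eq_transpose_of_trivial]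
    simp only [transpose_mul, transpose_transpose, hQ, projMat_transpose hJ,
      transpose_eq_of_posDef hA, Matrix.mul_assoc]
  have hr : (B * Q * A * Q * Bᵀ).rank = r := by
    simpa using rank_sandwich hJ hA hH hBt
  obtain ⟨ζ, O, h1, h2, h3⟩ := exists_nonzero_diagonalization hN hr
  refine ⟨ζ, O * (Bᵀ)⁻¹, ?_, ?_, fun z => ?_⟩
  · have : (A * (Q * V * Q)).charpoly = (B * Q * A * Q * Bᵀ).charpoly := by
      rw [hVB, show A * (Q * (Bᵀ * B) * Q) = (A * Q * Bᵀ) * (B * Q) by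
        simp only [Matrix.mul_assoc], charpoly_mul_comm]
      simp only [Matrix.mul_assoc]
    exact ⟨h1.1, h1.2.1, this ▸ h1.2.2⟩
  · rw [hVB, transpose_mul, transpose_nonsing_inv, transpose_transpose]
    calc O * Bᵀ⁻¹ * (Bᵀ * B) * (B⁻¹ * Oᵀ)
        = O * (Bᵀ⁻¹ * Bᵀ) * (B * B⁻¹) * Oᵀ := by simp only [Matrix.mul_assoc]
      _ = 1 := by rw [nonsing_inv_mul _ hBt, mul_nonsing_inv _ hB, Matrix.mul_one,
          Matrix.mul_one, h2]
  · rw [← mulVec_mulVec z O, ← h3 ((Bᵀ)⁻¹ *ᵥ z)]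
    have : Bᵀ *ᵥ ((Bᵀ)⁻¹ *ᵥ z) = z := by
      rw [mulVec_mulVec, mul_nonsing_inv _ hBt, one_mulVec]
    have h4 : (B * Q * A * Q * Bᵀ) *ᵥ ((Bᵀ)⁻¹ *ᵥ z) = B *ᵥ ((Q * A * Q) *ᵥ z) := by
      rw [← mulVec_mulVec, this]
      simp only [mulVec_mulVec, Matrix.mul_assoc]
    rw [h4, dotProduct_mulVec _ B, ← mulVec_transpose, this]

lemma exists_mulVec_bound {m n : ℕ} (A : Matrix (Fin m) (Fin n) ℝ) :
    ∃ C : ℝ, 0 ≤ C ∧ ∀ v, ‖A *ᵥ v‖ ≤ C * ‖v‖ :=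
  ⟨‖LinearMap.toContinuousLinearMap A.mulVecLin‖, norm_nonneg _, fun v =>
    (LinearMap.toContinuousLinearMap A.mulVecLin).le_opNorm v⟩

lemma exists_quadratic_lower_bound {J : Matrix (Fin p) (Fin p) ℝ} (hJ : J.PosDef) :
    ∃ c : ℝ, 0 < c ∧ ∀ v, c * ‖v‖ ^ 2 ≤ v ⬝ᵥ J *ᵥ v := by
  obtain ⟨B, hB, rfl⟩ := exists_factor hJ
  obtain ⟨C, hC, hbd⟩ := exists_mulVec_bound B⁻¹
  refine ⟨((C + 1) ^ 2)⁻¹, by positivity, fun v => ?_⟩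
  have h1 : ‖v‖ ≤ (C + 1) * ‖B *ᵥ v‖ := by
    have := hbd (B *ᵥ v)
    rw [mulVec_mulVec, nonsing_inv_mul _ hB, one_mulVec] at this
    nlinarith [norm_nonneg (B *ᵥ v)]
  -- The norm on `Fin p → ℝ` is the sup norm, so it is compared with the dot product coordinate by
  -- coordinate.
  have h2 : ‖B *ᵥ v‖ ^ 2 ≤ v ⬝ᵥ (Bᵀ * B) *ᵥ v := by
    rw [← mulVec_mulVec, dotProduct_mulVec, ← mulVec_transpose, transpose_transpose]
    have h0 : 0 ≤ (B *ᵥ v) ⬝ᵥ (B *ᵥ v) := by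
      simp only [dotProduct]; exact Finset.sum_nonneg fun i _ => mul_self_nonneg _
    rw [← Real.sqrt_le_sqrt_iff h0, Real.sqrt_sq (norm_nonneg _)]
    refine (pi_norm_le_iff_of_nonneg (Real.sqrt_nonneg _)).2 fun i => ?_
    rw [Real.norm_eq_abs]
    refine Real.abs_le_sqrt ?_
    rw [dotProduct, pow_two]
    exact Finset.single_le_sum (f := fun i => (B *ᵥ v) i * (B *ᵥ v) i)
      (fun i _ => mul_self_nonneg _) (Finset.mem_univ i)
  refine le_trans ?_ h2
  rw [inv_mul_le_iff₀ (by positivity), ← mul_pow]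
  exact pow_le_pow_left₀ (norm_nonneg _) h1 2

/-- `(H₀ᵀ H₀)⁻¹ H₀ᵀ` is a left inverse of `H₀`, and injectivity survives perturbations that are
small against its norm. The factors `1⁻¹` come from taking `J = 1` in `posDef_gram`. The lemma is
what excludes abnormal Lagrange multipliers in `exists_multiplier`. -/
lemma exists_stable_injective {H₀ : Matrix (Fin p) (Fin r) ℝ} (hH : H₀.rank = r) :
    ∃ η > 0, ∀ H : Matrix (Fin p) (Fin r) ℝ, (∀ m, ‖(H - H₀) *ᵥ m‖ ≤ η * ‖m‖) →
      ∀ m, H *ᵥ m = 0 → m = 0 := by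
  have hG := isUnit_det_of_posDef (posDef_gram (PosDef.one (n := Fin p) (R := ℝ)) hH)
  obtain ⟨C, hC, hbd⟩ := exists_mulVec_bound ((H₀ᵀ * (1 : Matrix (Fin p) (Fin p) ℝ)⁻¹ * H₀)⁻¹ *
    (H₀ᵀ * (1 : Matrix (Fin p) (Fin p) ℝ)⁻¹))
  refine ⟨(2 * (C + 1))⁻¹, by positivity, fun H hd m hm => ?_⟩
  have h1 := hbd (H₀ *ᵥ m)
  rw [mulVec_mulVec, Matrix.mul_assoc, nonsing_inv_mul _ hG, one_mulVec] at h1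
  have h2 := hd m
  rw [sub_mulVec, hm, zero_sub, norm_neg] at h2
  have h3 : (2 * (C + 1))⁻¹ * (C + 1) = 1 / 2 := by field_simp
  have h4 : ‖m‖ ≤ (C + 1) * ((2 * (C + 1))⁻¹ * ‖m‖) :=
    h1.trans (mul_le_mul (by linarith) h2 (norm_nonneg _) (by linarith))
  rw [← mul_assoc, mul_comm (C + 1), h3] at h4
  exact norm_le_zero_iff.1 (by linarith)

/-- Stability of the solution of the linearised restricted estimating equations. -/
lemma exists_restricted_solution_bound {J : Matrix (Fin p) (Fin p) ℝ} (hJ : J.PosDef)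
    {H₀ : Matrix (Fin p) (Fin r) ℝ} (hH : H₀.rank = r) {ε : ℝ} (hε : 0 < ε) :
    ∃ η > 0, ∀ (d ψ : Fin p → ℝ) (m : Fin r → ℝ) (H : Matrix (Fin p) (Fin r) ℝ),
      ‖J *ᵥ d - ψ - H *ᵥ m‖ ≤ η * ‖d‖ → (∀ m', ‖(H - H₀) *ᵥ m'‖ ≤ η * ‖m'‖) →
      ‖H₀ᵀ *ᵥ d‖ ≤ η * ‖d‖ → ‖d - (J⁻¹ - projMat J H₀) *ᵥ ψ‖ ≤ ε * ‖ψ‖ := by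
  have hJu := isUnit_det_of_posDef hJ
  have hG := isUnit_det_of_posDef (posDef_gram hJ hH)
  set G := H₀ᵀ * J⁻¹ * H₀ with hGdef
  obtain ⟨C₁, hC₁, hb₁⟩ := exists_mulVec_bound (G⁻¹ * H₀ᵀ * J⁻¹)
  obtain ⟨C₂, hC₂, hb₂⟩ := exists_mulVec_bound G⁻¹
  obtain ⟨C₃, hC₃, hb₃⟩ := exists_mulVec_bound (J⁻¹ - projMat J H₀)
  obtain ⟨C₄, hC₄, hb₄⟩ := exists_mulVec_bound (J⁻¹ * H₀ * G⁻¹)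
  set C := C₁ + C₂ + C₃ + C₄ + 1 with hC
  have hCpos : 0 < C := by positivity
  -- The second bound makes `C * η ≤ 1/8`, so that error terms can be absorbed on the left. The
  -- first makes the final error `8 * C ^ 2 * η * ‖ψ‖` at most `ε * ‖ψ‖`.
  refine ⟨min (ε / (8 * C ^ 2)) (1 / (8 * C)), by positivity, fun d ψ m H h1 h2 h3 => ?_⟩
  set η := min (ε / (8 * C ^ 2)) (1 / (8 * C)) with hη
  have hη0 : 0 < η := by positivity
  have hη1 : 8 * C ^ 2 * η ≤ ε := by
    have := min_le_left (ε / (8 * C ^ 2)) (1 / (8 * C))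
    rw [← hη, le_div_iff₀ (by positivity)] at this
    linarith
  have hη2 : 8 * C * η ≤ 1 := by
    have := min_le_right (ε / (8 * C ^ 2)) (1 / (8 * C))
    rw [← hη, le_div_iff₀ (by positivity)] at this
    linarith
  -- The residual after freezing the constraint matrix at `H₀`. The system `J d = ψ + H₀ m + e` is
  -- solved exactly: `m` is recovered from `H₀ᵀ d`, then `d` from `m`. The size of the multiplier is
  -- thus derived, not assumed.
  set e := J *ᵥ d - ψ - H₀ *ᵥ m with he
  have he_le : ‖e‖ ≤ η * (‖d‖ + ‖m‖) := by
    have : e = (J *ᵥ d - ψ - H *ᵥ m) + (H - H₀) *ᵥ m := by rw [he, sub_mulVec]; abel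
    rw [this, mul_add]
    exact (norm_add_le _ _).trans (add_le_add h1 (h2 m))
  have hd : d = J⁻¹ *ᵥ (ψ + e) + J⁻¹ *ᵥ (H₀ *ᵥ m) := by
    rw [← mulVec_add, he, show ψ + (J *ᵥ d - ψ - H₀ *ᵥ m) + H₀ *ᵥ m = J *ᵥ d by abel,
      mulVec_mulVec, nonsing_inv_mul _ hJu, one_mulVec]
  have hm : m = G⁻¹ *ᵥ (H₀ᵀ *ᵥ d) - (G⁻¹ * H₀ᵀ * J⁻¹) *ᵥ (ψ + e) := by
    have : H₀ᵀ *ᵥ d = (H₀ᵀ * J⁻¹) *ᵥ (ψ + e) + G *ᵥ m := by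
      conv_lhs => rw [hd]
      rw [mulVec_add, mulVec_mulVec, mulVec_mulVec, mulVec_mulVec, hGdef, Matrix.mul_assoc]
    rw [this, mulVec_add, mulVec_mulVec, mulVec_mulVec, nonsing_inv_mul _ hG, one_mulVec,
      Matrix.mul_assoc]
    abel
  have hd2 : d - (J⁻¹ - projMat J H₀) *ᵥ ψ
      = (J⁻¹ - projMat J H₀) *ᵥ e + (J⁻¹ * H₀ * G⁻¹) *ᵥ (H₀ᵀ *ᵥ d) := by
    have : J⁻¹ *ᵥ (H₀ *ᵥ m)
        = (J⁻¹ * H₀ * G⁻¹) *ᵥ (H₀ᵀ *ᵥ d) - projMat J H₀ *ᵥ (ψ + e) := by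
      conv_lhs => rw [hm]
      simp only [mulVec_sub, mulVec_mulVec, projMat, ← hGdef, Matrix.mul_assoc]
    nth_rewrite 1 [hd]
    rw [this]
    simp only [sub_mulVec, mulVec_add]
    abel
  have hdn : ‖d - (J⁻¹ - projMat J H₀) *ᵥ ψ‖ ≤ C * ‖e‖ + C * (η * ‖d‖) := by
    rw [hd2]
    refine (norm_add_le _ _).trans (add_le_add ((hb₃ _).trans ?_) ((hb₄ _).trans ?_))
    · exact mul_le_mul_of_nonneg_right (by rw [hC]; linarith) (norm_nonneg _)
    · exact mul_le_mul (by rw [hC]; linarith) h3 (norm_nonneg _) hCpos.le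
  have hdd : ‖d‖ ≤ C * ‖ψ‖ + (C * ‖e‖ + C * (η * ‖d‖)) := by
    have h4 : ‖d‖ ≤ ‖(J⁻¹ - projMat J H₀) *ᵥ ψ‖ + ‖d - (J⁻¹ - projMat J H₀) *ᵥ ψ‖ := by
      have := norm_add_le ((J⁻¹ - projMat J H₀) *ᵥ ψ) (d - (J⁻¹ - projMat J H₀) *ᵥ ψ)
      simpa using this
    have h5 : C₃ * ‖ψ‖ ≤ C * ‖ψ‖ :=
      mul_le_mul_of_nonneg_right (by rw [hC]; linarith) (norm_nonneg _)
    linarith [hb₃ ψ]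
  have hmm : ‖m‖ ≤ C * (η * ‖d‖) + C * (‖ψ‖ + ‖e‖) := by
    rw [hm]
    refine (norm_sub_le _ _).trans (add_le_add ((hb₂ _).trans ?_) ((hb₁ _).trans ?_))
    · exact mul_le_mul (by rw [hC]; linarith) h3 (norm_nonneg _) hCpos.le
    · exact mul_le_mul (by rw [hC]; linarith) (norm_add_le _ _) (norm_nonneg _) hCpos.le
  have hCe : C * ‖e‖ ≤ C * (η * (‖d‖ + ‖m‖)) := mul_le_mul_of_nonneg_left he_le hCpos.le
  -- Adding the two bounds gives `s ≤ 2 C ‖ψ‖ + 4 C η s` for `s = ‖d‖ + ‖m‖`, and `4 C η ≤ 1/2`.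
  have hs : ‖d‖ + ‖m‖ ≤ 4 * C * ‖ψ‖ := by
    nlinarith [norm_nonneg d, norm_nonneg m, mul_nonneg hCpos.le hη0.le]
  have hs2 : C * η * (‖d‖ + ‖m‖) ≤ C * η * (4 * C * ‖ψ‖) :=
    mul_le_mul_of_nonneg_left hs (by positivity)
  have hs3 : C * (η * ‖d‖) ≤ C * η * (‖d‖ + ‖m‖) := by
    nlinarith [norm_nonneg m, mul_nonneg hCpos.le hη0.le]
  have : 8 * C ^ 2 * η * ‖ψ‖ ≤ ε * ‖ψ‖ := mul_le_mul_of_nonneg_right hη1 (norm_nonneg _)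
  nlinarith

end LinearAlgebra

/-! ### Limit theorems for empirical means, and measurable selection of minimizers. -/

section Probability

variable {𝒳 Ω : Type*} [MeasurableSpace 𝒳] [MeasurableSpace Ω] {P : Measure Ω} {X : ℕ → Ω → 𝒳} {ν : Measure 𝒳}

/-- The empirical mean of `F` over a sample. -/
noncomputable def empMean (F : 𝒳 → ℝ) {n : ℕ} (x : Fin n → 𝒳) : ℝ :=
  (1 / (n : ℝ)) * ∑ i, F (x i)

lemma identDistrib_comp (hX : ∀ i, Measurable (X i)) (hlaw : ∀ i, P.map (X i) = ν)
    {E : Type*} [MeasurableSpace E] {F : 𝒳 → E} (hF : AEMeasurable F ν) (i j : ℕ) :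
    IdentDistrib (fun w => F (X i w)) (fun w => F (X j w)) P P := by
  have h : IdentDistrib (X i) (X j) P P :=
    ⟨(hX i).aemeasurable, (hX j).aemeasurable, by rw [hlaw, hlaw]⟩
  exact h.comp_of_aemeasurable (by rwa [hlaw])

lemma iIndepFun_comp (hX : ∀ i, Measurable (X i)) (hind : iIndepFun X P)
    (hlaw : ∀ i, P.map (X i) = ν) {E : Type*} [MeasurableSpace E] {F : 𝒳 → E}
    (hF : AEMeasurable F ν) : iIndepFun (fun i w => F (X i w)) P :=
  hind.comp₀ (fun _ => F) (fun i => (hX i).aemeasurable) (fun i => by rwa [hlaw])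

lemma integral_comp_sample (hX : ∀ i, Measurable (X i)) (hlaw : ∀ i, P.map (X i) = ν) (i : ℕ)
    {F : 𝒳 → ℝ} (hF : AEStronglyMeasurable F ν) : ∫ w, F (X i w) ∂P = ∫ x, F x ∂ν := by
  rw [← hlaw i, integral_map (hX i).aemeasurable (by rwa [hlaw])]

lemma integrable_comp_sample (hX : ∀ i, Measurable (X i)) (hlaw : ∀ i, P.map (X i) = ν) (i : ℕ)
    {F : 𝒳 → ℝ} (hF : Integrable F ν) : Integrable (fun w => F (X i w)) P := by
  rw [← hlaw i] at hF
  exact hF.comp_measurable (hX i)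

lemma ae_forall_sample (hX : ∀ i, Measurable (X i)) (hlaw : ∀ i, P.map (X i) = ν)
    {p : 𝒳 → Prop} (hp : ∀ᵐ x ∂ν, p x) : ∀ᵐ w ∂P, ∀ i, p (X i w) := by
  refine ae_all_iff.2 fun i => ?_
  rw [← hlaw i] at hp
  exact ae_of_ae_map (hX i).aemeasurable hp

/-- Weak law of large numbers for empirical means. -/
lemma tendsto_measure_empMean_sub [IsProbabilityMeasure P] (hX : ∀ i, Measurable (X i)) (hind : iIndepFun X P)
    (hlaw : ∀ i, P.map (X i) = ν) {F : 𝒳 → ℝ} (hF : Integrable F ν) {η : ℝ} (hη : 0 < η) :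
    Tendsto (fun n => P {w | η ≤ |empMean F (fun i : Fin n => X i w) - ∫ x, F x ∂ν|})
      atTop (𝓝 0) := by
  have hm := hF.aestronglyMeasurable
  have h1 := strong_law_ae_real (μ := P) (fun i w => F (X i w))
    (integrable_comp_sample hX hlaw 0 hF)
    (fun i j hij => (iIndepFun_comp hX hind hlaw hm.aemeasurable).indepFun hij)
    (fun i => identDistrib_comp hX hlaw hm.aemeasurable i 0)
  rw [integral_comp_sample hX hlaw 0 hm] at h1
  have h2 : TendstoInMeasure P (fun (n : ℕ) w => (∑ i ∈ Finset.range n, F (X i w)) / n) atTop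
      (fun _ => ∫ x, F x ∂ν) := by
    refine tendstoInMeasure_of_tendsto_ae (fun n => ?_) h1
    have := fun i => (integrable_comp_sample hX hlaw i hF).aestronglyMeasurable
    exact ((Finset.aemeasurable_fun_sum _ fun i _ => (this i).aemeasurable).div_const
      _).aestronglyMeasurable
  rw [tendstoInMeasure_iff_norm] at h2
  refine (h2 η hη).congr fun n => ?_
  congr 1; ext w
  simp only [empMean, Set.mem_ofPred_eq, Real.norm_eq_abs]
  rw [Finset.sum_range, div_eq_inv_mul, one_div]

/-- Multivariate central limit theorem with identity covariance. -/
theorem tendstoInDistribution_stdGaussian [IsProbabilityMeasure P] {r : ℕ} {Y : ℕ → Ω → EuclideanSpace ℝ (Fin r)}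
    (hind : iIndepFun Y P) (hid : ∀ i, IdentDistrib (Y i) (Y 0) P P)
    (hY : ∀ t, MemLp (fun w => inner ℝ (Y 0 w) t) 2 P)
    (hmean : ∀ t, ∫ w, inner ℝ (Y 0 w) t ∂P = 0)
    (hvar : ∀ t, ∫ w, (inner ℝ (Y 0 w) t) ^ 2 ∂P = ‖t‖ ^ 2) :
    TendstoInDistribution (fun (n : ℕ) w => (√n)⁻¹ • ∑ k ∈ Finset.range n, Y k w) atTop
      (fun z : Fin r → ℝ => (WithLp.toLp 2 z : EuclideanSpace ℝ (Fin r)))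
      (fun _ => P) (Measure.pi fun _ => gaussianReal 0 1) where
  forall_aemeasurable n :=
    (measurable_const_smul _).comp_aemeasurable
      (Finset.aemeasurable_fun_sum _ fun i _ => (hid i).aemeasurable_fst)
  aemeasurable_limit := by fun_prop
  tendsto := by
    have hm : ∀ n : ℕ, AEMeasurable (fun w => (√n)⁻¹ • ∑ k ∈ Finset.range n, Y k w) P := fun n =>
      (measurable_const_smul _).comp_aemeasurable
        (Finset.aemeasurable_fun_sum _ fun i _ => (hid i).aemeasurable_fst)
    refine ProbabilityMeasure.tendsto_iff_tendsto_charFun.2 fun t => ?_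
    have hmt : Measurable (fun y : EuclideanSpace ℝ (Fin r) => inner ℝ y t) := by fun_prop
    -- Cramér–Wold: the characteristic function at `t` of the vector sums is the one at `1` of the
    -- scalar sums of `⟪Y, t⟫`, so the scalar theorem suffices.
    have h1 := tendstoInDistribution_inv_sqrt_mul_sum_sub (P := P)
      (X := fun i w => inner ℝ (Y i w) t) (Y := id)
      (P' := gaussianReal 0 Var[fun w => inner ℝ (Y 0 w) t; P].toNNReal)
      ⟨aemeasurable_id, Measure.map_id⟩ (hY t) (hind.comp _ fun _ => hmt)
      (fun i => (hid i).comp hmt)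
    have h2 := ProbabilityMeasure.tendsto_iff_tendsto_charFun.1 h1.tendsto 1
    have hv : Var[fun w => inner ℝ (Y 0 w) t; P] = ‖t‖ ^ 2 := by
      rw [variance_of_integral_eq_zero (hY t).aestronglyMeasurable.aemeasurable (hmean t), hvar]
    simp only [ProbabilityMeasure.coe_mk, Measure.map_id, hv] at h2
    simp only [ProbabilityMeasure.coe_mk, map_pi_eq_stdGaussian, charFun_stdGaussian]
    have e1 : charFun (gaussianReal 0 (‖t‖ ^ 2).toNNReal) 1 = Complex.exp (-(‖t‖ : ℂ) ^ 2 / 2) := by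
      rw [charFun_gaussianReal]
      congr 1
      simp [neg_div]
    rw [e1] at h2
    refine h2.congr fun n => ?_
    rw [charFun_apply, charFun_apply, integral_map (hm n) (by fun_prop),
      integral_map (h1.forall_aemeasurable n) (by fun_prop)]
    congr 1 with w
    simp [hmean t, inner_smul_left, sum_inner]

omit [MeasurableSpace 𝒳] in
lemma sqrt_mul_empMean (F : 𝒳 → ℝ) (n : ℕ) (x : ℕ → 𝒳) :
    √n * empMean F (fun i : Fin n => x i) = (√n)⁻¹ * ∑ k ∈ Finset.range n, F (x k) := by
  rw [empMean, Finset.sum_range, ← mul_assoc]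
  congr 1
  rcases Nat.eq_zero_or_pos n with rfl | hn
  · simp
  · have : (0 : ℝ) < n := by exact_mod_cast hn
    have h2 := Real.mul_self_sqrt this.le
    have h3 := Real.sqrt_pos.2 this
    field_simp
    nlinarith

/-- Limit law of a diagonal quadratic form in standardized empirical means. -/
lemma tendstoInDistribution_quadratic [IsProbabilityMeasure P] (hX : ∀ i, Measurable (X i)) (hind : iIndepFun X P)
    (hlaw : ∀ i, P.map (X i) = ν) {p r : ℕ} {s : Fin p → 𝒳 → ℝ}
    (hs : ∀ k, Integrable (s k) ν) (hs0 : ∀ k, ∫ x, s k x ∂ν = 0)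
    (hs2 : ∀ k l, Integrable (fun x => s k x * s l x) ν) {V : Matrix (Fin p) (Fin p) ℝ}
    (hV : ∀ k l, ∫ x, s k x * s l x ∂ν = V k l) {T : Matrix (Fin r) (Fin p) ℝ}
    (hT : T * V * Tᵀ = 1) (ζ : Fin r → ℝ) :
    TendstoInDistribution (fun (n : ℕ) w => (n : ℝ) *
        ∑ i, ζ i * (T *ᵥ fun k => empMean (s k) (fun i : Fin n => X i w)) i ^ 2) atTop
      (fun z : Fin r → ℝ => ∑ i, ζ i * z i ^ 2) (fun _ => P)
      (Measure.pi fun _ => gaussianReal 0 1) := by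
  have hsm : ∀ k, AEMeasurable (s k) ν := fun k => (hs k).aestronglyMeasurable.aemeasurable
  -- The whitened vector `T s` has mean zero and covariance `T V Tᵀ = 1`. The limit is then a
  -- continuous function of a standard Gaussian vector.
  let F : 𝒳 → EuclideanSpace ℝ (Fin r) := fun x => WithLp.toLp 2 (T *ᵥ fun k => s k x)
  have hFm : AEMeasurable F ν := by
    refine (WithLp.measurable_toLp 2 _).comp_aemeasurable (aemeasurable_pi_lambda _ fun i => ?_)
    simp only [mulVec, dotProduct]
    exact Finset.aemeasurable_fun_sum _ fun k _ => (hsm k).const_mul _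
  have hin : ∀ t x, inner ℝ (F x) t = ∑ k, (∑ i, t i * T i k) * s k x := by
    intro t x
    simp only [F, PiLp.inner_apply, mulVec, dotProduct, RCLike.inner_apply, conj_trivial,
      Finset.mul_sum, Finset.sum_mul]
    rw [Finset.sum_comm]
    exact Finset.sum_congr rfl fun k _ => Finset.sum_congr rfl fun i _ => by ring
  have hint : ∀ t, Integrable (fun x => inner ℝ (F x) t) ν := fun t => by
    simp only [hin]
    exact integrable_finsetSum _ fun k _ => (hs k).const_mul _
  have hsq : ∀ t x, inner ℝ (F x) t ^ 2
      = ∑ k, ∑ l, (∑ i, t i * T i k) * (∑ i, t i * T i l) * (s k x * s l x) := by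
    intro t x
    rw [hin, pow_two, Finset.sum_mul_sum]
    exact Finset.sum_congr rfl fun k _ => Finset.sum_congr rfl fun i _ => by ring
  have hint2 : ∀ t, Integrable (fun x => inner ℝ (F x) t ^ 2) ν := fun t => by
    simp only [hsq]
    exact integrable_finsetSum _ fun k _ => integrable_finsetSum _ fun l _ =>
      (hs2 k l).const_mul _
  have hclt := tendstoInDistribution_stdGaussian (P := P) (Y := fun i w => F (X i w))
    (iIndepFun_comp hX hind hlaw hFm) (fun i => identDistrib_comp hX hlaw hFm i 0)
    (fun t => by
      have := integrable_comp_sample hX hlaw 0 (hint2 t)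
      exact (memLp_two_iff_integrable_sq
        (integrable_comp_sample hX hlaw 0 (hint t)).aestronglyMeasurable).2 this)
    (fun t => by
      rw [integral_comp_sample hX hlaw 0 (hint t).aestronglyMeasurable]
      simp only [hin]
      rw [integral_finsetSum _ fun k _ => (hs k).const_mul _]
      simp [integral_const_mul, hs0])
    (fun t => by
      rw [integral_comp_sample hX hlaw 0 (F := fun x => inner ℝ (F x) t ^ 2)
        (hint2 t).aestronglyMeasurable]
      simp only [hsq]
      rw [integral_finsetSum _ fun k _ => integrable_finsetSum _ fun l _ =>
        (hs2 k l).const_mul _]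
      simp only [integral_finsetSum _ fun l _ => (hs2 _ l).const_mul _, integral_const_mul, hV]
      have e : (Tᵀ *ᵥ t.ofLp) ⬝ᵥ (V *ᵥ (Tᵀ *ᵥ t.ofLp)) = ‖t‖ ^ 2 := by
        rw [mulVec_transpose, ← dotProduct_mulVec, ← mulVec_transpose, mulVec_mulVec, mulVec_mulVec,
          hT, one_mulVec, EuclideanSpace.real_norm_sq_eq, dotProduct]
        exact Finset.sum_congr rfl fun i _ => by ring
      rw [← e]
      simp only [dotProduct, mulVec, transpose_apply, mul_comm (T _ _)]
      refine Finset.sum_congr rfl fun k _ => ?_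
      rw [Finset.mul_sum]
      exact Finset.sum_congr rfl fun l _ => by ring)
  have hc : Continuous (fun y : EuclideanSpace ℝ (Fin r) => ∑ i, ζ i * y i ^ 2) := by fun_prop
  have := hclt.continuous_comp hc
  refine this.congr (fun n => ae_of_all _ fun w => ?_) (ae_of_all _ fun z => rfl)
  simp only [Function.comp, Finset.mul_sum]
  refine Finset.sum_congr rfl fun i _ => ?_
  have : ((√n)⁻¹ • ∑ k ∈ Finset.range n, F (X k w)) i
      = √n * (T *ᵥ fun k => empMean (s k) (fun i : Fin n => X i w)) i := by
    simp only [mulVec, dotProduct, Finset.mul_sum, PiLp.smul_apply, WithLp.ofLp_sum,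
      Finset.sum_apply, smul_eq_mul, F]
    rw [Finset.sum_comm]
    refine Finset.sum_congr rfl fun k _ => ?_
    rw [mul_left_comm, sqrt_mul_empMean (s k) n (fun i => X i w), Finset.mul_sum, Finset.mul_sum]
    exact Finset.sum_congr rfl fun j _ => by ring
  rw [this, mul_pow, Real.sq_sqrt (Nat.cast_nonneg n)]
  ring

/-- The minimum over `K` is attained, so it is at most `0` exactly when the values come below every
`1 / (m + 1)`; by continuity this can be tested on one countable dense subset, the same for all `x`.
-/
lemma measurableSet_exists_le {α E : Type*} [MeasurableSpace α] [PseudoMetricSpace E] {K : Set E}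
    (hK : IsCompact K) {F : α → E → ℝ} (hFm : ∀ k ∈ K, Measurable fun x => F x k)
    (hFc : ∀ x, ContinuousOn (F x) K) : MeasurableSet {x | ∃ k ∈ K, F x k ≤ 0} := by
  obtain ⟨D, hDK, hDc, hDd⟩ := hK.isSeparable.exists_countable_dense_subset
  have : {x | ∃ k ∈ K, F x k ≤ 0} = ⋂ m : ℕ, ⋃ d ∈ D, {x | F x d < 1 / ((m : ℝ) + 1)} := by
    ext x
    simp only [Set.mem_ofPred_eq, Set.mem_iInter, Set.mem_iUnion, exists_prop]
    constructor
    · rintro ⟨k, hk, hle⟩ m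
      have hpos : 0 < 1 / ((m : ℝ) + 1) := by positivity
      have hev : ∀ᶠ y in 𝓝[K] k, F x y < 1 / ((m : ℝ) + 1) :=
        (hFc x k hk).eventually_lt_const (hle.trans_lt hpos)
      obtain ⟨U, hU, hkU, hsub⟩ := mem_nhdsWithin.1 hev
      obtain ⟨y, hyU, hyD⟩ := mem_closure_iff.1 (hDd hk) U hU hkU
      exact ⟨y, hyD, hsub ⟨hyU, hDK hyD⟩⟩
    · intro h
      have hne : K.Nonempty := by
        obtain ⟨d, hd, -⟩ := h 0
        exact ⟨d, hDK hd⟩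
      obtain ⟨k, hk, hmin⟩ := hK.exists_isMinOn hne (hFc x)
      refine ⟨k, hk, le_of_forall_pos_lt_add fun ε hε => ?_⟩
      obtain ⟨m, hm⟩ := exists_nat_one_div_lt hε
      obtain ⟨d, hd, hlt⟩ := h m
      have := isMinOn_iff.1 hmin d (hDK hd)
      linarith
  rw [this]
  refine MeasurableSet.iInter fun m => MeasurableSet.biUnion hDc fun d hd => ?_
  exact measurableSet_lt (hFm d (hDK hd)) measurable_const

/-- A measurable choice of minimizers of a Carathéodory function over a compact set. -/
lemma exists_measurable_argmin {α : Type*} [MeasurableSpace α] {p : ℕ}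
    {K : Set (EuclideanSpace ℝ (Fin p))} (hK : IsCompact K) (hne : K.Nonempty)
    {F : α → EuclideanSpace ℝ (Fin p) → ℝ} (hFm : ∀ k ∈ K, Measurable fun x => F x k)
    (hFc : ∀ x, ContinuousOn (F x) K) :
    ∃ s : α → EuclideanSpace ℝ (Fin p), Measurable s ∧
      ∀ x, s x ∈ K ∧ ∀ k ∈ K, F x (s x) ≤ F x k := by
  -- Ties are broken lexicographically. The zeros of `G x` are minimizers of `F x`, and any two of
  -- them agree in the first `j` coordinates. For `j = p` there is exactly one zero, and the set
  -- where it falls into a closed `C` has the form treated in `measurableSet_exists_le`.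
  have key : ∀ j : ℕ, ∃ G : α → EuclideanSpace ℝ (Fin p) → ℝ,
      (∀ k ∈ K, Measurable fun x => G x k) ∧ (∀ x, ContinuousOn (G x) K) ∧
      (∀ x, ∀ k ∈ K, 0 ≤ G x k) ∧ (∀ x, ∃ k ∈ K, G x k = 0) ∧
      (∀ x, ∀ k ∈ K, G x k = 0 → ∀ k' ∈ K, F x k ≤ F x k') ∧
      ∀ x, ∀ k ∈ K, ∀ k' ∈ K, G x k = 0 → G x k' = 0 → ∀ i : Fin p, i.1 < j → k i = k' i := by
    intro j
    induction j with
    | zero =>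
      have hex : ∀ x, ∃ k ∈ K, ∀ k' ∈ K, F x k ≤ F x k' := fun x => by
        obtain ⟨k, hk, hmin⟩ := hK.exists_isMinOn hne (hFc x)
        exact ⟨k, hk, isMinOn_iff.1 hmin⟩
      choose k₀ hk₀ hmin using hex
      refine ⟨fun x k => F x k - F x (k₀ x), fun k hk => (hFm k hk).sub ?_,
        fun x => (hFc x).sub continuousOn_const, fun x k hk => sub_nonneg.2 (hmin x k hk),
        fun x => ⟨k₀ x, hk₀ x, sub_self _⟩, fun x k hk h k' hk' => ?_,
        fun _ _ _ _ _ _ _ i hi => absurd hi (Nat.not_lt_zero _)⟩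
      · refine measurable_of_Iic fun c => ?_
        have : (fun x => F x (k₀ x)) ⁻¹' Set.Iic c = {x | ∃ k ∈ K, F x k - c ≤ 0} := by
          ext x
          simp only [Set.mem_preimage, Set.mem_Iic, Set.mem_ofPred_eq, sub_nonpos]
          exact ⟨fun h => ⟨_, hk₀ x, h⟩, fun ⟨k, hk, h⟩ => (hmin x k hk).trans h⟩
        rw [this]
        exact measurableSet_exists_le hK (fun k hk => (hFm k hk).sub_const c)
          fun x => (hFc x).sub continuousOn_const
      · have := hmin x k' hk'
        linarith
    | succ j ih =>
      obtain ⟨G, hGm, hGc, hG0, hGe, hGF, hGu⟩ := ih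
      by_cases hj : j < p
      swap
      · exact ⟨G, hGm, hGc, hG0, hGe, hGF, fun x k hk k' hk' h h' i hi =>
          hGu x k hk k' hk' h h' i (by have := i.2; omega)⟩
      have hcoord : Continuous fun k : EuclideanSpace ℝ (Fin p) => k ⟨j, hj⟩ := by fun_prop
      have hex : ∀ x, ∃ k ∈ K, G x k = 0 ∧ ∀ k' ∈ K, G x k' = 0 → k ⟨j, hj⟩ ≤ k' ⟨j, hj⟩ := by
        intro x
        have hZ : IsCompact (K ∩ G x ⁻¹' {0}) := by
          refine hK.of_isClosed_subset ?_ Set.inter_subset_left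
          exact (hGc x).preimage_isClosed_of_isClosed hK.isClosed isClosed_singleton
        obtain ⟨k₁, hk₁, h₁⟩ := hGe x
        obtain ⟨k, hk, hmin⟩ := hZ.exists_isMinOn ⟨k₁, hk₁, h₁⟩ hcoord.continuousOn
        exact ⟨k, hk.1, hk.2, fun k' hk' h' => isMinOn_iff.1 hmin k' ⟨hk', h'⟩⟩
      choose k₀ hk₀ hz₀ hmin using hex
      have hmeas : Measurable fun x => k₀ x ⟨j, hj⟩ := by
        refine measurable_of_Iic fun c => ?_
        have : (fun x => k₀ x ⟨j, hj⟩) ⁻¹' Set.Iic c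
            = {x | ∃ k ∈ K ∩ {k | k ⟨j, hj⟩ ≤ c}, G x k ≤ 0} := by
          ext x
          simp only [Set.mem_preimage, Set.mem_Iic, Set.mem_ofPred_eq, Set.mem_inter_iff]
          exact ⟨fun h => ⟨_, ⟨hk₀ x, h⟩, (hz₀ x).le⟩, fun ⟨k, ⟨hk, hc⟩, h⟩ =>
            (hmin x k hk (le_antisymm h (hG0 x k hk))).trans hc⟩
        rw [this]
        exact measurableSet_exists_le (hK.inter_right (isClosed_le hcoord continuous_const))
          (fun k hk => hGm k hk.1) fun x => (hGc x).mono Set.inter_subset_left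
      have hz : ∀ x, ∀ k ∈ K, G x k + |k ⟨j, hj⟩ - k₀ x ⟨j, hj⟩| = 0 →
          G x k = 0 ∧ k ⟨j, hj⟩ = k₀ x ⟨j, hj⟩ := by
        intro x k hk h
        have h1 := hG0 x k hk
        have h2 := abs_nonneg (k ⟨j, hj⟩ - k₀ x ⟨j, hj⟩)
        exact ⟨by linarith, sub_eq_zero.1 (abs_eq_zero.1 (by linarith))⟩
      -- Among the zeros of the previous `G x`, the added term keeps those with the least `j`-th
      -- coordinate. That least value is measurable in `x` because its sublevel sets are again
      -- existence statements over compact sets.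
      refine ⟨fun x k => G x k + |k ⟨j, hj⟩ - k₀ x ⟨j, hj⟩|, fun k hk => (hGm k hk).add ?_,
        fun x => (hGc x).add (by fun_prop), fun x k hk => add_nonneg (hG0 x k hk) (abs_nonneg _),
        fun x => ⟨k₀ x, hk₀ x, by simp [hz₀ x]⟩, fun x k hk h => hGF x k hk (hz x k hk h).1, ?_⟩
      · exact (measurable_const.sub hmeas).abs
      · intro x k hk k' hk' h h' i hi
        rcases Nat.lt_succ_iff_lt_or_eq.1 hi with h1 | h1
        · exact hGu x k hk k' hk' (hz x k hk h).1 (hz x k' hk' h').1 i h1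
        · obtain rfl : i = ⟨j, hj⟩ := Fin.ext h1
          rw [(hz x k hk h).2, (hz x k' hk' h').2]
  obtain ⟨G, hGm, hGc, hG0, hGe, hGF, hGu⟩ := key p
  choose s hs hs0 using hGe
  refine ⟨s, measurable_of_isClosed fun C hC => ?_, fun x => ⟨hs x, hGF x _ (hs x) (hs0 x)⟩⟩
  have : s ⁻¹' C = {x | ∃ k ∈ K ∩ C, G x k ≤ 0} := by
    ext x
    simp only [Set.mem_preimage, Set.mem_ofPred_eq, Set.mem_inter_iff]
    refine ⟨fun h => ⟨_, ⟨hs x, h⟩, (hs0 x).le⟩, fun ⟨k, ⟨hk, hkC⟩, h⟩ => ?_⟩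
    have : s x = k := by
      ext i
      exact hGu x _ (hs x) k hk (hs0 x) (le_antisymm h (hG0 x k hk)) i i.2
    rwa [this]
  rw [this]
  exact measurableSet_exists_le (hK.inter_right hC) (fun k hk => hGm k hk.1)
    fun x => (hGc x).mono Set.inter_subset_left

end Probability

/-! ### Taylor expansions along segments, and their averages over a sample. -/

section Expansion

variable {p r : ℕ}

/-- The mean value inequality applied to `φ` minus its quadratic model. The case `β = 0` gives
first-order expansions and `α = β = 0` plain increments, so this one estimate serves all orders. -/
lemma line_taylor {φ φ' : ℝ → ℝ} {α β K : ℝ}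
    (hφ : ∀ t ∈ Set.Icc (0 : ℝ) 1, HasDerivAt φ (φ' t) t)
    (hb : ∀ t ∈ Set.Icc (0 : ℝ) 1, |φ' t - α - t * β| ≤ K) :
    |φ 1 - φ 0 - α - β / 2| ≤ K := by
  have h := norm_image_sub_le_of_norm_deriv_le_segment_01' (f := fun t => φ t - α * t - β * t ^ 2 / 2)
    (f' := fun t => φ' t - α - t * β) (C := K) (fun t ht => ?_)
    (fun t ht => hb t ⟨ht.1, ht.2.le⟩)
  · rw [Real.norm_eq_abs] at h
    convert h using 2
    ring
  · refine HasDerivAt.hasDerivWithinAt ?_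
    have h1 := (hφ t ht).sub ((hasDerivAt_id t).const_mul α)
    have h2 := h1.sub ((((hasDerivAt_id t).pow 2).const_mul β).div_const 2)
    convert! h2 using 1
    simp; ring

lemma fderiv_eq_sum_pderiv (F : EuclideanSpace ℝ (Fin p) → ℝ) (θ d : EuclideanSpace ℝ (Fin p)) :
    fderiv ℝ F θ d = ∑ k, pderiv k F θ * d k := by
  have hd : d = ∑ k, d k • EuclideanSpace.single k (1 : ℝ) := by
    ext i
    simp [Finset.sum_apply, Pi.single_apply]
  conv_lhs => rw [hd]
  simp [pderiv, mul_comm]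

lemma hasDerivAt_line {F : EuclideanSpace ℝ (Fin p) → ℝ} {θ d : EuclideanSpace ℝ (Fin p)} {t : ℝ}
    (hF : DifferentiableAt ℝ F (θ + t • d)) :
    HasDerivAt (fun s : ℝ => F (θ + s • d)) (∑ k, pderiv k F (θ + t • d) * d k) t := by
  rw [← fderiv_eq_sum_pderiv]
  have h1 : HasDerivAt (fun s : ℝ => θ + s • d) d t := by
    simpa using ((hasDerivAt_id t).smul_const d).const_add θ
  exact hF.hasFDerivAt.comp_hasDerivAt t h1

lemma abs_coord_le (d : EuclideanSpace ℝ (Fin p)) (k : Fin p) : |d k| ≤ ‖d‖ :=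
  PiLp.norm_apply_le d k

lemma norm_ofLp_le (d : EuclideanSpace ℝ (Fin p)) : ‖d.ofLp‖ ≤ ‖d‖ :=
  (pi_norm_le_iff_of_nonneg (norm_nonneg _)).2 fun k => abs_coord_le d k

lemma exists_norm_le_ofLp (p : ℕ) :
    ∃ C : ℝ, 0 < C ∧ ∀ d : EuclideanSpace ℝ (Fin p), ‖d‖ ≤ C * ‖d.ofLp‖ := by
  let e := (EuclideanSpace.equiv (Fin p) ℝ).symm.toContinuousLinearMap
  refine ⟨‖e‖ + 1, by positivity, fun d => ?_⟩
  have h : ‖d‖ ≤ ‖e‖ * ‖d.ofLp‖ := e.le_opNorm d.ofLp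
  nlinarith [norm_nonneg d.ofLp]

lemma abs_sum_mul_le {ι : Type*} [Fintype ι] {a c : ι → ℝ} {A C : ℝ} (ha : ∀ i, |a i| ≤ A)
    (hc : ∀ i, |c i| ≤ C) (hA : 0 ≤ A) : |∑ i, a i * c i| ≤ Fintype.card ι * (A * C) := by
  refine (Finset.abs_sum_le_sum_abs _ _).trans ?_
  rw [← nsmul_eq_mul, ← Finset.card_univ]
  refine Finset.sum_le_card_nsmul _ _ _ fun i _ => ?_
  rw [abs_mul]
  exact mul_le_mul (ha i) (hc i) (abs_nonneg _) hA

/-- Second-order behaviour of a loss `L` on the ball of radius `δ` about `θ₀`: `g` and `b` are its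
gradient and Hessian at `θ₀`, and `M` controls the remainders. -/
structure LocalExpansion (L : EuclideanSpace ℝ (Fin p) → ℝ) (θ₀ : EuclideanSpace ℝ (Fin p)) (δ : ℝ)
    (g : Fin p → ℝ) (b : Matrix (Fin p) (Fin p) ℝ) (M : ℝ) : Prop where
  contDiffAt : ∀ θ ∈ Metric.ball θ₀ δ, ContDiffAt ℝ 1 L θ
  value : ∀ θ ∈ Metric.ball θ₀ δ,
    |L θ - L θ₀ - ∑ k, g k * (θ - θ₀) k - (∑ k, (∑ l, b k l * (θ - θ₀) l) * (θ - θ₀) k) / 2|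
      ≤ M * ‖θ - θ₀‖ ^ 3
  grad : ∀ θ ∈ Metric.ball θ₀ δ, ∀ k,
    |pderiv k L θ - g k - ∑ l, b k l * (θ - θ₀) l| ≤ M * ‖θ - θ₀‖ ^ 2

/-- The bound on third derivatives is integrated three times along the segment from `θ₀`: it bounds
the increment of the Hessian, then the remainder of the gradient, then that of the value. Each pass
costs a factor `p` from the sum over coordinates; `(p + 1) ^ 3` covers both `p ^ 2` and `p ^ 3`. -/
lemma localExpansion_of_third_bound {L : EuclideanSpace ℝ (Fin p) → ℝ}
    {θ₀ : EuclideanSpace ℝ (Fin p)} {δ m : ℝ}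
    (h0 : ∀ θ ∈ Metric.ball θ₀ δ, ContDiffAt ℝ 1 L θ)
    (h1 : ∀ θ ∈ Metric.ball θ₀ δ, ∀ k, DifferentiableAt ℝ (pderiv k L) θ)
    (h2 : ∀ θ ∈ Metric.ball θ₀ δ, ∀ l k, DifferentiableAt ℝ (pderiv l (pderiv k L)) θ)
    (hm0 : 0 ≤ m)
    (hm : ∀ θ ∈ Metric.ball θ₀ δ, ∀ j l k, |pderiv j (pderiv l (pderiv k L)) θ| ≤ m) :
    LocalExpansion L θ₀ δ (fun k => pderiv k L θ₀)
      (Matrix.of fun k l => pderiv l (pderiv k L) θ₀) (((p : ℝ) + 1) ^ 3 * m) := by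
  have hseg : ∀ θ ∈ Metric.ball θ₀ δ, ∀ t ∈ Set.Icc (0 : ℝ) 1,
      θ₀ + t • (θ - θ₀) ∈ Metric.ball θ₀ δ := by
    intro θ hθ t ht
    rw [Metric.mem_ball, dist_eq_norm] at hθ ⊢
    rw [add_sub_cancel_left, norm_smul, Real.norm_eq_abs, abs_of_nonneg ht.1]
    nlinarith [norm_nonneg (θ - θ₀), ht.2]
  have hnorm : ∀ (θ : EuclideanSpace ℝ (Fin p)), ∀ t ∈ Set.Icc (0 : ℝ) 1,
      ‖(θ₀ + t • (θ - θ₀)) - θ₀‖ ≤ ‖θ - θ₀‖ := by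
    intro θ t ht
    rw [add_sub_cancel_left, norm_smul, Real.norm_eq_abs, abs_of_nonneg ht.1]
    nlinarith [norm_nonneg (θ - θ₀), ht.2]
  have e1 : ∀ θ : EuclideanSpace ℝ (Fin p), θ₀ + (1 : ℝ) • (θ - θ₀) = θ := fun θ => by simp
  have e0 : ∀ θ : EuclideanSpace ℝ (Fin p), θ₀ + (0 : ℝ) • (θ - θ₀) = θ₀ := fun θ => by simp
  have s2 : ∀ θ ∈ Metric.ball θ₀ δ, ∀ l k,
      |pderiv l (pderiv k L) θ - pderiv l (pderiv k L) θ₀| ≤ p * (m * ‖θ - θ₀‖) := by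
    intro θ hθ l k
    have := line_taylor (α := 0) (β := 0) (K := p * (m * ‖θ - θ₀‖))
      (fun t ht => hasDerivAt_line (d := θ - θ₀) (h2 _ (hseg θ hθ t ht) l k)) (fun t ht => by
        have := abs_sum_mul_le (fun j => hm _ (hseg θ hθ t ht) j l k)
          (fun j => abs_coord_le (θ - θ₀) j) hm0
        simpa using this)
    simpa [e1, e0] using this
  have s1 : ∀ θ ∈ Metric.ball θ₀ δ, ∀ k,
      |pderiv k L θ - pderiv k L θ₀ - ∑ l, pderiv l (pderiv k L) θ₀ * (θ - θ₀) l|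
        ≤ p * (p * (m * ‖θ - θ₀‖) * ‖θ - θ₀‖) := by
    intro θ hθ k
    have := line_taylor (α := ∑ l, pderiv l (pderiv k L) θ₀ * (θ - θ₀) l) (β := 0)
      (K := p * (p * (m * ‖θ - θ₀‖) * ‖θ - θ₀‖))
      (fun t ht => hasDerivAt_line (d := θ - θ₀) (h1 _ (hseg θ hθ t ht) k)) (fun t ht => by
        rw [mul_zero, sub_zero, ← Finset.sum_sub_distrib]
        simp only [← sub_mul]
        have := abs_sum_mul_le (fun l => (s2 _ (hseg θ hθ t ht) l k).trans
          (show _ ≤ (p : ℝ) * (m * ‖θ - θ₀‖) by gcongr; exact hnorm θ t ht))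
          (fun j => abs_coord_le (θ - θ₀) j) (by positivity)
        simpa using this)
    simpa [e1, e0] using this
  refine ⟨h0, fun θ hθ => ?_, fun θ hθ k => ?_⟩
  · set d := θ - θ₀ with hd
    have := line_taylor (α := ∑ k, pderiv k L θ₀ * d k)
      (β := ∑ k, (∑ l, pderiv l (pderiv k L) θ₀ * d l) * d k)
      (K := p * (p * (p * (m * ‖d‖) * ‖d‖) * ‖d‖))
      (fun t ht => hasDerivAt_line (d := d)
        ((h0 _ (hseg θ hθ t ht)).differentiableAt (by norm_num))) (fun t ht => by
        have e : ∑ k, pderiv k L (θ₀ + t • d) * d k - ∑ k, pderiv k L θ₀ * d k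
            - t * ∑ k, (∑ l, pderiv l (pderiv k L) θ₀ * d l) * d k
            = ∑ k, (pderiv k L (θ₀ + t • d) - pderiv k L θ₀
                - ∑ l, pderiv l (pderiv k L) θ₀ * ((θ₀ + t • d) - θ₀) l) * d k := by
          rw [Finset.mul_sum, ← Finset.sum_sub_distrib, ← Finset.sum_sub_distrib]
          refine Finset.sum_congr rfl fun k _ => ?_
          rw [add_sub_cancel_left]
          have : ∑ l, pderiv l (pderiv k L) θ₀ * (t • d) l
              = t * ∑ l, pderiv l (pderiv k L) θ₀ * d l := by
            rw [Finset.mul_sum]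
            exact Finset.sum_congr rfl fun l _ => by simp; ring
          rw [this]; ring
        rw [e]
        have hn := hnorm θ t ht
        rw [← hd] at hn
        have := abs_sum_mul_le (fun k => (s1 _ (hseg θ hθ t ht) k).trans
          (show _ ≤ (p : ℝ) * (p * (m * ‖d‖) * ‖d‖) by rw [← hd]; gcongr))
          (fun j => abs_coord_le d j) (by positivity)
        rw [Fintype.card_fin] at this
        exact this)
    rw [hd, e1, e0] at this
    refine this.trans ?_
    rw [← hd]
    have hp : (p : ℝ) ^ 3 ≤ ((p : ℝ) + 1) ^ 3 := by gcongr; linarith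
    calc p * (p * (p * (m * ‖d‖) * ‖d‖) * ‖d‖) = (p : ℝ) ^ 3 * (m * ‖d‖ ^ 3) := by ring
      _ ≤ ((p : ℝ) + 1) ^ 3 * (m * ‖d‖ ^ 3) := by gcongr
      _ = _ := by ring
  · refine (s1 θ hθ k).trans ?_
    have hp : (p : ℝ) ^ 2 ≤ ((p : ℝ) + 1) ^ 3 := by nlinarith [Nat.cast_nonneg (α := ℝ) p]
    calc p * (p * (m * ‖θ - θ₀‖) * ‖θ - θ₀‖) = (p : ℝ) ^ 2 * (m * ‖θ - θ₀‖ ^ 2) := by ring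
      _ ≤ ((p : ℝ) + 1) ^ 3 * (m * ‖θ - θ₀‖ ^ 2) := by gcongr
      _ = _ := by ring

lemma pderiv_empMean {𝒳 : Type*} {ℓ : EuclideanSpace ℝ (Fin p) → 𝒳 → ℝ} {n : ℕ} {x : Fin n → 𝒳}
    {θ : EuclideanSpace ℝ (Fin p)} (hℓ : ∀ i, DifferentiableAt ℝ (fun t => ℓ t (x i)) θ)
    (k : Fin p) : pderiv k (fun t => empMean (ℓ t) x) θ
      = empMean (fun y => pderiv k (fun t => ℓ t y) θ) x := by
  simp only [pderiv, empMean]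
  rw [fderiv_const_mul (by fun_prop), fderiv_fun_sum fun i _ => hℓ i]
  simp

lemma abs_empMean_le {𝒳 : Type*} {n : ℕ} {x : Fin n → 𝒳} {F G : 𝒳 → ℝ}
    (h : ∀ i, |F (x i)| ≤ G (x i)) : |empMean F x| ≤ empMean G x := by
  rw [empMean, empMean, abs_mul, abs_of_nonneg (by positivity)]
  gcongr
  exact (Finset.abs_sum_le_sum_abs _ _).trans (Finset.sum_le_sum fun i _ => h i)

/-- Expansions are linear in the loss and remainders obey the triangle inequality, so gradient,
Hessian and remainder constant of the objective are empirical means, to which the law of large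
numbers applies. -/
lemma LocalExpansion.empMean {𝒳 : Type*} {ℓ : EuclideanSpace ℝ (Fin p) → 𝒳 → ℝ}
    {θ₀ : EuclideanSpace ℝ (Fin p)} {δ : ℝ} {g : Fin p → 𝒳 → ℝ} {b : Fin p → Fin p → 𝒳 → ℝ}
    {M : 𝒳 → ℝ} {n : ℕ} {x : Fin n → 𝒳}
    (h : ∀ i, LocalExpansion (fun t => ℓ t (x i)) θ₀ δ (fun k => g k (x i))
      (Matrix.of fun k l => b k l (x i)) (M (x i))) :
    LocalExpansion (fun t => SDT.empMean (ℓ t) x) θ₀ δ (fun k => SDT.empMean (g k) x)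
      (Matrix.of fun k l => SDT.empMean (b k l) x) (SDT.empMean M x) := by
  refine ⟨fun θ hθ => ?_, fun θ hθ => ?_, fun θ hθ k => ?_⟩
  · simp only [SDT.empMean]
    exact contDiffAt_const.mul (ContDiffAt.sum fun i _ => (h i).contDiffAt θ hθ)
  · have := abs_empMean_le (x := x) (F := fun y => ℓ θ y - ℓ θ₀ y - ∑ k, g k y * (θ - θ₀) k
      - (∑ k, (∑ l, b k l y * (θ - θ₀) l) * (θ - θ₀) k) / 2)
      (G := fun y => M y * ‖θ - θ₀‖ ^ 3) (fun i => (h i).value θ hθ)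
    convert this using 2
    · simp only [SDT.empMean, of_apply, Finset.sum_sub_distrib, mul_sub, ← Finset.sum_div]
      rw [Finset.sum_comm (γ := Fin n), Finset.sum_comm (γ := Fin n)]
      congr 1
      · congr 1
        rw [Finset.mul_sum]
        refine Finset.sum_congr rfl fun k _ => ?_
        rw [mul_assoc, Finset.sum_mul]
      · rw [← mul_div_assoc, Finset.mul_sum]
        congr 1
        refine Finset.sum_congr rfl fun k _ => ?_
        rw [← Finset.sum_mul, ← mul_assoc]
        congr 1
        rw [Finset.sum_comm, Finset.mul_sum]
        refine Finset.sum_congr rfl fun l _ => ?_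
        rw [mul_assoc, Finset.sum_mul]
    · simp only [SDT.empMean, ← Finset.sum_mul]; ring
  · rw [pderiv_empMean fun i => ((h i).contDiffAt θ hθ).differentiableAt (by norm_num)]
    have := abs_empMean_le (x := x)
      (F := fun y => pderiv k (fun t => ℓ t y) θ - g k y - ∑ l, b k l y * (θ - θ₀) l)
      (G := fun y => M y * ‖θ - θ₀‖ ^ 2) (fun i => (h i).grad θ hθ k)
    convert this using 2
    · simp only [SDT.empMean, of_apply, Finset.sum_sub_distrib, mul_sub]
      congr 1
      rw [Finset.sum_comm, Finset.mul_sum]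
      refine Finset.sum_congr rfl fun l _ => ?_
      rw [mul_assoc, Finset.sum_mul]
    · simp only [SDT.empMean, ← Finset.sum_mul]; ring

end Expansion

/-! ### Deterministic behaviour of roots and minimizers near the true parameter. -/

section Estimation

variable {p r : ℕ}

lemma fderiv_apply_coord_eq {h : EuclideanSpace ℝ (Fin p) → EuclideanSpace ℝ (Fin r)}
    (θ d : EuclideanSpace ℝ (Fin p)) : (fderiv ℝ h θ d).ofLp = (Hmat h θ)ᵀ *ᵥ d.ofLp := by
  have hd : d = ∑ k, d k • EuclideanSpace.single k (1 : ℝ) := by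
    ext i
    simp [Finset.sum_apply, Pi.single_apply]
  ext k
  conv_lhs => rw [hd]
  simp [Hmat, mulVec, dotProduct, mul_comm]

lemma norm_Hmat_sub_mulVec_le {h : EuclideanSpace ℝ (Fin p) → EuclideanSpace ℝ (Fin r)}
    (θ θ₀ : EuclideanSpace ℝ (Fin p)) (m : Fin r → ℝ) :
    ‖(Hmat h θ - Hmat h θ₀) *ᵥ m‖ ≤ r * (‖fderiv ℝ h θ - fderiv ℝ h θ₀‖ * ‖m‖) := by
  refine (pi_norm_le_iff_of_nonneg (by positivity)).2 fun j => ?_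
  have := abs_sum_mul_le (a := fun k => (Hmat h θ - Hmat h θ₀) j k) (c := m)
    (A := ‖fderiv ℝ h θ - fderiv ℝ h θ₀‖) (C := ‖m‖) (fun k => ?_) (fun k => norm_le_pi_norm m k)
    (norm_nonneg _)
  · rw [Fintype.card_fin] at this
    exact this
  · have e : (Hmat h θ - Hmat h θ₀) j k
        = ((fderiv ℝ h θ - fderiv ℝ h θ₀) (EuclideanSpace.single j 1)) k := by
      simp [Hmat]
    rw [e]
    refine (abs_coord_le _ k).trans ((ContinuousLinearMap.le_opNorm _ _).trans ?_)
    simp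

lemma eventually_Hmat_close {h : EuclideanSpace ℝ (Fin p) → EuclideanSpace ℝ (Fin r)}
    {θ₀ : EuclideanSpace ℝ (Fin p)} (hh : ContDiffAt ℝ 1 h θ₀) {η : ℝ} (hη : 0 < η) :
    ∀ᶠ θ in 𝓝 θ₀, ∀ m, ‖(Hmat h θ - Hmat h θ₀) *ᵥ m‖ ≤ η * ‖m‖ := by
  have hc : ContinuousAt (fderiv ℝ h) θ₀ := (hh.fderiv_right (m := 0) (by norm_num)).continuousAt
  have : ∀ᶠ θ in 𝓝 θ₀, ‖fderiv ℝ h θ - fderiv ℝ h θ₀‖ < η / (r + 1) := by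
    have := Metric.continuousAt_iff'.1 hc (η / (r + 1)) (by positivity)
    simpa [dist_eq_norm] using this
  filter_upwards [this] with θ hθ m
  refine (norm_Hmat_sub_mulVec_le θ θ₀ m).trans ?_
  rw [← mul_assoc]
  gcongr
  rw [lt_div_iff₀ (by positivity)] at hθ
  nlinarith [norm_nonneg (fderiv ℝ h θ - fderiv ℝ h θ₀)]

/-- On the constraint set the increment of `h` is zero, so the linear part equals the remainder
`o(‖θ - θ₀‖)`: the displacement is almost tangent. -/
lemma eventually_Hmat_transpose_small {h : EuclideanSpace ℝ (Fin p) → EuclideanSpace ℝ (Fin r)}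
    {θ₀ : EuclideanSpace ℝ (Fin p)} (hh : ContDiffAt ℝ 1 h θ₀) (h0 : h θ₀ = 0) {η : ℝ}
    (hη : 0 < η) :
    ∀ᶠ θ in 𝓝 θ₀, h θ = 0 → ‖(Hmat h θ₀)ᵀ *ᵥ (θ - θ₀).ofLp‖ ≤ η * ‖(θ - θ₀).ofLp‖ := by
  obtain ⟨C, hC, hCb⟩ := exists_norm_le_ofLp p
  have hd := (hh.differentiableAt (by norm_num)).hasFDerivAt.isLittleO
  filter_upwards [hd.def (show 0 < η / C by positivity)] with θ hθ hz
  rw [hz, h0, sub_zero, zero_sub, norm_neg] at hθ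
  rw [← fderiv_apply_coord_eq]
  refine (norm_ofLp_le _).trans (hθ.trans ?_)
  calc η / C * ‖θ - θ₀‖ ≤ η / C * (C * ‖(θ - θ₀).ofLp‖) := by gcongr; exact hCb _
    _ = _ := by field_simp

/-- Linear representation of a root of the restricted estimating equations near `θ₀`. -/
lemma exists_representation {J : Matrix (Fin p) (Fin p) ℝ} (hJ : J.PosDef)
    {h : EuclideanSpace ℝ (Fin p) → EuclideanSpace ℝ (Fin r)} {θ₀ : EuclideanSpace ℝ (Fin p)}
    (hh : ContDiffAt ℝ 1 h θ₀) (h0 : h θ₀ = 0) (hrank : (Hmat h θ₀).rank = r) {c M₀ δ ε : ℝ}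
    (hc : 0 < c) (hM₀ : 0 ≤ M₀) (hδ : 0 < δ) (hε : 0 < ε) :
    ∃ η > 0, ∀ (L : EuclideanSpace ℝ (Fin p) → ℝ) (g : Fin p → ℝ) (b : Matrix (Fin p) (Fin p) ℝ)
      (M : ℝ), LocalExpansion L θ₀ δ g b M → M ≤ M₀ → (∀ k l, |b k l - c * J k l| ≤ η) →
      ∀ θ, ‖θ - θ₀‖ < η → h θ = 0 → ∀ m : Fin r → ℝ,
        (fun k => -(1 / c) * pderiv k L θ) + Hmat h θ *ᵥ m = 0 →
        ‖(θ - θ₀).ofLp - (J⁻¹ - projMat J (Hmat h θ₀)) *ᵥ (fun k => -(1 / c) * g k)‖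
          ≤ ε * ‖fun k => -(1 / c) * g k‖ := by
  obtain ⟨η₁, hη₁, hsol⟩ := exists_restricted_solution_bound hJ hrank hε
  obtain ⟨C, hC, hCb⟩ := exists_norm_le_ofLp p
  obtain ⟨ρ₁, hρ₁, hH⟩ := Metric.eventually_nhds_iff.1 (eventually_Hmat_close hh hη₁)
  obtain ⟨ρ₂, hρ₂, hT⟩ := Metric.eventually_nhds_iff.1 (eventually_Hmat_transpose_small hh h0 hη₁)
  -- `M₀ * C` accounts for the Taylor remainder of the gradient, `p` for the error of the Hessian.
  -- With `η * D ≤ η₁ * c` the residual of the linearised system is at most `η₁ * ‖d‖`.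
  set D := M₀ * C + p + 1 with hD
  have hDpos : 0 < D := by positivity
  refine ⟨min (min ρ₁ ρ₂) (min δ (η₁ * c / D)), by positivity, ?_⟩
  set η := min (min ρ₁ ρ₂) (min δ (η₁ * c / D)) with hη
  have i1 : η ≤ ρ₁ := (min_le_left _ _).trans (min_le_left _ _)
  have i2 : η ≤ ρ₂ := (min_le_left _ _).trans (min_le_right _ _)
  have i3 : η ≤ δ := (min_le_right _ _).trans (min_le_left _ _)
  have i4 : η * D ≤ η₁ * c := by
    rw [← le_div_iff₀ hDpos]
    exact (min_le_right _ _).trans (min_le_right _ _)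
  have hη0 : 0 < η := by positivity
  intro L g b M hL hM hb θ hθ hhθ m hm
  have hdist : dist θ θ₀ < η := by rwa [dist_eq_norm]
  refine hsol _ _ m (Hmat h θ) ?_ (hH (hdist.trans_le i1)) (hT (hdist.trans_le i2) hhθ)
  set d := θ - θ₀ with hd
  refine (pi_norm_le_iff_of_nonneg (by positivity)).2 fun k => ?_
  have hmk := congrFun hm k
  simp only [Pi.add_apply, Pi.zero_apply] at hmk
  have e : (J *ᵥ d.ofLp - (fun k => -(1 / c) * g k) - Hmat h θ *ᵥ m) k
      = -(1 / c) * ((pderiv k L θ - g k - ∑ l, b k l * d l)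
        + ∑ l, (b k l - c * J k l) * d l) := by
    have : ∑ l, (b k l - c * J k l) * d l = ∑ l, b k l * d l - c * ∑ l, J k l * d l := by
      rw [Finset.mul_sum, ← Finset.sum_sub_distrib]
      exact Finset.sum_congr rfl fun l _ => by ring
    rw [this]
    simp only [Pi.sub_apply, mulVec, dotProduct] at hmk ⊢
    rw [eq_neg_of_add_eq_zero_right hmk]
    field_simp
    ring
  rw [e, Real.norm_eq_abs, abs_mul, abs_neg, abs_of_pos (by positivity : 0 < 1 / c)]
  have b1 := hL.grad θ (by rw [Metric.mem_ball]; exact hdist.trans_le i3) k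
  rw [← hd] at b1
  have b2 := abs_sum_mul_le (hb k) (fun l => norm_le_pi_norm d.ofLp l) hη0.le
  rw [Fintype.card_fin] at b2
  have b3 : M * ‖d‖ ^ 2 ≤ M₀ * (η * (C * ‖d.ofLp‖)) := by
    calc M * ‖d‖ ^ 2 ≤ M₀ * ‖d‖ ^ 2 := by gcongr
      _ = M₀ * (‖d‖ * ‖d‖) := by ring
      _ ≤ M₀ * (η * (C * ‖d.ofLp‖)) := by
        gcongr
        exact hCb d
  calc 1 / c * |(pderiv k L θ - g k - ∑ l, b k l * d l) + ∑ l, (b k l - c * J k l) * d l|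
      ≤ 1 / c * (M₀ * (η * (C * ‖d.ofLp‖)) + p * (η * ‖d.ofLp‖)) := by
        gcongr
        exact (abs_add_le _ _).trans (add_le_add (b1.trans b3) b2)
    _ ≤ 1 / c * ((η * D) * ‖d.ofLp‖) := by
        gcongr
        rw [hD]
        nlinarith [norm_nonneg d.ofLp]
    _ ≤ 1 / c * ((η₁ * c) * ‖d.ofLp‖) := by gcongr
    _ = η₁ * ‖d.ofLp‖ := by field_simp

/-- Lagrange multipliers at a constrained local minimizer close to `θ₀`. -/
lemma exists_multiplier {h : EuclideanSpace ℝ (Fin p) → EuclideanSpace ℝ (Fin r)}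
    {θ₀ : EuclideanSpace ℝ (Fin p)} (hh : ContDiffAt ℝ 1 h θ₀) (hrank : (Hmat h θ₀).rank = r)
    {c : ℝ} (hc : 0 < c) :
    ∃ η > 0, ∀ (L : EuclideanSpace ℝ (Fin p) → ℝ) (θ : EuclideanSpace ℝ (Fin p)),
      ‖θ - θ₀‖ < η → ContDiffAt ℝ 1 L θ → h θ = 0 → IsLocalMinOn L {t | h t = 0} θ →
      ∃ m : Fin r → ℝ, (fun k => -(1 / c) * pderiv k L θ) + Hmat h θ *ᵥ m = 0 := by
  obtain ⟨η₁, hη₁, hinj⟩ := exists_stable_injective hrank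
  have hev := (eventually_Hmat_close hh hη₁).and (hh.eventually (by simp))
  obtain ⟨ρ, hρ, hev⟩ := Metric.eventually_nhds_iff.1 hev
  refine ⟨ρ, hρ, fun L θ hθ hL hz hmin => ?_⟩
  obtain ⟨hH, hhθ⟩ := hev (by rwa [dist_eq_norm])
  have hstr := hhθ.hasStrictFDerivAt (by norm_num)
  have hset : {t | ∀ i, h t i = h θ i} = {t | h t = 0} := by
    ext t
    simp only [Set.mem_ofPred_eq, hz]
    exact ⟨fun h => by ext i; exact h i, fun h i => by rw [h]⟩
  obtain ⟨Λ, Λ₀, hne, hsum⟩ := IsLocalExtrOn.exists_multipliers_of_hasStrictFDerivAt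
    (f := fun i t => h t i) (f' := fun i => (EuclideanSpace.proj i).comp (fderiv ℝ h θ))
    (φ := L) (x₀ := θ) (φ' := fderiv ℝ L θ) (by rw [hset]; exact Or.inl hmin)
    (fun i => (EuclideanSpace.proj (𝕜 := ℝ) i).hasStrictFDerivAt.comp θ hstr)
    (hL.hasStrictFDerivAt (by norm_num))
  have hco : ∀ k, (Hmat h θ *ᵥ Λ) k + Λ₀ * pderiv k L θ = 0 := by
    intro k
    have := DFunLike.congr_fun hsum (EuclideanSpace.single k 1)
    simp only [_root_.add_apply, _root_.sum_apply,
      _root_.smul_apply, ContinuousLinearMap.comp_apply, PiLp.proj_apply, smul_eq_mul,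
      _root_.zero_apply] at this
    rw [← this]
    simp only [Hmat, mulVec, dotProduct, of_apply, pderiv]
    congr 1
    exact Finset.sum_congr rfl fun i _ => mul_comm _ _
  -- If the multiplier of `L` vanished, `H(θ)` would annihilate the nonzero `Λ`, against its
  -- injectivity near `θ₀`.
  have hΛ₀ : Λ₀ ≠ 0 := by
    rintro rfl
    have : Λ = 0 := hinj _ hH _ (funext fun k => by simpa using hco k)
    exact hne (by rw [this]; rfl)
  refine ⟨-(1 / (c * Λ₀)) • Λ, funext fun k => ?_⟩
  have := hco k
  rw [mulVec_smul]
  simp only [Pi.add_apply, Pi.smul_apply, smul_eq_mul, Pi.zero_apply]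
  field_simp
  linarith

/-- Points near `θ₀` whose loss does not exceed that of `θ₀` are controlled by the gradient. -/
lemma exists_norm_le_gradient {J : Matrix (Fin p) (Fin p) ℝ} (hJ : J.PosDef)
    (θ₀ : EuclideanSpace ℝ (Fin p)) {c M₀ δ : ℝ} (hc : 0 < c) (hM₀ : 0 ≤ M₀) (hδ : 0 < δ) :
    ∃ ρ₀ > 0, ∃ η > 0, ∃ C > 0,
      ∀ (L : EuclideanSpace ℝ (Fin p) → ℝ) (g : Fin p → ℝ) (b : Matrix (Fin p) (Fin p) ℝ)
      (M : ℝ), LocalExpansion L θ₀ δ g b M → M ≤ M₀ → (∀ k l, |b k l - c * J k l| ≤ η) →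
      ∀ θ, ‖θ - θ₀‖ ≤ ρ₀ → L θ ≤ L θ₀ → ‖θ - θ₀‖ ≤ C * ‖g‖ := by
  obtain ⟨a, ha, hquad⟩ := exists_quadratic_lower_bound hJ
  obtain ⟨C, hC, hCb⟩ := exists_norm_le_ofLp p
  -- `κ` is the coercivity constant of `c * J` in the Euclidean norm. In the expansion the quadratic
  -- part contributes at least `κ/2 ‖d‖²`; the Hessian error and the cubic remainder take away at
  -- most `κ/8 ‖d‖²` each, leaving `κ/4 ‖d‖²` to be paid by the linear term. The radius depends on
  -- the loss only through `M₀`.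
  set κ := c * a / C ^ 2 with hκ
  have hκ0 : 0 < κ := by positivity
  refine ⟨min (δ / 2) (κ / (8 * (M₀ + 1))), by positivity, κ / (4 * ((p : ℝ) ^ 2 + 1)),
    by positivity, 4 * (p + 1) / κ, by positivity, fun L g b M hL hM hb θ hθ hle => ?_⟩
  set η := κ / (4 * ((p : ℝ) ^ 2 + 1)) with hη
  have hη0 : 0 < η := by positivity
  have hθ1 : ‖θ - θ₀‖ < δ := by
    have := hθ.trans (min_le_left _ _)
    linarith
  have hθ2 : ‖θ - θ₀‖ * (8 * (M₀ + 1)) ≤ κ := by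
    rw [← le_div_iff₀ (by positivity)]
    exact hθ.trans (min_le_right _ _)
  have hv := hL.value θ (by rwa [Metric.mem_ball, dist_eq_norm])
  set d := θ - θ₀ with hd
  have b1 := abs_sum_mul_le (a := g) (c := d.ofLp) (fun k => norm_le_pi_norm g k)
    (fun k => abs_coord_le d k) (norm_nonneg _)
  rw [Fintype.card_fin] at b1
  have b2 : |∑ k, (∑ l, (b k l - c * J k l) * d l) * d k| ≤ p * (p * (η * ‖d‖) * ‖d‖) := by
    have := abs_sum_mul_le (a := fun k => ∑ l, (b k l - c * J k l) * d l) (c := d.ofLp)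
      (A := p * (η * ‖d‖)) (C := ‖d‖)
      (fun k => by
        have := abs_sum_mul_le (hb k) (fun l => abs_coord_le d l) hη0.le
        rwa [Fintype.card_fin] at this) (fun k => abs_coord_le d k) (by positivity)
    rwa [Fintype.card_fin] at this
  have e : ∑ k, (∑ l, b k l * d l) * d k
      = c * (d.ofLp ⬝ᵥ J *ᵥ d.ofLp) + ∑ k, (∑ l, (b k l - c * J k l) * d l) * d k := by
    simp only [dotProduct, mulVec, Finset.mul_sum]
    rw [← Finset.sum_add_distrib]
    refine Finset.sum_congr rfl fun k _ => ?_
    rw [Finset.sum_mul, Finset.sum_mul, ← Finset.sum_add_distrib]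
    exact Finset.sum_congr rfl fun l _ => by ring
  rw [e] at hv
  have b3 : κ * ‖d‖ ^ 2 ≤ c * (d.ofLp ⬝ᵥ J *ᵥ d.ofLp) := by
    have h1 : ‖d‖ ^ 2 ≤ C ^ 2 * ‖d.ofLp‖ ^ 2 := by
      rw [← mul_pow]; exact pow_le_pow_left₀ (norm_nonneg _) (hCb d) 2
    calc κ * ‖d‖ ^ 2 ≤ κ * (C ^ 2 * ‖d.ofLp‖ ^ 2) := by gcongr
      _ = c * (a * ‖d.ofLp‖ ^ 2) := by rw [hκ]; field_simp
      _ ≤ _ := by gcongr; exact hquad _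
  have b4 : M * ‖d‖ ^ 3 ≤ κ / 8 * ‖d‖ ^ 2 := by
    have : M * ‖d‖ ≤ κ / 8 := by nlinarith [norm_nonneg d]
    calc M * ‖d‖ ^ 3 = (M * ‖d‖) * ‖d‖ ^ 2 := by ring
      _ ≤ _ := by gcongr
  have b5 : p * (p * (η * ‖d‖) * ‖d‖) ≤ κ / 4 * ‖d‖ ^ 2 := by
    have : (p : ℝ) ^ 2 * η ≤ κ / 4 := by
      rw [hη, mul_div_assoc', div_le_div_iff₀ (by positivity) (by positivity)]
      nlinarith
    calc (p : ℝ) * (p * (η * ‖d‖) * ‖d‖) = ((p : ℝ) ^ 2 * η) * ‖d‖ ^ 2 := by ring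
      _ ≤ _ := by gcongr
  have b6 := (abs_le.1 hv).1
  have b7 := (abs_le.1 b1).1
  have b8 := (abs_le.1 b2).1
  have hfin : κ / 4 * ‖d‖ ^ 2 ≤ p * (‖g‖ * ‖d‖) := by nlinarith
  rcases (norm_nonneg d).eq_or_lt with hz | hpos
  · rw [← hz]; positivity
  · have : κ / 4 * ‖d‖ ≤ p * ‖g‖ := by
      have : (κ / 4 * ‖d‖) * ‖d‖ ≤ (p * ‖g‖) * ‖d‖ := by nlinarith
      exact le_of_mul_le_mul_right this hpos
    rw [div_mul_eq_mul_div, le_div_iff₀ hκ0]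
    nlinarith [norm_nonneg g]

end Estimation

/-! ### Consequences of differentiation under the integral sign, and chain rules. -/

section Calculus

variable {𝒳 E : Type*} [MeasurableSpace 𝒳] [NormedAddCommGroup E] [NormedSpace ℝ E]
  {μ : Measure 𝒳} {ω : Set E}

lemma DiffUnderIntegral.integrable {k : ℕ} {F : E → 𝒳 → ℝ} (h : DiffUnderIntegral μ ω k F) {θ : E}
    (hθ : θ ∈ ω) : Integrable (F θ) μ := by
  cases k with
  | zero => exact h θ hθ
  | succ k => exact h.1 θ hθ

lemma DiffUnderIntegral.fderiv_eq {k : ℕ} {F : E → 𝒳 → ℝ} (h : DiffUnderIntegral μ ω (k + 1) F)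
    (v : E) {θ : E} (hθ : θ ∈ ω) : fderiv ℝ (fun t => ∫ x, F t x ∂μ) θ v
      = ∫ x, fderiv ℝ (fun t => F t x) θ v ∂μ :=
  (h.2.2 v).1 θ hθ

lemma DiffUnderIntegral.fderiv_eventuallyEq {k : ℕ} {F : E → 𝒳 → ℝ}
    (h : DiffUnderIntegral μ ω (k + 1) F) (hω : IsOpen ω) (v : E) {θ : E} (hθ : θ ∈ ω) :
    (fun q => fderiv ℝ (fun t => ∫ x, F t x ∂μ) q v) =ᶠ[𝓝 θ]
      fun q => ∫ x, fderiv ℝ (fun t => F t x) q v ∂μ :=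
  eventually_of_mem (hω.mem_nhds hθ) fun _ hq => h.fderiv_eq v hq

lemma DiffUnderIntegral.fderiv_fderiv_eq {k : ℕ} {F : E → 𝒳 → ℝ}
    (h : DiffUnderIntegral μ ω (k + 2) F) (hω : IsOpen ω) (u v : E) {θ : E} (hθ : θ ∈ ω) :
    fderiv ℝ (fun q => fderiv ℝ (fun t => ∫ x, F t x ∂μ) q v) θ u
      = ∫ x, fderiv ℝ (fun q => fderiv ℝ (fun t => F t x) q v) θ u ∂μ := by
  rw [(h.fderiv_eventuallyEq hω v hθ).fderiv_eq]
  exact (h.2.2 v).2.fderiv_eq u hθ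

/-- One order is lost: the last level provides differentiability of a derivative, of which only
continuity remains. -/
lemma DiffUnderIntegral.contDiffOn [FiniteDimensional ℝ E] (hω : IsOpen ω) {k : ℕ} :
    ∀ {F : E → 𝒳 → ℝ}, DiffUnderIntegral μ ω (k + 1) F →
      ContDiffOn ℝ k (fun θ => ∫ x, F θ x ∂μ) ω := by
  induction k with
  | zero =>
    intro F h
    exact contDiffOn_zero.2 h.2.1.continuousOn
  | succ k ih =>
    intro F h
    rw [Nat.cast_add, Nat.cast_one, contDiffOn_succ_iff_fderiv_apply hω.uniqueDiffOn]
    refine ⟨h.2.1, fun hk => absurd hk (by simp), fun v => ?_⟩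
    refine (ih (h.2.2 v).2).congr fun θ hθ => ?_
    rw [fderivWithin_of_isOpen hω hθ]
    exact h.fderiv_eq v hθ

/-- Second-order Taylor expansion with Peano remainder of an integral that can be differentiated
twice under the integral sign. -/
lemma DiffUnderIntegral.exists_taylor [FiniteDimensional ℝ E] (hω : IsOpen ω) {F : E → 𝒳 → ℝ}
    (h : DiffUnderIntegral μ ω 2 F) {q₀ : E} (hq₀ : q₀ ∈ ω) {ε : ℝ} (hε : 0 < ε) :
    ∃ δ > 0, ∀ v : E, ‖v‖ < δ → |∫ x, F (q₀ + v) x ∂μ - ∫ x, F q₀ x ∂μ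
      - ∫ x, fderiv ℝ (fun t => F t x) q₀ v ∂μ
      - (∫ x, fderiv ℝ (fun q => fderiv ℝ (fun t => F t x) q v) q₀ v ∂μ) / 2| ≤ ε * ‖v‖ ^ 2 := by
  set D : E → ℝ := fun q => ∫ x, F q x ∂μ with hD
  have happly : ∀ v, DifferentiableAt ℝ (fun q => fderiv ℝ D q v) q₀ := fun v =>
    (((h.2.2 v).2.2.1 q₀ hq₀).differentiableAt (hω.mem_nhds hq₀)).congr_of_eventuallyEq
      (h.fderiv_eventuallyEq hω v hq₀)
  -- Each directional derivative is differentiable at `q₀`; expanding in a finite basis transfers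
  -- this to the Fréchet derivative. Since the second derivative is not known to be continuous, the
  -- remainder comes from its definition at `q₀` and has Peano form.
  have hdiff : DifferentiableAt ℝ (fderiv ℝ D) q₀ := by
    let b := Module.finBasis ℝ E
    have : fderiv ℝ D = fun q => ∑ i, fderiv ℝ D q (b i) •
        (LinearMap.toContinuousLinearMap (b.coord i) : E →L[ℝ] ℝ) := by
      funext q
      ext w
      conv_lhs => rw [← b.sum_repr w]
      rw [map_sum]
      simp [mul_comm]
    rw [this]
    exact DifferentiableAt.fun_sum fun i _ => (happly (b i)).smul_const _
  set B := fderiv ℝ (fderiv ℝ D) q₀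
  have hB : ∀ v, fderiv ℝ (fun q => fderiv ℝ D q v) q₀ v = B v v := by
    intro v
    rw [fderiv_clm_apply hdiff (differentiableAt_const v)]
    simp [B]
  have hlo := hdiff.hasFDerivAt.isLittleO.def hε
  obtain ⟨δ, hδ, hball⟩ := Metric.eventually_nhds_iff.1 (hlo.and (hω.mem_nhds hq₀))
  refine ⟨δ, hδ, fun v hv => ?_⟩
  rw [← h.fderiv_eq v hq₀, ← h.fderiv_fderiv_eq (k := 0) hω v v hq₀, hB v]
  have hin : ∀ t ∈ Set.Icc (0 : ℝ) 1, ‖t • v‖ ≤ ‖v‖ := fun t ht => by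
    rw [norm_smul, Real.norm_eq_abs, abs_of_nonneg ht.1]
    nlinarith [norm_nonneg v, ht.2]
  have hb : ∀ t ∈ Set.Icc (0 : ℝ) 1, dist (q₀ + t • v) q₀ < δ := fun t ht => by
    rw [dist_eq_norm, add_sub_cancel_left]
    exact (hin t ht).trans_lt hv
  have := line_taylor (φ := fun t => D (q₀ + t • v)) (φ' := fun t => fderiv ℝ D (q₀ + t • v) v)
    (α := fderiv ℝ D q₀ v) (β := B v v) (K := ε * ‖v‖ ^ 2) (fun t ht => by
      have h1 : HasDerivAt (fun s : ℝ => q₀ + s • v) v t := by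
        simpa using ((hasDerivAt_id t).smul_const v).const_add q₀
      have hmem := (hball (hb t ht)).2
      exact ((h.2.1 _ hmem).differentiableAt (hω.mem_nhds hmem)).hasFDerivAt.comp_hasDerivAt t h1)
    (fun t ht => by
      have h1 := (hball (hb t ht)).1
      rw [add_sub_cancel_left] at h1
      have e : fderiv ℝ D (q₀ + t • v) v - fderiv ℝ D q₀ v - t * B v v
          = (fderiv ℝ D (q₀ + t • v) - fderiv ℝ D q₀ - B (t • v)) v := by simp
      rw [e, ← Real.norm_eq_abs]
      refine (ContinuousLinearMap.le_opNorm _ _).trans ?_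
      calc _ ≤ (ε * ‖t • v‖) * ‖v‖ := by gcongr
        _ ≤ (ε * ‖v‖) * ‖v‖ := by gcongr; exact hin t ht
        _ = _ := by ring)
  simpa [hD] using this

variable {φ : E → ℝ} {θ : E}

lemma fderiv_comp_apply {w : ℝ → ℝ} {w₁ : ℝ} (hw : HasDerivAt w w₁ (φ θ))
    (hφ : DifferentiableAt ℝ φ θ) (v : E) :
    fderiv ℝ (fun t => w (φ t)) θ v = w₁ * fderiv ℝ φ θ v := by
  have := (hw.comp_hasFDerivAt θ hφ.hasFDerivAt).fderiv
  simp only [Function.comp_def] at this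
  rw [this]
  simp

lemma fderiv_fderiv_comp_apply {w w₁ : ℝ → ℝ} {w₂ : ℝ}
    (hw : ∀ᶠ y in 𝓝 (φ θ), HasDerivAt w (w₁ y) y) (hw₁ : HasDerivAt w₁ w₂ (φ θ))
    (hφ : ContDiffAt ℝ 2 φ θ) (u v : E) :
    fderiv ℝ (fun q => fderiv ℝ (fun t => w (φ t)) q v) θ u
      = w₂ * fderiv ℝ φ θ u * fderiv ℝ φ θ v
        + w₁ (φ θ) * fderiv ℝ (fun q => fderiv ℝ φ q v) θ u := by
  have hd : DifferentiableAt ℝ φ θ := hφ.differentiableAt (by norm_num)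
  have h1 : ∀ᶠ q in 𝓝 θ, HasDerivAt w (w₁ (φ q)) (φ q) := hd.continuousAt.eventually hw
  have h2 : ∀ᶠ q in 𝓝 θ, DifferentiableAt ℝ φ q :=
    (hφ.eventually (by simp)).mono fun q hq => hq.differentiableAt (by norm_num)
  have he : (fun q => fderiv ℝ (fun t => w (φ t)) q v) =ᶠ[𝓝 θ]
      fun q => w₁ (φ q) * fderiv ℝ φ q v := by
    filter_upwards [h1, h2] with q hq hq' using fderiv_comp_apply hq hq' v
  rw [he.fderiv_eq]
  have hd2 : DifferentiableAt ℝ (fun q => fderiv ℝ φ q v) θ :=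
    ((hφ.fderiv_right (m := 1) (by norm_num)).differentiableAt (by norm_num)).clm_apply
      (differentiableAt_const v)
  have hw₁' := hw₁.comp_hasFDerivAt θ hd.hasFDerivAt
  have := (hw₁'.mul hd2.hasFDerivAt).fderiv
  simp only [Function.comp_def, Pi.mul_def] at this
  rw [this]
  simp
  ring

/-- Directional derivatives of first and second order computed along a line. -/
lemma fderiv_eq_of_line {Φ : E → ℝ} {q v : E} {Φ₁ : ℝ → ℝ} {Φ₂ : ℝ} (hΦ : ContDiffAt ℝ 2 Φ q)
    (h1 : ∀ᶠ t in 𝓝 (0 : ℝ), HasDerivAt (fun t => Φ (q + t • v)) (Φ₁ t) t)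
    (h2 : HasDerivAt Φ₁ Φ₂ 0) :
    fderiv ℝ Φ q v = Φ₁ 0 ∧ fderiv ℝ (fun q' => fderiv ℝ Φ q' v) q v = Φ₂ := by
  have hl : ∀ t : ℝ, HasDerivAt (fun s : ℝ => q + s • v) v t := fun t => by
    simpa using ((hasDerivAt_id t).smul_const v).const_add q
  have hq : q + (0 : ℝ) • v = q := by simp
  have hev : ∀ᶠ q' in 𝓝 q, DifferentiableAt ℝ Φ q' :=
    (hΦ.eventually (by simp)).mono fun q hq => hq.differentiableAt (by norm_num)
  have hcont : Tendsto (fun t : ℝ => q + t • v) (𝓝 0) (𝓝 q) := by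
    simpa [ContinuousAt] using (hl 0).continuousAt
  have h3 : ∀ᶠ t in 𝓝 (0 : ℝ), fderiv ℝ Φ (q + t • v) v = Φ₁ t := by
    filter_upwards [h1, hcont.eventually hev] with t ht ht'
    exact (ht'.hasFDerivAt.comp_hasDerivAt t (hl t)).unique ht
  refine ⟨by simpa using h3.self_of_nhds, ?_⟩
  have hd2 : DifferentiableAt ℝ (fun q => fderiv ℝ Φ q v) (q + (0 : ℝ) • v) := by
    rw [hq]
    exact ((hΦ.fderiv_right (m := 1) (by norm_num)).differentiableAt (by norm_num)).clm_apply
      (differentiableAt_const v)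
  have h4 := hd2.hasFDerivAt.comp_hasDerivAt (0 : ℝ) (hl 0)
  rw [hq] at h4
  exact h4.unique (h2.congr_of_eventuallyEq h3)

end Calculus

/-! ### Iterated partial derivatives. -/

section Partial

variable {p : ℕ} {ω : Set (EuclideanSpace ℝ (Fin p))} {F G : EuclideanSpace ℝ (Fin p) → ℝ}

/-- Three derivatives on the open set `ω`, in terms of iterated partial derivatives. -/
structure ThriceDifferentiable (F : EuclideanSpace ℝ (Fin p) → ℝ)
    (ω : Set (EuclideanSpace ℝ (Fin p))) : Prop where
  contDiffAt : ∀ θ ∈ ω, ContDiffAt ℝ 1 F θ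
  pderiv : ∀ θ ∈ ω, ∀ k, DifferentiableAt ℝ (pderiv k F) θ
  pderiv_pderiv : ∀ θ ∈ ω, ∀ l k, DifferentiableAt ℝ (SDT.pderiv l (SDT.pderiv k F)) θ

lemma pderiv_eventuallyEq {θ : EuclideanSpace ℝ (Fin p)} (h : F =ᶠ[𝓝 θ] G) (k : Fin p) :
    pderiv k F =ᶠ[𝓝 θ] pderiv k G :=
  (h.fderiv (𝕜 := ℝ)).mono fun q hq => by simp only [pderiv, hq]

lemma ThriceDifferentiable.congr (h : ThriceDifferentiable F ω) (hω : IsOpen ω)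
    (hFG : Set.EqOn G F ω) : ThriceDifferentiable G ω := by
  have he : ∀ θ ∈ ω, G =ᶠ[𝓝 θ] F := fun θ hθ => eventually_of_mem (hω.mem_nhds hθ) hFG
  exact ⟨fun θ hθ => (h.contDiffAt θ hθ).congr_of_eventuallyEq (he θ hθ),
    fun θ hθ k => (h.pderiv θ hθ k).congr_of_eventuallyEq (pderiv_eventuallyEq (he θ hθ) k),
    fun θ hθ l k => (h.pderiv_pderiv θ hθ l k).congr_of_eventuallyEq
      (pderiv_eventuallyEq (pderiv_eventuallyEq (he θ hθ) k) l)⟩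

lemma pderiv_sub {θ : EuclideanSpace ℝ (Fin p)} (hF : DifferentiableAt ℝ F θ)
    (hG : DifferentiableAt ℝ G θ) (k : Fin p) :
    pderiv k (fun t => F t - G t) θ = pderiv k F θ - pderiv k G θ := by
  simp only [pderiv]
  rw [fderiv_fun_sub hF hG]
  simp

lemma ThriceDifferentiable.pderiv_pderiv_sub (hF : ThriceDifferentiable F ω)
    (hG : ThriceDifferentiable G ω) (hω : IsOpen ω) {θ : EuclideanSpace ℝ (Fin p)} (hθ : θ ∈ ω)
    (l k : Fin p) : SDT.pderiv l (SDT.pderiv k (fun t => F t - G t)) θ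
      = SDT.pderiv l (SDT.pderiv k F) θ - SDT.pderiv l (SDT.pderiv k G) θ := by
  have he : SDT.pderiv k (fun t => F t - G t) =ᶠ[𝓝 θ]
      fun t => SDT.pderiv k F t - SDT.pderiv k G t :=
    eventually_of_mem (hω.mem_nhds hθ) fun q hq =>
      pderiv_sub ((hF.contDiffAt q hq).differentiableAt (by norm_num))
        ((hG.contDiffAt q hq).differentiableAt (by norm_num)) k
  rw [(pderiv_eventuallyEq he l).self_of_nhds]
  exact pderiv_sub (hF.pderiv θ hθ k) (hG.pderiv θ hθ k) l

lemma ThriceDifferentiable.sub (hF : ThriceDifferentiable F ω) (hG : ThriceDifferentiable G ω)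
    (hω : IsOpen ω) : ThriceDifferentiable (fun t => F t - G t) ω := by
  have he : ∀ k, ∀ θ ∈ ω, SDT.pderiv k (fun t => F t - G t) θ
      = SDT.pderiv k F θ - SDT.pderiv k G θ := fun k q hq =>
    pderiv_sub ((hF.contDiffAt q hq).differentiableAt (by norm_num))
      ((hG.contDiffAt q hq).differentiableAt (by norm_num)) k
  refine ⟨fun θ hθ => (hF.contDiffAt θ hθ).sub (hG.contDiffAt θ hθ), fun θ hθ k => ?_,
    fun θ hθ l k => ?_⟩
  · exact ((hF.pderiv θ hθ k).fun_sub (hG.pderiv θ hθ k)).congr_of_eventuallyEq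
      (eventually_of_mem (hω.mem_nhds hθ) (he k))
  · exact ((hF.pderiv_pderiv θ hθ l k).fun_sub (hG.pderiv_pderiv θ hθ l k)).congr_of_eventuallyEq
      (eventually_of_mem (hω.mem_nhds hθ) fun q hq => hF.pderiv_pderiv_sub hG hω hq l k)

lemma contDiffAt_pderiv {θ : EuclideanSpace ℝ (Fin p)} {n m : ℕ} (hF : ContDiffAt ℝ n F θ)
    (hmn : m + 1 ≤ n) (k : Fin p) : ContDiffAt ℝ m (pderiv k F) θ :=
  (hF.fderiv_right (m := m) (by exact_mod_cast hmn)).clm_apply contDiffAt_const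

lemma ThriceDifferentiable.of_contDiffAt (h : ∀ θ ∈ ω, ContDiffAt ℝ 3 F θ) :
    ThriceDifferentiable F ω where
  contDiffAt θ hθ := (h θ hθ).of_le (by norm_num)
  pderiv θ hθ k := (contDiffAt_pderiv (n := 3) (m := 2) (h θ hθ) le_rfl k).differentiableAt
    (by norm_num)
  pderiv_pderiv θ hθ l k := (contDiffAt_pderiv (n := 2) (m := 1)
    (contDiffAt_pderiv (n := 3) (m := 2) (h θ hθ) le_rfl k) le_rfl l).differentiableAt
    (by norm_num)

/-- `contDiffOn` reaches only `C²`. Differentiability of the second partials is read off the level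
where they are themselves integrals. -/
lemma ThriceDifferentiable.of_diffUnderIntegral {𝒳 : Type*} [MeasurableSpace 𝒳] {μ : Measure 𝒳}
    {F : EuclideanSpace ℝ (Fin p) → 𝒳 → ℝ} (hω : IsOpen ω) (h : DiffUnderIntegral μ ω 3 F) :
    ThriceDifferentiable (fun θ => ∫ x, F θ x ∂μ) ω := by
  have hc := h.contDiffOn (k := 2) hω
  refine ⟨fun θ hθ => (hc.contDiffAt (hω.mem_nhds hθ)).of_le (by norm_num), fun θ hθ k =>
    (contDiffAt_pderiv (n := 2) (m := 1) (hc.contDiffAt (hω.mem_nhds hθ)) le_rfl k).differentiableAt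
      (by norm_num), fun θ hθ l k => ?_⟩
  have h2 := (h.2.2 (EuclideanSpace.single k 1)).2
  have h1 := (h2.2.2 (EuclideanSpace.single l 1)).2
  refine ((h1.2.1 θ hθ).differentiableAt (hω.mem_nhds hθ)).congr_of_eventuallyEq ?_
  refine eventually_of_mem (hω.mem_nhds hθ) fun q hq => ?_
  exact h.fderiv_fderiv_eq (k := 1) hω _ _ hq

end Partial

/-! ### Scores, powers of the density and the loss at a fixed observation. -/

section Pointwise

variable {𝒳 : Type*} {p : ℕ} {f : EuclideanSpace ℝ (Fin p) → 𝒳 → ℝ}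
  {θ : EuclideanSpace ℝ (Fin p)} {x : 𝒳}

lemma score_of_pos (hd : DifferentiableAt ℝ (fun t => f t x) θ) (hpos : 0 < f θ x) (k : Fin p) :
    score f θ x k = pderiv k (fun t => f t x) θ / f θ x := by
  simp only [score, pderiv]
  rw [fderiv_comp_apply (φ := fun t => f t x) (Real.hasDerivAt_log hpos.ne') hd, div_eq_inv_mul]

/-- By the convention `Real.log 0 = 0`, the score vanishes off the common support, so the identities
below hold there as well. -/
lemma score_of_eventually_zero (h0 : ∀ᶠ t in 𝓝 θ, f t x = 0) (k : Fin p) : score f θ x k = 0 := by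
  have : (fun t => Real.log (f t x)) =ᶠ[𝓝 θ] fun _ => 0 := h0.mono fun t ht => by simp [ht]
  simp only [score, pderiv, this.fderiv_eq]
  simp

lemma fderiv_rpow_of_pos (hd : DifferentiableAt ℝ (fun t => f t x) θ) (hpos : 0 < f θ x) (a : ℝ)
    (v : EuclideanSpace ℝ (Fin p)) : fderiv ℝ (fun t => f t x ^ a) θ v
      = a * f θ x ^ (a - 1) * fderiv ℝ (fun t => f t x) θ v :=
  fderiv_comp_apply (φ := fun t => f t x) (w := fun y => y ^ a)
    (Real.hasDerivAt_rpow_const (Or.inl hpos.ne')) hd v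

lemma fderiv_fderiv_rpow_of_pos (hd : ContDiffAt ℝ 2 (fun t => f t x) θ) (hpos : 0 < f θ x) (a : ℝ)
    (u v : EuclideanSpace ℝ (Fin p)) :
    fderiv ℝ (fun q => fderiv ℝ (fun t => f t x ^ a) q v) θ u
      = a * ((a - 1) * f θ x ^ (a - 2)) * fderiv ℝ (fun t => f t x) θ u
          * fderiv ℝ (fun t => f t x) θ v
        + a * f θ x ^ (a - 1) * fderiv ℝ (fun q => fderiv ℝ (fun t => f t x) q v) θ u := by
  refine fderiv_fderiv_comp_apply (φ := fun t => f t x) (w := fun y => y ^ a)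
    (w₁ := fun y => a * y ^ (a - 1)) ?_ ?_ hd u v
  · filter_upwards [lt_mem_nhds hpos] with y hy
    exact Real.hasDerivAt_rpow_const (Or.inl hy.ne')
  · have := (Real.hasDerivAt_rpow_const (x := f θ x) (p := a - 1) (Or.inl hpos.ne')).const_mul a
    rwa [show a - 1 - 1 = a - 2 by ring] at this

lemma fderiv_rpow_eq_score (hd : DifferentiableAt ℝ (fun t => f t x) θ) (hpos : 0 < f θ x) (a : ℝ)
    (k : Fin p) : fderiv ℝ (fun t => f t x ^ a) θ (EuclideanSpace.single k 1)
      = a * (score f θ x k * f θ x ^ a) := by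
  rw [fderiv_rpow_of_pos hd hpos, score_of_pos hd hpos, Real.rpow_sub_one hpos.ne']
  simp only [pderiv]
  field_simp

lemma fderiv_of_eventually_zero {F : EuclideanSpace ℝ (Fin p) → ℝ} (h : ∀ᶠ t in 𝓝 θ, F t = 0) :
    (∀ v, fderiv ℝ F θ v = 0) ∧ ∀ u v, fderiv ℝ (fun q => fderiv ℝ F q v) θ u = 0 := by
  have h1 : F =ᶠ[𝓝 θ] fun _ => 0 := h
  have h2 : ∀ v, (fun q => fderiv ℝ F q v) =ᶠ[𝓝 θ] fun _ => 0 := fun v =>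
    (h1.fderiv (𝕜 := ℝ)).mono fun q hq => by simp [hq]
  exact ⟨fun v => (h2 v).self_of_nhds, fun u v => by rw [(h2 v).fderiv_eq]; simp⟩

/-- The data-dependent part of the density power divergence loss. -/
noncomputable def lossFun (β y : ℝ) : ℝ :=
  -- The `+ 1` offsets `∫ f = 1`, so that `∫ f ^ (1 + β) - lossFun β (f x)` is the loss also for `β
  -- = 0`. In both cases the derivative is `(1 + β) * y ^ (β - 1)`.
  if β = 0 then Real.log y + 1 else (1 + 1 / β) * y ^ β

lemma hasDerivAt_lossFun {β y : ℝ} (hy : 0 < y) :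
    HasDerivAt (lossFun β) ((1 + β) * y ^ (β - 1)) y := by
  by_cases h : β = 0
  · subst h
    have := (Real.hasDerivAt_log hy.ne').add_const 1
    convert! this using 1
    · funext z; simp [lossFun]
    · rw [zero_sub, Real.rpow_neg_one]; ring
  · have := (Real.hasDerivAt_rpow_const (x := y) (p := β) (Or.inl hy.ne')).const_mul (1 + 1 / β)
    convert! this using 1
    · funext z; simp [lossFun, h]
    · field_simp; ring

lemma hasDerivAt_lossFun_deriv {β y : ℝ} (hy : 0 < y) :
    HasDerivAt (fun z => (1 + β) * z ^ (β - 1)) ((1 + β) * ((β - 1) * y ^ (β - 2))) y := by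
  have := (Real.hasDerivAt_rpow_const (x := y) (p := β - 1) (Or.inl hy.ne')).const_mul (1 + β)
  rwa [show β - 1 - 1 = β - 2 by ring] at this

lemma contDiffAt_lossFun {β y : ℝ} (hy : 0 < y) : ContDiffAt ℝ 3 (lossFun β) y := by
  by_cases h : β = 0
  · subst h
    have : lossFun 0 = fun z => Real.log z + 1 := by funext z; simp [lossFun]
    rw [this]
    exact (Real.contDiffAt_log.2 hy.ne').add contDiffAt_const
  · have : lossFun β = fun z => (1 + 1 / β) * z ^ β := by funext z; simp [lossFun, h]
    rw [this]
    exact contDiffAt_const.mul (Real.contDiffAt_rpow_const_of_ne hy.ne')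

lemma hasDerivAt_crossFun {β y : ℝ} (c : ℝ) (hy : 0 < y) :
    HasDerivAt (fun z => (if β = 0 then Real.log z else z ^ β) * c)
      ((if β = 0 then 1 else β) * y ^ (β - 1) * c) y := by
  by_cases h : β = 0
  · simpa [h, Real.rpow_neg_one] using (Real.hasDerivAt_log hy.ne').mul_const c
  · simpa [h] using (Real.hasDerivAt_rpow_const (x := y) (p := β) (Or.inl hy.ne')).mul_const c

lemma hasDerivAt_crossFun_deriv {β y : ℝ} (τ c : ℝ) (hy : 0 < y) :
    HasDerivAt (fun z => τ * z ^ (β - 1) * c) (τ * ((β - 1) * y ^ (β - 2)) * c) y := by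
  have := ((Real.hasDerivAt_rpow_const (x := y) (p := β - 1) (Or.inl hy.ne')).const_mul
    τ).mul_const c
  rwa [show β - 1 - 1 = β - 2 by ring] at this

end Pointwise

/-! ### The local model: score identities and the mean Hessian of the loss. -/

section Model

variable {𝒳 : Type*} [MeasurableSpace 𝒳] {p : ℕ}

/-- The law with density `g` with respect to `μ`. -/
noncomputable abbrev densityLaw (μ : Measure 𝒳) (g : 𝒳 → ℝ) : Measure 𝒳 :=
  μ.withDensity fun x => ENNReal.ofReal (g x)

variable {μ : Measure 𝒳} {f : EuclideanSpace ℝ (Fin p) → 𝒳 → ℝ} {g : 𝒳 → ℝ}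

lemma integrable_densityLaw_iff (hg : Measurable g) (hg0 : ∀ x, 0 ≤ g x) {F : 𝒳 → ℝ} :
    Integrable F (densityLaw μ g) ↔ Integrable (fun x => F x * g x) μ := by
  rw [integrable_withDensity_iff_integrable_smul' hg.ennreal_ofReal (ae_of_all _ fun x => by simp)]
  simp only [ENNReal.toReal_ofReal (hg0 _), smul_eq_mul, mul_comm]

lemma integral_densityLaw (hg : Measurable g) (hg0 : ∀ x, 0 ≤ g x) (F : 𝒳 → ℝ) :
    ∫ x, F x ∂(densityLaw μ g) = ∫ x, F x * g x ∂μ := by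
  rw [integral_withDensity_eq_integral_toReal_smul hg.ennreal_ofReal
    (ae_of_all _ fun x => by simp)]
  simp only [ENNReal.toReal_ofReal (hg0 _), smul_eq_mul, mul_comm]

lemma ae_densityLaw_iff (hg : Measurable g) {q : 𝒳 → Prop} :
    (∀ᵐ x ∂(densityLaw μ g), q x) ↔ ∀ᵐ x ∂μ, 0 < g x → q x := by
  rw [ae_withDensity_iff hg.ennreal_ofReal]
  simp

variable {Θ : Set (EuclideanSpace ℝ (Fin p))} {θ₀ : EuclideanSpace ℝ (Fin p)} {β : ℝ}

lemma IsDensityFamily.measurable_apply (hf : IsDensityFamily μ f Θ) {θ : EuclideanSpace ℝ (Fin p)}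
    (hθ : θ ∈ Θ) : Measurable (f θ) :=
  hf.measurable.comp ((measurable_const (a := (⟨θ, hθ⟩ : Θ))).prodMk measurable_id)

lemma IsDensityFamily.integral_eq_one (hf : IsDensityFamily μ f Θ) {θ : EuclideanSpace ℝ (Fin p)}
    (hθ : θ ∈ Θ) : ∫ x, f θ x ∂μ = 1 := by
  rw [integral_eq_lintegral_of_nonneg_ae (ae_of_all _ (hf.nonneg θ hθ))
    (hf.measurable_apply hθ).aestronglyMeasurable, hf.lintegral_eq_one θ hθ]
  simp

/-- The regularity of the model near `θ₀` that the asymptotics of minimum density power divergence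
estimators use. -/
structure LocalModel (μ : Measure 𝒳) (f : EuclideanSpace ℝ (Fin p) → 𝒳 → ℝ) (β : ℝ)
    (Θ ω : Set (EuclideanSpace ℝ (Fin p))) (θ₀ : EuclideanSpace ℝ (Fin p))
    (M : Fin p → Fin p → Fin p → 𝒳 → ℝ) : Prop where
  beta_nonneg : 0 ≤ β
  density : IsDensityFamily μ f Θ
  support : ∀ θ ∈ Θ, ∀ θ' ∈ Θ, ∀ x, 0 < f θ x ↔ 0 < f θ' x
  isOpen : IsOpen ω
  subset : ω ⊆ Θ
  mem : θ₀ ∈ ω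
  smooth : ∀ᵐ x ∂μ, ContDiffOn ℝ 3 (fun θ => f θ x) ω
  power : DiffUnderIntegral μ ω 3 (fun θ x => f θ x ^ (1 + β))
  cross : DiffUnderIntegral μ ω 3
    (fun θ x => (if β = 0 then Real.log (f θ x) else f θ x ^ β) * f θ₀ x)
  posDef : (Jmat μ f β θ₀).PosDef
  third_bound : ∀ j k l, ∀ᵐ x ∂μ, ∀ θ ∈ ω,
    |pderiv j (pderiv k (pderiv l (fun t => dpdLoss μ f β t x))) θ| ≤ M j k l x
  bound_integrable : ∀ j k l, Integrable (fun x => M j k l x * f θ₀ x) μ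
  score_integrable : ∀ j, Integrable (fun x => score f θ₀ x j * f θ₀ x) μ
  score_centred : ∀ j, ∫ x, score f θ₀ x j * f θ₀ x ∂μ = 0
  fisher_integrable : ∀ j k, Integrable (fun x => score f θ₀ x j * score f θ₀ x k * f θ₀ x) μ
  fisher_posDef : (Jmat μ f 0 θ₀).PosDef
  variance_integrable : ∀ j k,
    Integrable (fun x => score f θ₀ x j * score f θ₀ x k * f θ₀ x ^ (1 + 2 * β)) μ

namespace LocalModel

variable {ω : Set (EuclideanSpace ℝ (Fin p))} {M : Fin p → Fin p → Fin p → 𝒳 → ℝ}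
  (h : LocalModel μ f β Θ ω θ₀ M)

include h

lemma mem_Θ : θ₀ ∈ Θ := h.subset h.mem

lemma measurable₀ : Measurable (f θ₀) := h.density.measurable_apply h.mem_Θ

lemma nonneg₀ : ∀ x, 0 ≤ f θ₀ x := h.density.nonneg θ₀ h.mem_Θ

lemma isProbabilityMeasure : IsProbabilityMeasure (densityLaw μ (f θ₀)) :=
  ⟨by rw [densityLaw, withDensity_apply _ MeasurableSet.univ, Measure.restrict_univ,
    h.density.lintegral_eq_one θ₀ h.mem_Θ]⟩

/-- By the common support, an observation has positive density under all parameters or under none.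
Pointwise identities are checked in these two cases. -/
lemma pos_or_zero (x : 𝒳) : (∀ θ ∈ Θ, 0 < f θ x) ∨ ∀ θ ∈ Θ, f θ x = 0 := by
  by_cases hx : 0 < f θ₀ x
  · exact Or.inl fun θ hθ => (h.support θ₀ h.mem_Θ θ hθ x).1 hx
  · exact Or.inr fun θ hθ => le_antisymm
      (not_lt.1 fun hc => hx ((h.support θ hθ θ₀ h.mem_Θ x).1 hc)) (h.density.nonneg θ hθ x)

lemma eventually_zero {x : 𝒳} (hx : ∀ θ ∈ Θ, f θ x = 0) {θ : EuclideanSpace ℝ (Fin p)}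
    (hθ : θ ∈ ω) : ∀ᶠ t in 𝓝 θ, f t x = 0 :=
  eventually_of_mem (h.isOpen.mem_nhds hθ) fun t ht => hx t (h.subset ht)

lemma one_add_pos : 0 < 1 + β := by linarith [h.beta_nonneg]

lemma fderiv_power {θ : EuclideanSpace ℝ (Fin p)} (hθ : θ ∈ ω) (k : Fin p) :
    ∀ᵐ x ∂μ, fderiv ℝ (fun t => f t x ^ (1 + β)) θ (EuclideanSpace.single k 1)
      = (1 + β) * (score f θ x k * f θ x ^ (1 + β)) := by
  filter_upwards [h.smooth] with x hx
  rcases h.pos_or_zero x with hpos | hz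
  · exact fderiv_rpow_eq_score ((hx.contDiffAt (h.isOpen.mem_nhds hθ)).differentiableAt
      (by norm_num)) (hpos θ (h.subset hθ)) _ k
  · rw [score_of_eventually_zero (h.eventually_zero hz hθ), zero_mul, mul_zero]
    exact (fderiv_of_eventually_zero ((h.eventually_zero hz hθ).mono fun t ht => by
      rw [ht, Real.zero_rpow h.one_add_pos.ne'])).1 _

lemma score_power_integrable {θ : EuclideanSpace ℝ (Fin p)} (hθ : θ ∈ ω) (k : Fin p) :
    Integrable (fun x => score f θ x k * f θ x ^ (1 + β)) μ := by
  have h1 := (h.power.2.2 (EuclideanSpace.single k 1)).2.integrable hθ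
  have h2 := (h1.congr (h.fderiv_power hθ k)).const_mul (1 + β)⁻¹
  refine h2.congr (ae_of_all _ fun x => ?_)
  simp only []
  rw [inv_mul_cancel_left₀ h.one_add_pos.ne']

lemma pderiv_power_integral {θ : EuclideanSpace ℝ (Fin p)} (hθ : θ ∈ ω) (k : Fin p) :
    pderiv k (fun t => ∫ x, f t x ^ (1 + β) ∂μ) θ = (1 + β) * xiVec μ f β θ k := by
  rw [pderiv, h.power.fderiv_eq _ hθ, integral_congr_ae (h.fderiv_power hθ k),
    integral_const_mul, xiVec]

lemma dpdLoss_eq {x : 𝒳} {θ : EuclideanSpace ℝ (Fin p)} (hθ : θ ∈ Θ) :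
    dpdLoss μ f β θ x = ∫ y, f θ y ^ (1 + β) ∂μ - lossFun β (f θ x) := by
  by_cases hβ : β = 0
  · subst hβ
    simp only [dpdLoss, lossFun, if_true, add_zero, Real.rpow_one]
    rw [h.density.integral_eq_one hθ]
    ring
  · simp only [dpdLoss, lossFun, hβ, if_false]

lemma thriceDifferentiable_lossFun {x : 𝒳} (hx : ContDiffOn ℝ 3 (fun θ => f θ x) ω)
    (hpos : ∀ θ ∈ Θ, 0 < f θ x) : ThriceDifferentiable (fun t => lossFun β (f t x)) ω :=
  .of_contDiffAt fun θ hθ => (contDiffAt_lossFun (hpos θ (h.subset hθ))).fun_comp θ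
    (hx.contDiffAt (h.isOpen.mem_nhds hθ))

lemma thriceDifferentiable_power : ThriceDifferentiable (fun t => ∫ y, f t y ^ (1 + β) ∂μ) ω :=
  .of_diffUnderIntegral h.isOpen h.power

lemma thriceDifferentiable_dpdLoss {x : 𝒳} (hx : ContDiffOn ℝ 3 (fun θ => f θ x) ω)
    (hpos : ∀ θ ∈ Θ, 0 < f θ x) : ThriceDifferentiable (fun t => dpdLoss μ f β t x) ω :=
  (h.thriceDifferentiable_power.sub (h.thriceDifferentiable_lossFun hx hpos) h.isOpen).congr
    h.isOpen fun _ ht => h.dpdLoss_eq (h.subset ht)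

lemma pderiv_dpdLoss {x : 𝒳} (hx : ContDiffOn ℝ 3 (fun θ => f θ x) ω)
    (hpos : ∀ θ ∈ Θ, 0 < f θ x) {θ : EuclideanSpace ℝ (Fin p)} (hθ : θ ∈ ω) (k : Fin p) :
    pderiv k (fun t => dpdLoss μ f β t x) θ
      = -(1 + β) * (score f θ x k * f θ x ^ β - xiVec μ f β θ k) := by
  have he : (fun t => dpdLoss μ f β t x) =ᶠ[𝓝 θ]
      fun t => ∫ y, f t y ^ (1 + β) ∂μ - lossFun β (f t x) :=
    eventually_of_mem (h.isOpen.mem_nhds hθ) fun t ht => h.dpdLoss_eq (h.subset ht)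
  have hp := hpos θ (h.subset hθ)
  have hd := (hx.contDiffAt (h.isOpen.mem_nhds hθ)).differentiableAt (by norm_num)
  rw [(pderiv_eventuallyEq he k).self_of_nhds,
    pderiv_sub ((h.thriceDifferentiable_power.contDiffAt θ hθ).differentiableAt (by norm_num))
      (((h.thriceDifferentiable_lossFun hx hpos).contDiffAt θ hθ).differentiableAt (by norm_num)),
    h.pderiv_power_integral hθ, score_of_pos hd hp]
  simp only [pderiv]
  rw [fderiv_comp_apply (φ := fun t => f t x) (hasDerivAt_lossFun hp) hd,
    Real.rpow_sub_one hp.ne']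
  field_simp
  ring

/-- Second derivatives of the cross integrand, in terms of those of `f ^ (1 + β)`. -/
lemma fderiv_fderiv_cross (k l : Fin p) : ∀ᵐ x ∂μ,
    (1 + β) * fderiv ℝ (fun q => fderiv ℝ (fun t =>
        (if β = 0 then Real.log (f t x) else f t x ^ β) * f θ₀ x) q (EuclideanSpace.single k 1)) θ₀
        (EuclideanSpace.single l 1)
      = (if β = 0 then 1 else β) *
        (fderiv ℝ (fun q => fderiv ℝ (fun t => f t x ^ (1 + β)) q (EuclideanSpace.single k 1)) θ₀
          (EuclideanSpace.single l 1)
        - (1 + β) * (score f θ₀ x k * score f θ₀ x l * f θ₀ x ^ (1 + β))) ∧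
    pderiv l (pderiv k (fun t => lossFun β (f t x))) θ₀ * f θ₀ x
      = fderiv ℝ (fun q => fderiv ℝ (fun t => f t x ^ (1 + β)) q (EuclideanSpace.single k 1)) θ₀
          (EuclideanSpace.single l 1)
        - (1 + β) * (score f θ₀ x k * score f θ₀ x l * f θ₀ x ^ (1 + β)) := by
  filter_upwards [h.smooth] with x hx
  rcases h.pos_or_zero x with hpos | hz
  · have hp := hpos θ₀ h.mem_Θ
    have hc : ContDiffAt ℝ 2 (fun t => f t x) θ₀ :=
      (hx.contDiffAt (h.isOpen.mem_nhds h.mem)).of_le (by norm_num)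
    have hd := hc.differentiableAt (by norm_num)
    have e2 : pderiv l (pderiv k (fun t => lossFun β (f t x))) θ₀ * f θ₀ x
      = fderiv ℝ (fun q => fderiv ℝ (fun t => f t x ^ (1 + β)) q (EuclideanSpace.single k 1)) θ₀
          (EuclideanSpace.single l 1)
        - (1 + β) * (score f θ₀ x k * score f θ₀ x l * f θ₀ x ^ (1 + β)) := by
      rw [fderiv_fderiv_rpow_of_pos hc hp, score_of_pos hd hp, score_of_pos hd hp]
      have := fderiv_fderiv_comp_apply (φ := fun t => f t x) (w := lossFun β)
        ((lt_mem_nhds hp).mono fun y hy => hasDerivAt_lossFun (β := β) hy)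
        (hasDerivAt_lossFun_deriv hp) hc (EuclideanSpace.single l 1) (EuclideanSpace.single k 1)
      unfold pderiv
      rw [this, show β - 2 = β - 1 - 1 by ring, show 1 + β - 2 = β - 1 by ring,
        show 1 + β - 1 = β by ring, show (1 : ℝ) + β = β + 1 by ring, Real.rpow_add_one hp.ne',
        Real.rpow_sub_one hp.ne', Real.rpow_sub_one hp.ne']
      field_simp
      ring
    refine ⟨?_, e2⟩
    have := fderiv_fderiv_comp_apply (φ := fun t => f t x)
      (w := fun z => (if β = 0 then Real.log z else z ^ β) * f θ₀ x)
      ((lt_mem_nhds hp).mono fun y hy => hasDerivAt_crossFun (β := β) (f θ₀ x) hy)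
      (hasDerivAt_crossFun_deriv _ (f θ₀ x) hp) hc (EuclideanSpace.single l 1)
      (EuclideanSpace.single k 1)
    rw [this, fderiv_fderiv_rpow_of_pos hc hp, score_of_pos hd hp, score_of_pos hd hp]
    unfold pderiv
    rw [show β - 2 = β - 1 - 1 by ring, show 1 + β - 2 = β - 1 by ring,
      show 1 + β - 1 = β by ring, show (1 : ℝ) + β = β + 1 by ring, Real.rpow_add_one hp.ne',
      Real.rpow_sub_one hp.ne', Real.rpow_sub_one hp.ne']
    field_simp
    ring
  · have hz0 := h.eventually_zero hz h.mem
    have h0 : f θ₀ x = 0 := hz θ₀ h.mem_Θ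
    have hz1 := (fderiv_of_eventually_zero (F := fun t => f t x ^ (1 + β)) (hz0.mono fun t ht => by
      rw [ht, Real.zero_rpow h.one_add_pos.ne'])).2
    have hz2 := (fderiv_of_eventually_zero (θ := θ₀)
      (F := fun t => (if β = 0 then Real.log (f t x) else f t x ^ β) * f θ₀ x)
      (Eventually.of_forall fun t => by rw [h0, mul_zero])).2
    rw [score_of_eventually_zero hz0, hz1, hz2, h0]
    exact ⟨by ring, by ring⟩

/-- For `β ≠ 0`, eliminating the second derivative of `f` between those of `f ^ (1 + β)` and of `f ^
β * f θ₀` writes the integrand as a combination of two functions that differentiation under the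
integral sign makes integrable. For `β = 0` it is the finiteness of the Fisher information. -/
lemma fisher_power_integrable (k l : Fin p) :
    Integrable (fun x => score f θ₀ x k * score f θ₀ x l * f θ₀ x ^ (1 + β)) μ := by
  by_cases hβ : β = 0
  · simpa [hβ] using h.fisher_integrable k l
  have i1 := ((h.power.2.2 (EuclideanSpace.single k 1)).2.2.2
    (EuclideanSpace.single l 1)).2.integrable h.mem
  have i2 := ((h.cross.2.2 (EuclideanSpace.single k 1)).2.2.2
    (EuclideanSpace.single l 1)).2.integrable h.mem
  have hp := h.one_add_pos
  refine ((i1.const_mul (1 + β)⁻¹).sub (i2.const_mul β⁻¹)).congr ?_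
  filter_upwards [h.fderiv_fderiv_cross k l] with x hx
  have := hx.1
  rw [if_neg hβ] at this
  simp only [Pi.sub_apply]
  have e : ∀ a b s : ℝ, (1 + β) * b = β * (a - (1 + β) * s) →
      (1 + β)⁻¹ * a - β⁻¹ * b = s := by
    intro a b s h1
    field_simp
    linarith
  exact e _ _ _ this

lemma hessian_integrable (k l : Fin p) : Integrable
    (fun x => pderiv l (pderiv k (fun t => lossFun β (f t x))) θ₀ * f θ₀ x) μ := by
  have i1 := ((h.power.2.2 (EuclideanSpace.single k 1)).2.2.2
    (EuclideanSpace.single l 1)).2.integrable h.mem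
  refine (i1.sub ((h.fisher_power_integrable k l).const_mul (1 + β))).congr ?_
  filter_upwards [h.fderiv_fderiv_cross k l] with x hx
  rw [hx.2]; rfl

lemma pderiv_pderiv_dpdLoss {x : 𝒳} (hx : ContDiffOn ℝ 3 (fun θ => f θ x) ω)
    (hpos : ∀ θ ∈ Θ, 0 < f θ x) (k l : Fin p) :
    pderiv l (pderiv k (fun t => dpdLoss μ f β t x)) θ₀
      = pderiv l (pderiv k (fun t => ∫ y, f t y ^ (1 + β) ∂μ)) θ₀
        - pderiv l (pderiv k (fun t => lossFun β (f t x))) θ₀ := by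
  have he : (fun t => dpdLoss μ f β t x) =ᶠ[𝓝 θ₀]
      fun t => ∫ y, f t y ^ (1 + β) ∂μ - lossFun β (f t x) :=
    eventually_of_mem (h.isOpen.mem_nhds h.mem) fun t ht => h.dpdLoss_eq (h.subset ht)
  rw [(pderiv_eventuallyEq (pderiv_eventuallyEq he k) l).self_of_nhds]
  exact h.thriceDifferentiable_power.pderiv_pderiv_sub (h.thriceDifferentiable_lossFun hx hpos)
    h.isOpen h.mem l k

lemma ae_good : ∀ᵐ x ∂(densityLaw μ (f θ₀)),
    ContDiffOn ℝ 3 (fun θ => f θ x) ω ∧ ∀ θ ∈ Θ, 0 < f θ x := by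
  rw [ae_densityLaw_iff h.measurable₀]
  filter_upwards [h.smooth] with x hx hp
  exact ⟨hx, fun θ hθ => (h.support θ₀ h.mem_Θ θ hθ x).1 hp⟩

/-- The mean Hessian of the loss at the true parameter is `(1 + β) J_β`. -/
lemma hessian_mean (k l : Fin p) :
    Integrable (fun x => pderiv l (pderiv k (fun t => dpdLoss μ f β t x)) θ₀)
      (densityLaw μ (f θ₀)) ∧
    ∫ x, pderiv l (pderiv k (fun t => dpdLoss μ f β t x)) θ₀ ∂(densityLaw μ (f θ₀))
      = (1 + β) * Jmat μ f β θ₀ k l := by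
  have := h.isProbabilityMeasure
  have he : (fun x => pderiv l (pderiv k (fun t => dpdLoss μ f β t x)) θ₀)
      =ᵐ[densityLaw μ (f θ₀)] fun x => pderiv l (pderiv k (fun t => ∫ y, f t y ^ (1 + β) ∂μ)) θ₀
        - pderiv l (pderiv k (fun t => lossFun β (f t x))) θ₀ := by
    filter_upwards [h.ae_good] with x hx
    exact h.pderiv_pderiv_dpdLoss hx.1 hx.2 k l
  have hi := (integrable_densityLaw_iff h.measurable₀ h.nonneg₀).2 (h.hessian_integrable k l)
  refine ⟨((integrable_const _).sub hi).congr he.symm, ?_⟩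
  have i1 := ((h.power.2.2 (EuclideanSpace.single k 1)).2.2.2
    (EuclideanSpace.single l 1)).2.integrable h.mem
  rw [integral_congr_ae he, integral_sub (integrable_const _) hi, integral_const,
    integral_densityLaw h.measurable₀ h.nonneg₀,
    integral_congr_ae ((h.fderiv_fderiv_cross k l).mono fun x hx => hx.2),
    integral_sub i1 ((h.fisher_power_integrable k l).const_mul (1 + β)), integral_const_mul]
  -- The second derivative of `∫ f ^ (1 + β)` cancels against the integral of the pointwise second
  -- derivative; what remains is `(1 + β) J_β`.
  have := h.power.fderiv_fderiv_eq (k := 1) h.isOpen (EuclideanSpace.single l 1)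
    (EuclideanSpace.single k 1) h.mem
  rw [← this]
  have e : pderiv l (pderiv k (fun t => ∫ y, f t y ^ (1 + β) ∂μ)) θ₀
      = fderiv ℝ (fun q => fderiv ℝ (fun t => ∫ y, f t y ^ (1 + β) ∂μ) q
          (EuclideanSpace.single k 1)) θ₀ (EuclideanSpace.single l 1) := rfl
  rw [e]
  simp [Jmat]

end LocalModel

end Model

/-! ### Moments of the estimating function, and positive definite matrices. -/

section Model

variable {𝒳 : Type*} [MeasurableSpace 𝒳] {p : ℕ} {μ : Measure 𝒳}
  {f : EuclideanSpace ℝ (Fin p) → 𝒳 → ℝ} {Θ ω : Set (EuclideanSpace ℝ (Fin p))}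
  {θ₀ : EuclideanSpace ℝ (Fin p)} {β : ℝ} {M : Fin p → Fin p → Fin p → 𝒳 → ℝ}

/-- The summand of the estimating function at the true parameter. -/
noncomputable def psi (μ : Measure 𝒳) (f : EuclideanSpace ℝ (Fin p) → 𝒳 → ℝ) (β : ℝ)
    (θ₀ : EuclideanSpace ℝ (Fin p)) (k : Fin p) (x : 𝒳) : ℝ :=
  score f θ₀ x k * f θ₀ x ^ β - xiVec μ f β θ₀ k

lemma quadratic_eq_integral {w : 𝒳 → ℝ} {s : Fin p → 𝒳 → ℝ} {J : Matrix (Fin p) (Fin p) ℝ}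
    (hs : ∀ k l, Integrable (fun x => s k x * s l x * w x) μ)
    (hJ : ∀ k l, J k l = ∫ x, s k x * s l x * w x ∂μ) (v : Fin p → ℝ) :
    Integrable (fun x => (∑ k, v k * s k x) ^ 2 * w x) μ ∧
    v ⬝ᵥ J *ᵥ v = ∫ x, (∑ k, v k * s k x) ^ 2 * w x ∂μ := by
  have e : ∀ x, (∑ k, v k * s k x) ^ 2 * w x
      = ∑ k, ∑ l, v k * v l * (s k x * s l x * w x) := by
    intro x
    rw [pow_two, Finset.sum_mul_sum, Finset.sum_mul]
    refine Finset.sum_congr rfl fun k _ => ?_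
    rw [Finset.sum_mul]
    exact Finset.sum_congr rfl fun l _ => by ring
  have hi : ∀ k l, Integrable (fun x => v k * v l * (s k x * s l x * w x)) μ := fun k l =>
    (hs k l).const_mul _
  simp only [e]
  refine ⟨integrable_finsetSum _ fun k _ => integrable_finsetSum _ fun l _ => hi k l, ?_⟩
  rw [integral_finsetSum _ fun k _ => integrable_finsetSum _ fun l _ => hi k l]
  simp only [integral_finsetSum _ fun l _ => hi _ l, integral_const_mul, ← hJ, dotProduct, mulVec,
    Finset.mul_sum]
  exact Finset.sum_congr rfl fun k _ => Finset.sum_congr rfl fun l _ => by ring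

lemma posDef_of_integral {w : 𝒳 → ℝ} (hw : ∀ x, 0 ≤ w x) {s : Fin p → 𝒳 → ℝ}
    {J : Matrix (Fin p) (Fin p) ℝ}
    (hs : ∀ k l, Integrable (fun x => s k x * s l x * w x) μ)
    (hJ : ∀ k l, J k l = ∫ x, s k x * s l x * w x ∂μ)
    (hne : ∀ v : Fin p → ℝ, v ≠ 0 → ¬ ∀ᵐ x ∂μ, (∑ k, v k * s k x) ^ 2 * w x = 0) : J.PosDef := by
  refine Matrix.PosDef.of_dotProduct_mulVec_pos ?_ fun v hv => ?_
  · ext k l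
    rw [conjTranspose_apply, star_trivial, hJ, hJ]
    exact integral_congr_ae (ae_of_all _ fun x => by ring)
  · obtain ⟨hi, he⟩ := quadratic_eq_integral hs hJ v
    rw [star_trivial, he]
    have h0 : 0 ≤ fun x => (∑ k, v k * s k x) ^ 2 * w x :=
      fun x => mul_nonneg (sq_nonneg _) (hw x)
    refine lt_of_le_of_ne (integral_nonneg h0) fun hc => hne v hv ?_
    exact (integral_eq_zero_iff_of_nonneg h0 hi).1 hc.symm

namespace LocalModel

variable (h : LocalModel μ f β Θ ω θ₀ M)

include h

/-- The form in which positive definiteness of the Fisher information passes to the other matrices: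
the components of the score are linearly independent almost surely. -/
lemma score_nondegenerate {v : Fin p → ℝ} (hv : v ≠ 0) :
    ¬ ∀ᵐ x ∂(densityLaw μ (f θ₀)), ∑ k, v k * score f θ₀ x k = 0 := by
  intro hc
  rw [ae_densityLaw_iff h.measurable₀] at hc
  have hq := (quadratic_eq_integral (μ := μ) (s := fun k x => score f θ₀ x k) (w := f θ₀)
    (J := Jmat μ f 0 θ₀) h.fisher_integrable (fun k l => by simp [Jmat]) v).2
  have hpos := h.fisher_posDef.dotProduct_mulVec_pos hv
  rw [star_trivial, hq] at hpos
  refine hpos.ne' (integral_eq_zero_of_ae ?_)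
  filter_upwards [hc] with x hx
  rcases (h.nonneg₀ x).eq_or_lt with h0 | h0
  · simp [← h0]
  · simp [hx h0]

lemma psi_mul_density (x : 𝒳) (k : Fin p) : psi μ f β θ₀ k x * f θ₀ x
    = score f θ₀ x k * f θ₀ x ^ (1 + β) - xiVec μ f β θ₀ k * f θ₀ x := by
  rw [psi, Real.rpow_add' (h.nonneg₀ x) h.one_add_pos.ne', Real.rpow_one]
  ring

lemma density_integrable : Integrable (f θ₀) μ := by
  have := h.isProbabilityMeasure
  have := (integrable_densityLaw_iff (μ := μ) h.measurable₀ h.nonneg₀).1 (integrable_const (1 : ℝ))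
  simpa using this

lemma psi_integrable (k : Fin p) : Integrable (psi μ f β θ₀ k) (densityLaw μ (f θ₀)) := by
  rw [integrable_densityLaw_iff h.measurable₀ h.nonneg₀]
  simp only [h.psi_mul_density]
  exact (h.score_power_integrable h.mem k).sub (h.density_integrable.const_mul _)

lemma psi_integral (k : Fin p) : ∫ x, psi μ f β θ₀ k x ∂(densityLaw μ (f θ₀)) = 0 := by
  rw [integral_densityLaw h.measurable₀ h.nonneg₀]
  simp only [h.psi_mul_density]
  rw [integral_sub (h.score_power_integrable h.mem k) (h.density_integrable.const_mul _),
    integral_const_mul, h.density.integral_eq_one h.mem_Θ, xiVec]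
  ring

lemma psi_mul_psi_density (x : 𝒳) (k l : Fin p) : psi μ f β θ₀ k x * psi μ f β θ₀ l x * f θ₀ x
    = score f θ₀ x k * score f θ₀ x l * f θ₀ x ^ (1 + 2 * β)
      - xiVec μ f β θ₀ l * (score f θ₀ x k * f θ₀ x ^ (1 + β))
      - xiVec μ f β θ₀ k * (score f θ₀ x l * f θ₀ x ^ (1 + β))
      + xiVec μ f β θ₀ k * xiVec μ f β θ₀ l * f θ₀ x := by
  have e1 := Real.rpow_add' (h.nonneg₀ x) h.one_add_pos.ne'
  have hb := h.beta_nonneg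
  have e2 : f θ₀ x ^ (1 + 2 * β) = f θ₀ x ^ (1 + β) * f θ₀ x ^ β := by
    rw [← Real.rpow_add' (h.nonneg₀ x) (by linarith)]
    congr 1; ring
  rw [e2, e1, Real.rpow_one, psi, psi]
  ring

lemma psi_mul_psi_integrable' (k l : Fin p) :
    Integrable (fun x => psi μ f β θ₀ k x * psi μ f β θ₀ l x * f θ₀ x) μ := by
  simp only [h.psi_mul_psi_density]
  exact (((h.variance_integrable k l).sub ((h.score_power_integrable h.mem k).const_mul _)).sub
    ((h.score_power_integrable h.mem l).const_mul _)).add (h.density_integrable.const_mul _)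

lemma psi_mul_psi_integrable (k l : Fin p) :
    Integrable (fun x => psi μ f β θ₀ k x * psi μ f β θ₀ l x) (densityLaw μ (f θ₀)) := by
  rw [integrable_densityLaw_iff h.measurable₀ h.nonneg₀]
  exact h.psi_mul_psi_integrable' k l

lemma Vmat_eq_integral (k l : Fin p) :
    Vmat μ f β θ₀ k l = ∫ x, psi μ f β θ₀ k x * psi μ f β θ₀ l x * f θ₀ x ∂μ := by
  simp only [h.psi_mul_psi_density]
  have i1 := h.variance_integrable k l
  have i2 := (h.score_power_integrable h.mem k).const_mul (xiVec μ f β θ₀ l)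
  have i3 := (h.score_power_integrable h.mem l).const_mul (xiVec μ f β θ₀ k)
  have i4 := h.density_integrable.const_mul (xiVec μ f β θ₀ k * xiVec μ f β θ₀ l)
  have i12 : Integrable (fun x => score f θ₀ x k * score f θ₀ x l * f θ₀ x ^ (1 + 2 * β)
      - xiVec μ f β θ₀ l * (score f θ₀ x k * f θ₀ x ^ (1 + β))) μ := i1.sub i2
  have i123 : Integrable (fun x => score f θ₀ x k * score f θ₀ x l * f θ₀ x ^ (1 + 2 * β)
      - xiVec μ f β θ₀ l * (score f θ₀ x k * f θ₀ x ^ (1 + β))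
      - xiVec μ f β θ₀ k * (score f θ₀ x l * f θ₀ x ^ (1 + β))) μ := i12.sub i3
  rw [integral_add i123 i4, integral_sub i12 i3, integral_sub i1 i2,
    integral_const_mul, integral_const_mul, integral_const_mul,
    h.density.integral_eq_one h.mem_Θ]
  simp only [Vmat, Jmat, Matrix.sub_apply, of_apply, vecMulVec_apply]
  have e : ∀ k, ∫ x, score f θ₀ x k * f θ₀ x ^ (1 + β) ∂μ = xiVec μ f β θ₀ k := fun k => rfl
  rw [e, e]
  ring

lemma psi_covariance (k l : Fin p) :
    ∫ x, psi μ f β θ₀ k x * psi μ f β θ₀ l x ∂(densityLaw μ (f θ₀)) = Vmat μ f β θ₀ k l := by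
  rw [integral_densityLaw h.measurable₀ h.nonneg₀, h.Vmat_eq_integral]

/-- A degenerate direction `v` means that `(vᵀu) f ^ β` is almost surely a constant `c`. If `c ≠ 0`,
then `vᵀu` has the sign of `c` almost surely, although its mean is zero; so `vᵀu = 0` in either
case, against `score_nondegenerate`. -/
lemma Vmat_posDef : (Vmat μ f β θ₀).PosDef := by
  have := h.isProbabilityMeasure
  refine posDef_of_integral h.nonneg₀ h.psi_mul_psi_integrable' h.Vmat_eq_integral fun v hv hz => ?_
  set c := ∑ k, v k * xiVec μ f β θ₀ k with hc
  have h1 : ∀ᵐ x ∂(densityLaw μ (f θ₀)),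
      (∑ k, v k * score f θ₀ x k) * f θ₀ x ^ β = c ∧ 0 < f θ₀ x := by
    rw [ae_densityLaw_iff h.measurable₀]
    filter_upwards [hz] with x hx hp
    refine ⟨?_, hp⟩
    rcases mul_eq_zero.1 hx with h2 | h2
    · have h3 := pow_eq_zero_iff (two_ne_zero) |>.1 h2
      simp only [psi, mul_sub, Finset.sum_sub_distrib] at h3
      rw [hc, ← sub_eq_zero, ← h3, Finset.sum_mul]
      congr 1
      exact Finset.sum_congr rfl fun k _ => by ring
    · exact absurd h2 hp.ne'
  have hi : Integrable (fun x => ∑ k, v k * score f θ₀ x k) (densityLaw μ (f θ₀)) :=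
    integrable_finsetSum _ fun k _ =>
      ((integrable_densityLaw_iff h.measurable₀ h.nonneg₀).2 (h.score_integrable k)).const_mul _
  have h0 : ∫ x, ∑ k, v k * score f θ₀ x k ∂(densityLaw μ (f θ₀)) = 0 := by
    rw [integral_finsetSum _ fun k _ => ((integrable_densityLaw_iff h.measurable₀ h.nonneg₀).2
      (h.score_integrable k)).const_mul _]
    refine Finset.sum_eq_zero fun k _ => ?_
    rw [integral_const_mul, integral_densityLaw h.measurable₀ h.nonneg₀, h.score_centred, mul_zero]
  refine h.score_nondegenerate hv ?_
  by_cases hc0 : c = 0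
  · filter_upwards [h1] with x hx
    rw [hc0] at hx
    exact (mul_eq_zero.1 hx.1).resolve_right (Real.rpow_pos_of_pos hx.2 _).ne'
  · have hpos : ∀ᵐ x ∂(densityLaw μ (f θ₀)), 0 < (∑ k, v k * score f θ₀ x k) * c := by
      filter_upwards [h1] with x hx
      have hb := Real.rpow_pos_of_pos hx.2 β
      have : (∑ k, v k * score f θ₀ x k) * c * f θ₀ x ^ β = c * c := by
        rw [mul_right_comm, hx.1]
      by_contra hneg
      have h2 : (∑ k, v k * score f θ₀ x k) * c * f θ₀ x ^ β ≤ 0 :=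
        mul_nonpos_of_nonpos_of_nonneg (not_lt.1 hneg) hb.le
      have h3 := mul_self_pos.2 hc0
      linarith
    have h2 : ∫ x, (∑ k, v k * score f θ₀ x k) * c ∂(densityLaw μ (f θ₀)) = 0 := by
      rw [integral_mul_const, h0, zero_mul]
    have h3 := (integral_eq_zero_iff_of_nonneg_ae (hpos.mono fun x hx => hx.le)
      (hi.mul_const c)).1 h2
    filter_upwards [h3] with x hx
    exact (mul_eq_zero.1 hx).resolve_right hc0

/-- The weight `f ^ (1 + γ)` is positive on the support, so the quadratic form degenerates only
where the score itself does. -/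
lemma Jmat_posDef {γ : ℝ} (hi : ∀ k l,
    Integrable (fun x => score f θ₀ x k * score f θ₀ x l * f θ₀ x ^ (1 + γ)) μ) :
    (Jmat μ f γ θ₀).PosDef := by
  refine posDef_of_integral (w := fun x => f θ₀ x ^ (1 + γ)) (s := fun k x => score f θ₀ x k)
    (fun x => Real.rpow_nonneg (h.nonneg₀ x) _) hi (fun k l => rfl) fun v hv hz => ?_
  refine h.score_nondegenerate hv ?_
  rw [ae_densityLaw_iff h.measurable₀]
  filter_upwards [hz] with x hx hp
  rcases mul_eq_zero.1 hx with h2 | h2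
  · exact pow_eq_zero_iff (two_ne_zero) |>.1 h2
  · exact absurd h2 (Real.rpow_pos_of_pos hp _).ne'

lemma exists_localExpansion : ∃ δ > 0, Metric.ball θ₀ δ ⊆ ω ∧
    ∀ᵐ x ∂(densityLaw μ (f θ₀)), LocalExpansion (fun t => dpdLoss μ f β t x) θ₀ δ
      (fun k => pderiv k (fun t => dpdLoss μ f β t x) θ₀)
      (Matrix.of fun k l => pderiv l (pderiv k (fun t => dpdLoss μ f β t x)) θ₀)
      (((p : ℝ) + 1) ^ 3 * ∑ j, ∑ k, ∑ l, |M j k l x|) := by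
  obtain ⟨δ, hδ, hsub⟩ := Metric.isOpen_iff.1 h.isOpen θ₀ h.mem
  refine ⟨δ, hδ, hsub, ?_⟩
  have hb : ∀ᵐ x ∂(densityLaw μ (f θ₀)), ∀ j k l, ∀ θ ∈ ω,
      |pderiv j (pderiv k (pderiv l (fun t => dpdLoss μ f β t x))) θ| ≤ M j k l x := by
    refine (withDensity_absolutelyContinuous _ _).ae_le ?_
    exact ae_all_iff.2 fun j => ae_all_iff.2 fun k => ae_all_iff.2 fun l => h.third_bound j k l
  filter_upwards [h.ae_good, hb] with x hx hM
  have ht := h.thriceDifferentiable_dpdLoss hx.1 hx.2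
  refine localExpansion_of_third_bound (fun θ hθ => ht.contDiffAt θ (hsub hθ))
    (fun θ hθ => ht.pderiv θ (hsub hθ)) (fun θ hθ => ht.pderiv_pderiv θ (hsub hθ))
    (by positivity) fun θ hθ j k l => ?_
  refine (hM j k l θ (hsub hθ)).trans ((le_abs_self _).trans ?_)
  calc |M j k l x| ≤ ∑ l, |M j k l x| :=
        Finset.single_le_sum (f := fun l => |M j k l x|) (fun _ _ => abs_nonneg _)
          (Finset.mem_univ l)
    _ ≤ ∑ k, ∑ l, |M j k l x| :=
        Finset.single_le_sum (f := fun k => ∑ l, |M j k l x|)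
          (fun _ _ => Finset.sum_nonneg fun _ _ => abs_nonneg _) (Finset.mem_univ k)
    _ ≤ ∑ j, ∑ k, ∑ l, |M j k l x| :=
        Finset.single_le_sum (f := fun j => ∑ k, ∑ l, |M j k l x|)
          (fun _ _ => Finset.sum_nonneg fun _ _ => Finset.sum_nonneg fun _ _ => abs_nonneg _)
          (Finset.mem_univ j)

lemma bound_sum_integrable : Integrable
    (fun x => ((p : ℝ) + 1) ^ 3 * ∑ j, ∑ k, ∑ l, |M j k l x|) (densityLaw μ (f θ₀)) :=
  (integrable_finsetSum _ fun j _ => integrable_finsetSum _ fun k _ => integrable_finsetSum _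
    fun l _ => ((integrable_densityLaw_iff h.measurable₀ h.nonneg₀).2
      (h.bound_integrable j k l)).abs).const_mul _

end LocalModel

end Model

/-! ### Derivatives of the integrand of the divergence along curves. -/

section Divergence

/-- Coefficients of `∫ f^(1+γ)`, of the cross integral and of `∫ g^(1+γ)` in `sDiv μ γ lam g f`. -/
noncomputable def sDivCoeff (γ lam : ℝ) : ℝ × ℝ × ℝ :=
  if expA γ lam = 0 then (-(1 / (1 + γ)), 1, 1 / (1 + γ))
  else if expB γ lam = 0 then (1 / (1 + γ), 1, -(1 / (1 + γ)))
  else (1 / expA γ lam, -((1 + γ) / (expA γ lam * expB γ lam)), 1 / expB γ lam)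

lemma sDiv_eq {𝒳 : Type*} [MeasurableSpace 𝒳] (μ : Measure 𝒳) (γ lam : ℝ) (g f : 𝒳 → ℝ) :
    sDiv μ γ lam g f = (sDivCoeff γ lam).1 * ∫ x, f x ^ (1 + γ) ∂μ
      + (sDivCoeff γ lam).2.1 * ∫ x, crossTerm γ lam (g x) (f x) ∂μ
      + (sDivCoeff γ lam).2.2 * ∫ x, g x ^ (1 + γ) ∂μ := by
  unfold sDiv sDivCoeff
  split_ifs <;> simp only [] <;> ring

lemma expA_add_expB (γ lam : ℝ) : expA γ lam + expB γ lam = 1 + γ := by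
  unfold expA expB; ring

/-- Written with `a ^ s / a` instead of `a ^ (s - 1)`, so that derivatives at a common value `y`
stay rational expressions in `y` times a power of it. -/
lemma hasDerivAt_rpow_comp {a : ℝ → ℝ} {a' t : ℝ} (s : ℝ) (ha : HasDerivAt a a' t) (h : 0 < a t) :
    HasDerivAt (fun t => a t ^ s) (s * (a t ^ s / a t) * a') t := by
  have := ha.rpow_const (p := s) (Or.inl h.ne')
  rw [Real.rpow_sub_one h.ne'] at this
  convert! this using 1
  ring

/-- The derivative `c₁` is needed as a function near `0`, because it is differentiated again; its
explicit values matter only at `0`, where both curves equal `y`. -/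
lemma crossPower_derivs {a b a₁ b₁ : ℝ → ℝ} {a₂ b₂ y : ℝ} (s r : ℝ) (hy : 0 < y) (ha0 : a 0 = y)
    (hb0 : b 0 = y) (ha : ∀ᶠ t in 𝓝 (0 : ℝ), HasDerivAt a (a₁ t) t) (ha₁ : HasDerivAt a₁ a₂ 0)
    (hb : ∀ᶠ t in 𝓝 (0 : ℝ), HasDerivAt b (b₁ t) t) (hb₁ : HasDerivAt b₁ b₂ 0) :
    ∃ c₁ : ℝ → ℝ, ∃ c₂ : ℝ, (∀ᶠ t in 𝓝 (0 : ℝ), HasDerivAt (fun t => b t ^ s * a t ^ r) (c₁ t) t) ∧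
      HasDerivAt c₁ c₂ 0 ∧ c₁ 0 = y ^ (s + r) * (s * b₁ 0 + r * a₁ 0) / y ∧
      c₂ = y ^ (s + r) * (s * (s - 1) * b₁ 0 ^ 2 + 2 * s * r * b₁ 0 * a₁ 0
        + r * (r - 1) * a₁ 0 ^ 2 + s * y * b₂ + r * y * a₂) / y ^ 2 := by
  have hap : ∀ᶠ t in 𝓝 (0 : ℝ), 0 < a t :=
    ha.self_of_nhds.continuousAt.eventually (lt_mem_nhds (by rwa [ha0]))
  have hbp : ∀ᶠ t in 𝓝 (0 : ℝ), 0 < b t :=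
    hb.self_of_nhds.continuousAt.eventually (lt_mem_nhds (by rwa [hb0]))
  refine ⟨fun t => s * (b t ^ s / b t) * b₁ t * a t ^ r + b t ^ s * (r * (a t ^ r / a t) * a₁ t),
    _, ?_, ?_, ?_, rfl⟩
  · filter_upwards [ha, hb, hap, hbp] with t h1 h2 h3 h4
    exact (hasDerivAt_rpow_comp s h2 h4).mul (hasDerivAt_rpow_comp r h1 h3)
  · have hA := ha.self_of_nhds
    have hB := hb.self_of_nhds
    have hAp := hap.self_of_nhds
    have hBp := hbp.self_of_nhds
    have r1 := hasDerivAt_rpow_comp s hB hBp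
    have r2 := hasDerivAt_rpow_comp r hA hAp
    have := ((((r1.div hB hBp.ne').const_mul s).mul hb₁).mul r2).add
      (r1.mul (((r2.div hA hAp.ne').const_mul r).mul ha₁))
    convert! this using 1
    simp only [ha0, hb0, Pi.mul_apply, Pi.div_apply]
    rw [Real.rpow_add hy]
    field_simp
    ring
  · simp only [ha0, hb0]
    rw [Real.rpow_add hy]
    field_simp

lemma crossLog_derivs {a b a₁ b₁ : ℝ → ℝ} {a₂ b₂ y : ℝ} (s : ℝ) (hy : 0 < y) (ha0 : a 0 = y)
    (hb0 : b 0 = y) (ha : ∀ᶠ t in 𝓝 (0 : ℝ), HasDerivAt a (a₁ t) t) (ha₁ : HasDerivAt a₁ a₂ 0)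
    (hb : ∀ᶠ t in 𝓝 (0 : ℝ), HasDerivAt b (b₁ t) t) (hb₁ : HasDerivAt b₁ b₂ 0) :
    ∃ c₁ : ℝ → ℝ, ∃ c₂ : ℝ,
      (∀ᶠ t in 𝓝 (0 : ℝ), HasDerivAt (fun t => b t ^ s * Real.log (b t / a t)) (c₁ t) t) ∧
      HasDerivAt c₁ c₂ 0 ∧ c₁ 0 = y ^ s * (b₁ 0 - a₁ 0) / y ∧
      c₂ = y ^ s * (2 * s * b₁ 0 * (b₁ 0 - a₁ 0) - b₁ 0 ^ 2 + a₁ 0 ^ 2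
        + y * b₂ - y * a₂) / y ^ 2 := by
  have hap : ∀ᶠ t in 𝓝 (0 : ℝ), 0 < a t :=
    ha.self_of_nhds.continuousAt.eventually (lt_mem_nhds (by rwa [ha0]))
  have hbp : ∀ᶠ t in 𝓝 (0 : ℝ), 0 < b t :=
    hb.self_of_nhds.continuousAt.eventually (lt_mem_nhds (by rwa [hb0]))
  have hlog : ∀ t, HasDerivAt a (a₁ t) t → HasDerivAt b (b₁ t) t → 0 < a t → 0 < b t →
      HasDerivAt (fun t => Real.log (b t / a t)) (b₁ t / b t - a₁ t / a t) t := by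
    intro t h1 h2 h3 h4
    have := (h2.div h1 h3.ne').log (div_pos h4 h3).ne'
    convert! this using 1
    simp only [Pi.div_apply]
    field_simp
  refine ⟨fun t => s * (b t ^ s / b t) * b₁ t * Real.log (b t / a t)
      + b t ^ s * (b₁ t / b t - a₁ t / a t), _, ?_, ?_, ?_, rfl⟩
  · filter_upwards [ha, hb, hap, hbp] with t h1 h2 h3 h4
    exact (hasDerivAt_rpow_comp s h2 h4).mul (hlog t h1 h2 h3 h4)
  · have hA := ha.self_of_nhds
    have hB := hb.self_of_nhds
    have hAp := hap.self_of_nhds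
    have hBp := hbp.self_of_nhds
    have r1 := hasDerivAt_rpow_comp s hB hBp
    have := ((((r1.div hB hBp.ne').const_mul s).mul hb₁).mul (hlog 0 hA hB hAp hBp)).add
      (r1.mul ((hb₁.div hB hBp.ne').sub (ha₁.div hA hAp.ne')))
    convert! this using 1
    simp only [ha0, hb0, Pi.mul_apply, Pi.div_apply, Pi.sub_apply, div_self hy.ne', Real.log_one]
    field_simp
    ring
  · simp only [ha0, hb0, div_self hy.ne', Real.log_one]
    field_simp
    ring

/-- Along smooth positive curves meeting at `t = 0`, the integrand of the `S`-divergence vanishes to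
first order, and its second derivative does not depend on `lam`. -/
lemma crossTerm_derivs {γ lam : ℝ} (hγ : 0 ≤ γ) {a b a₁ b₁ : ℝ → ℝ} {a₂ b₂ y : ℝ} (hy : 0 < y)
    (ha0 : a 0 = y) (hb0 : b 0 = y) (ha : ∀ᶠ t in 𝓝 (0 : ℝ), HasDerivAt a (a₁ t) t)
    (ha₁ : HasDerivAt a₁ a₂ 0) (hb : ∀ᶠ t in 𝓝 (0 : ℝ), HasDerivAt b (b₁ t) t)
    (hb₁ : HasDerivAt b₁ b₂ 0) :
    ∃ c₁ : ℝ → ℝ, ∃ c₂ : ℝ,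
      (∀ᶠ t in 𝓝 (0 : ℝ), HasDerivAt (fun t => crossTerm γ lam (a t) (b t)) (c₁ t) t) ∧
      HasDerivAt c₁ c₂ 0 ∧
      (sDivCoeff γ lam).1 * ((1 + γ) * b₁ 0 * (y ^ (1 + γ) / y)) + (sDivCoeff γ lam).2.1 * c₁ 0
        + (sDivCoeff γ lam).2.2 * ((1 + γ) * a₁ 0 * (y ^ (1 + γ) / y)) = 0 ∧
      (sDivCoeff γ lam).1 * ((1 + γ) * (γ * b₁ 0 ^ 2 + y * b₂) * (y ^ (1 + γ) / y ^ 2))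
        + (sDivCoeff γ lam).2.1 * c₂
        + (sDivCoeff γ lam).2.2 * ((1 + γ) * (γ * a₁ 0 ^ 2 + y * a₂) * (y ^ (1 + γ) / y ^ 2))
        = (1 + γ) * (a₁ 0 - b₁ 0) ^ 2 * (y ^ (1 + γ) / y ^ 2) := by
  have h1γ : 0 < 1 + γ := by linarith
  by_cases hA : expA γ lam = 0
  · obtain ⟨c₁, c₂, h1, h2, h3, h4⟩ := crossLog_derivs (1 + γ) hy ha0 hb0 ha ha₁ hb hb₁
    refine ⟨c₁, c₂, ?_, h2, ?_, ?_⟩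
    · simpa only [crossTerm, hA, if_true] using h1
    · simp only [sDivCoeff, hA, if_true, h3]
      field_simp
      ring
    · simp only [sDivCoeff, hA, if_true, h4]
      field_simp
      ring
  by_cases hB : expB γ lam = 0
  -- The case `B = 0` is the case `A = 0` with the two densities interchanged.
  · obtain ⟨c₁, c₂, h1, h2, h3, h4⟩ := crossLog_derivs (1 + γ) hy hb0 ha0 hb hb₁ ha ha₁
    refine ⟨c₁, c₂, ?_, h2, ?_, ?_⟩
    · simpa only [crossTerm, hA, hB, if_false, if_true] using h1
    · simp only [sDivCoeff, hA, hB, if_false, if_true, h3]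
      field_simp
      ring
    · simp only [sDivCoeff, hA, hB, if_false, if_true, h4]
      field_simp
      ring
  · obtain ⟨c₁, c₂, h1, h2, h3, h4⟩ :=
      crossPower_derivs (expB γ lam) (expA γ lam) hy ha0 hb0 ha ha₁ hb hb₁
    have hs : expB γ lam + expA γ lam = 1 + γ := by rw [add_comm, expA_add_expB]
    have hg : γ = expB γ lam + expA γ lam - 1 := by linarith
    rw [hs] at h3 h4
    refine ⟨c₁, c₂, ?_, h2, ?_, ?_⟩
    · simpa only [crossTerm, hA, hB, if_false] using h1
    · simp only [sDivCoeff, hA, hB, if_false, h3]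
      field_simp
      ring
    · simp only [sDivCoeff, hA, hB, if_false, h4]
      -- With `γ` eliminated by `A + B = 1 + γ`, the claim is a rational identity in free `A` and
      -- `B`; this is why `lam` leaves no trace in the second derivative.
      generalize expA γ lam = A at *
      generalize expB γ lam = B at *
      generalize y ^ (1 + γ) = w at *
      subst hg
      field_simp
      ring

lemma sDivCoeff_diag {γ lam : ℝ} (hγ : 0 ≤ γ) {y : ℝ} (hy : 0 < y) :
    (sDivCoeff γ lam).1 * y ^ (1 + γ) + (sDivCoeff γ lam).2.1 * crossTerm γ lam y y
      + (sDivCoeff γ lam).2.2 * y ^ (1 + γ) = 0 := by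
  have h1γ : 0 < 1 + γ := by linarith
  unfold sDivCoeff crossTerm
  split_ifs with hA hB
  · simp [div_self hy.ne']
  · simp [div_self hy.ne']
  · simp only []
    rw [← Real.rpow_add hy, add_comm (expB γ lam), expA_add_expB]
    have := expA_add_expB γ lam
    field_simp
    rw [← this]; ring

lemma crossTerm_zero (γ lam : ℝ) : crossTerm γ lam 0 0 = 0 := by
  unfold crossTerm
  split_ifs with hA hB
  · simp
  · simp
  · rw [Real.zero_rpow hB, zero_mul]

lemma contDiffAt_crossTerm {E : Type*} [NormedAddCommGroup E] [NormedSpace ℝ E] {γ lam : ℝ}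
    {a b : E → ℝ} {q : E} (ha : ContDiffAt ℝ 2 a q) (hb : ContDiffAt ℝ 2 b q) (hap : 0 < a q)
    (hbp : 0 < b q) : ContDiffAt ℝ 2 (fun q => crossTerm γ lam (a q) (b q)) q := by
  unfold crossTerm
  split_ifs
  · exact (hb.rpow_const_of_ne hbp.ne').mul ((hb.div ha hap.ne').log (div_pos hbp hap).ne')
  · exact (ha.rpow_const_of_ne hap.ne').mul ((ha.div hb hbp.ne').log (div_pos hap hbp).ne')
  · exact (hb.rpow_const_of_ne hbp.ne').mul (ha.rpow_const_of_ne hap.ne')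

lemma hasDerivAt_line_of_contDiffAt {E : Type*} [NormedAddCommGroup E] [NormedSpace ℝ E]
    {φ : E → ℝ} {θ : E} (hφ : ContDiffAt ℝ 2 φ θ) (v : E) :
    (∀ᶠ t in 𝓝 (0 : ℝ), HasDerivAt (fun t : ℝ => φ (θ + t • v)) (fderiv ℝ φ (θ + t • v) v) t) ∧
    HasDerivAt (fun t : ℝ => fderiv ℝ φ (θ + t • v) v)
      (fderiv ℝ (fun q => fderiv ℝ φ q v) θ v) 0 := by
  have hl : ∀ t : ℝ, HasDerivAt (fun s : ℝ => θ + s • v) v t := fun t => by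
    simpa using ((hasDerivAt_id t).smul_const v).const_add θ
  have hq : θ + (0 : ℝ) • v = θ := by simp
  have hev : ∀ᶠ q' in 𝓝 θ, DifferentiableAt ℝ φ q' :=
    (hφ.eventually (by simp)).mono fun q hq => hq.differentiableAt (by norm_num)
  have hcont : Tendsto (fun t : ℝ => θ + t • v) (𝓝 0) (𝓝 θ) := by
    simpa [ContinuousAt] using (hl 0).continuousAt
  refine ⟨(hcont.eventually hev).mono fun t ht => ht.hasFDerivAt.comp_hasDerivAt t (hl t), ?_⟩
  have hd2 : DifferentiableAt ℝ (fun q => fderiv ℝ φ q v) (θ + (0 : ℝ) • v) := by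
    rw [hq]
    exact ((hφ.fderiv_right (m := 1) (by norm_num)).differentiableAt (by norm_num)).clm_apply
      (differentiableAt_const v)
  have h4 := hd2.hasFDerivAt.comp_hasDerivAt (0 : ℝ) (hl 0)
  rw [hq] at h4
  exact h4

end Divergence

lemma integral_lincomb {α : Type*} [MeasurableSpace α] {μ : Measure α} {F₁ F₂ F₃ : α → ℝ}
    (h₁ : Integrable F₁ μ) (h₂ : Integrable F₂ μ) (h₃ : Integrable F₃ μ) (κ₁ κ₂ κ₃ : ℝ) :
    Integrable (fun x => κ₁ * F₁ x + κ₂ * F₂ x + κ₃ * F₃ x) μ ∧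
    ∫ x, (κ₁ * F₁ x + κ₂ * F₂ x + κ₃ * F₃ x) ∂μ
      = κ₁ * ∫ x, F₁ x ∂μ + κ₂ * ∫ x, F₂ x ∂μ + κ₃ * ∫ x, F₃ x ∂μ := by
  have h12 : Integrable (fun x => κ₁ * F₁ x + κ₂ * F₂ x) μ :=
    (h₁.const_mul κ₁).add (h₂.const_mul κ₂)
  refine ⟨h12.add (h₃.const_mul κ₃), ?_⟩
  rw [integral_add h12 (h₃.const_mul κ₃), integral_add (h₁.const_mul κ₁) (h₂.const_mul κ₂),
    integral_const_mul, integral_const_mul, integral_const_mul]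

/-- Combination of three second-order expansions whose lower-order terms cancel. -/
lemma abs_expansion_le {κ₁ κ₂ κ₃ Ga Gb G0 C C0 Ga1 Gb1 C1 Ga2 Gb2 C2 e N : ℝ}
    (hz : κ₁ * G0 + κ₂ * C0 + κ₃ * G0 = 0) (hz1 : κ₁ * Gb1 + κ₂ * C1 + κ₃ * Ga1 = 0)
    (he : 0 ≤ e) (hN : 0 ≤ N)
    (ta : |Ga - G0 - Ga1 - Ga2 / 2| ≤ e / (2 * (|κ₁| + |κ₂| + |κ₃| + 1)) * N)
    (tb : |Gb - G0 - Gb1 - Gb2 / 2| ≤ e / (2 * (|κ₁| + |κ₂| + |κ₃| + 1)) * N)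
    (tc : |C - C0 - C1 - C2 / 2| ≤ e / (2 * (|κ₁| + |κ₂| + |κ₃| + 1)) * N) :
    |2 * (κ₁ * Gb + κ₂ * C + κ₃ * Ga) - (κ₁ * Gb2 + κ₂ * C2 + κ₃ * Ga2)| ≤ e * N := by
  have hK : 0 < |κ₁| + |κ₂| + |κ₃| + 1 := by positivity
  have e1 : 2 * (κ₁ * Gb + κ₂ * C + κ₃ * Ga) - (κ₁ * Gb2 + κ₂ * C2 + κ₃ * Ga2)
      = 2 * (κ₁ * (Gb - G0 - Gb1 - Gb2 / 2) + κ₂ * (C - C0 - C1 - C2 / 2)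
        + κ₃ * (Ga - G0 - Ga1 - Ga2 / 2)) := by linear_combination 2 * hz + 2 * hz1
  have e2 : e * N = 2 * ((|κ₁| + |κ₂| + |κ₃| + 1)
      * (e / (2 * (|κ₁| + |κ₂| + |κ₃| + 1)) * N)) := by field_simp
  have hNn : 0 ≤ e / (2 * (|κ₁| + |κ₂| + |κ₃| + 1)) * N := by positivity
  rw [e1, e2, abs_mul, abs_two]
  generalize e / (2 * (|κ₁| + |κ₂| + |κ₃| + 1)) * N = R at *
  refine mul_le_mul_of_nonneg_left ((abs_add_three _ _ _).trans ?_) zero_le_two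
  rw [abs_mul, abs_mul, abs_mul]
  have := mul_le_mul_of_nonneg_left tb (abs_nonneg κ₁)
  have := mul_le_mul_of_nonneg_left tc (abs_nonneg κ₂)
  have := mul_le_mul_of_nonneg_left ta (abs_nonneg κ₃)
  linarith

/-! ### Second-order expansion of the divergence at the true parameter. -/

namespace LocalModel

variable {𝒳 : Type*} [MeasurableSpace 𝒳] {p : ℕ} {μ : Measure 𝒳}
  {f : EuclideanSpace ℝ (Fin p) → 𝒳 → ℝ} {Θ ω U : Set (EuclideanSpace ℝ (Fin p))}
  {θ₀ : EuclideanSpace ℝ (Fin p)} {β γ lam : ℝ} {M : Fin p → Fin p → Fin p → 𝒳 → ℝ}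
  (h : LocalModel μ f β Θ ω θ₀ M)

include h

/-- Pointwise derivatives of the integrand of the `S`-divergence at the true parameter. -/
lemma crossTerm_fderiv (hγ : 0 ≤ γ) : ∀ᵐ x ∂μ,
    ((sDivCoeff γ lam).1 * f θ₀ x ^ (1 + γ)
      + (sDivCoeff γ lam).2.1 * crossTerm γ lam (f θ₀ x) (f θ₀ x)
      + (sDivCoeff γ lam).2.2 * f θ₀ x ^ (1 + γ) = 0) ∧
    ∀ v : EuclideanSpace ℝ (Fin p) × EuclideanSpace ℝ (Fin p),
      ((sDivCoeff γ lam).1 * fderiv ℝ (fun t => f t x ^ (1 + γ)) θ₀ v.2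
        + (sDivCoeff γ lam).2.1 *
          fderiv ℝ (fun q : EuclideanSpace ℝ (Fin p) × EuclideanSpace ℝ (Fin p) =>
            crossTerm γ lam (f q.1 x) (f q.2 x)) (θ₀, θ₀) v
        + (sDivCoeff γ lam).2.2 * fderiv ℝ (fun t => f t x ^ (1 + γ)) θ₀ v.1 = 0) ∧
      (sDivCoeff γ lam).1 *
          fderiv ℝ (fun q => fderiv ℝ (fun t => f t x ^ (1 + γ)) q v.2) θ₀ v.2
        + (sDivCoeff γ lam).2.1 *
          fderiv ℝ (fun q' => fderiv ℝ
            (fun q : EuclideanSpace ℝ (Fin p) × EuclideanSpace ℝ (Fin p) =>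
              crossTerm γ lam (f q.1 x) (f q.2 x)) q' v) (θ₀, θ₀) v
        + (sDivCoeff γ lam).2.2 *
          fderiv ℝ (fun q => fderiv ℝ (fun t => f t x ^ (1 + γ)) q v.1) θ₀ v.1
        = (1 + γ) * ((∑ k, (v.1 - v.2) k * score f θ₀ x k) ^ 2 * f θ₀ x ^ (1 + γ)) := by
  have h1γ : 0 < 1 + γ := by linarith
  filter_upwards [h.smooth] with x hx
  rcases h.pos_or_zero x with hpos | hz
  · have hp := hpos θ₀ h.mem_Θ
    have hc : ContDiffAt ℝ 2 (fun t => f t x) θ₀ :=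
      (hx.contDiffAt (h.isOpen.mem_nhds h.mem)).of_le (by norm_num)
    have hd := hc.differentiableAt (by norm_num)
    refine ⟨sDivCoeff_diag hγ hp, fun v => ?_⟩
    -- The second differential of the integrand at `(θ₀, θ₀)` in direction `v` is computed on the
    -- lines `θ₀ + t v.1` and `θ₀ + t v.2`, which meet at `t = 0`.
    obtain ⟨ha, ha₁⟩ := hasDerivAt_line_of_contDiffAt hc v.1
    obtain ⟨hb, hb₁⟩ := hasDerivAt_line_of_contDiffAt hc v.2
    obtain ⟨c₁, c₂, k1, k2, k3, k4⟩ := crossTerm_derivs (lam := lam) hγ hp (by simp) (by simp)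
      ha ha₁ hb hb₁
    have hΦ : ContDiffAt ℝ 2 (fun q : EuclideanSpace ℝ (Fin p) × EuclideanSpace ℝ (Fin p) =>
        crossTerm γ lam (f q.1 x) (f q.2 x)) (θ₀, θ₀) :=
      contDiffAt_crossTerm (ContDiffAt.fun_comp (θ₀, θ₀) hc contDiffAt_fst)
        (ContDiffAt.fun_comp (θ₀, θ₀) hc contDiffAt_snd) hp hp
    obtain ⟨e1, e2⟩ := fderiv_eq_of_line (v := v) hΦ (by simpa using k1) k2
    simp only [zero_smul, add_zero] at k3 k4
    rw [e1, e2]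
    constructor
    · refine Eq.trans ?_ k3
      rw [fderiv_rpow_of_pos hd hp, fderiv_rpow_of_pos hd hp, Real.rpow_sub_one hp.ne']
      ring
    · have hu : ∑ k, (v.1 - v.2) k * score f θ₀ x k
          = (fderiv ℝ (fun t => f t x) θ₀ v.1 - fderiv ℝ (fun t => f t x) θ₀ v.2) / f θ₀ x := by
        rw [← map_sub, fderiv_eq_sum_pderiv, Finset.sum_div]
        refine Finset.sum_congr rfl fun k _ => ?_
        rw [score_of_pos hd hp]
        ring
      rw [hu]
      rw [fderiv_fderiv_rpow_of_pos hc hp, fderiv_fderiv_rpow_of_pos hc hp,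
        show 1 + γ - 2 = 1 + γ - 1 - 1 by ring, Real.rpow_sub_one hp.ne' (1 + γ - 1),
        Real.rpow_sub_one hp.ne']
      refine Eq.trans ?_ (k4.trans ?_)
      · field_simp
        ring
      · field_simp
  · have hz0 := h.eventually_zero hz h.mem
    have h0 : f θ₀ x = 0 := hz θ₀ h.mem_Θ
    obtain ⟨z1, z2⟩ := fderiv_of_eventually_zero (F := fun t => f t x ^ (1 + γ))
      (hz0.mono fun t ht => by rw [ht, Real.zero_rpow h1γ.ne'])
    have hzz : (fun q : EuclideanSpace ℝ (Fin p) × EuclideanSpace ℝ (Fin p) =>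
        crossTerm γ lam (f q.1 x) (f q.2 x)) =ᶠ[𝓝 (θ₀, θ₀)] fun _ => 0 := by
      have := (hz0.prod_mk hz0)
      rw [← nhds_prod_eq] at this
      exact this.mono fun q hq => by simp only [hq.1, hq.2, crossTerm_zero]
    refine ⟨by rw [h0, crossTerm_zero, Real.zero_rpow h1γ.ne']; ring, fun v => ?_⟩
    have y1 : ∀ v, (fun q' => fderiv ℝ
            (fun q : EuclideanSpace ℝ (Fin p) × EuclideanSpace ℝ (Fin p) =>
              crossTerm γ lam (f q.1 x) (f q.2 x)) q' v) =ᶠ[𝓝 (θ₀, θ₀)] fun _ => 0 := fun v =>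
      (hzz.fderiv (𝕜 := ℝ)).mono fun q hq => by simp [hq]
    have y2 : fderiv ℝ (fun q : EuclideanSpace ℝ (Fin p) × EuclideanSpace ℝ (Fin p) =>
        crossTerm γ lam (f q.1 x) (f q.2 x)) (θ₀, θ₀) v = 0 := (y1 v).self_of_nhds
    rw [z1, z1, z2, z2, (y1 v).fderiv_eq, y2, h0, Real.zero_rpow h1γ.ne']
    simp

/-- The pointwise identity of `crossTerm_fderiv`, integrated. Integrability of the squared score
against `f ^ (1 + γ)` is a conclusion here, since the other side consists of second derivatives that
are integrable by `d1` and `d2`. -/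
lemma score_quadratic (hγ : 0 ≤ γ) (hθU : θ₀ ∈ U)
    (d1 : DiffUnderIntegral μ U 2 (fun θ x => f θ x ^ (1 + γ)))
    (d2 : DiffUnderIntegral μ (U ×ˢ U) 2 (fun q x => crossTerm γ lam (f q.1 x) (f q.2 x)))
    (v : EuclideanSpace ℝ (Fin p) × EuclideanSpace ℝ (Fin p)) :
    Integrable (fun x => (∑ k, (v.1 - v.2) k * score f θ₀ x k) ^ 2 * f θ₀ x ^ (1 + γ)) μ ∧
    (1 + γ) * ∫ x, (∑ k, (v.1 - v.2) k * score f θ₀ x k) ^ 2 * f θ₀ x ^ (1 + γ) ∂μ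
      = (sDivCoeff γ lam).1 *
          ∫ x, fderiv ℝ (fun q => fderiv ℝ (fun t => f t x ^ (1 + γ)) q v.2) θ₀ v.2 ∂μ
        + (sDivCoeff γ lam).2.1 * ∫ x, fderiv ℝ (fun q' => fderiv ℝ
            (fun q : EuclideanSpace ℝ (Fin p) × EuclideanSpace ℝ (Fin p) =>
              crossTerm γ lam (f q.1 x) (f q.2 x)) q' v) (θ₀, θ₀) v ∂μ
        + (sDivCoeff γ lam).2.2 *
          ∫ x, fderiv ℝ (fun q => fderiv ℝ (fun t => f t x ^ (1 + γ)) q v.1) θ₀ v.1 ∂μ := by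
  have h1γ : 0 < 1 + γ := by linarith
  have i1 := fun v => ((d1.2.2 v).2.2.2 v).2.integrable hθU
  have i2 := ((d2.2.2 v).2.2.2 v).2.integrable (Set.mk_mem_prod hθU hθU)
  obtain ⟨hi, he⟩ := integral_lincomb (i1 v.2) i2 (i1 v.1) (sDivCoeff γ lam).1
    (sDivCoeff γ lam).2.1 (sDivCoeff γ lam).2.2
  have hae := (h.crossTerm_fderiv (lam := lam) hγ).mono fun x hx => (hx.2 v).2
  constructor
  · refine ((hi.congr hae).const_mul (1 + γ)⁻¹).congr (ae_of_all _ fun x => ?_)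
    simp only []
    rw [inv_mul_cancel_left₀ h1γ.ne']
  · rw [← integral_const_mul, ← integral_congr_ae hae, he]

/-- Polarisation of `score_quadratic`, with the second parameter kept at `θ₀`. -/
lemma score_power_mul_integrable (hγ : 0 ≤ γ) (hθU : θ₀ ∈ U)
    (d1 : DiffUnderIntegral μ U 2 (fun θ x => f θ x ^ (1 + γ)))
    (d2 : DiffUnderIntegral μ (U ×ˢ U) 2 (fun q x => crossTerm γ lam (f q.1 x) (f q.2 x)))
    (k l : Fin p) :
    Integrable (fun x => score f θ₀ x k * score f θ₀ x l * f θ₀ x ^ (1 + γ)) μ := by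
  have hi := fun d : EuclideanSpace ℝ (Fin p) =>
    (h.score_quadratic (lam := lam) hγ hθU d1 d2 (d, 0)).1
  have h1 := hi (EuclideanSpace.single k 1 + EuclideanSpace.single l 1)
  have h2 := hi (EuclideanSpace.single k 1)
  have h3 := hi (EuclideanSpace.single l 1)
  refine (((h1.sub h2).sub h3).const_mul (1 / 2)).congr (ae_of_all _ fun x => ?_)
  simp only [sub_zero, PiLp.add_apply, PiLp.single_apply, add_mul, Finset.sum_add_distrib,
    ite_mul, one_mul, zero_mul, Finset.sum_ite_eq', Finset.mem_univ, if_true,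
    Pi.sub_apply]
  ring

lemma Amat_posDef (hγ : 0 ≤ γ) (hθU : θ₀ ∈ U)
    (d1 : DiffUnderIntegral μ U 2 (fun θ x => f θ x ^ (1 + γ)))
    (d2 : DiffUnderIntegral μ (U ×ˢ U) 2 (fun q x => crossTerm γ lam (f q.1 x) (f q.2 x))) :
    (Amat μ f γ θ₀).PosDef :=
  (h.Jmat_posDef (h.score_power_mul_integrable hγ hθU d1 d2)).smul (by linarith)

/-- Second-order expansion of the `S`-divergence between two model densities near the true one. -/
lemma exists_sDiv_expansion (hγ : 0 ≤ γ) (hU : IsOpen U) (hθU : θ₀ ∈ U)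
    (d1 : DiffUnderIntegral μ U 2 (fun θ x => f θ x ^ (1 + γ)))
    (d2 : DiffUnderIntegral μ (U ×ˢ U) 2 (fun q x => crossTerm γ lam (f q.1 x) (f q.2 x)))
    {ε : ℝ} (hε : 0 < ε) :
    ∃ δ > 0, ∀ a b, ‖a - θ₀‖ < δ → ‖b - θ₀‖ < δ →
      |2 * sDiv μ γ lam (f a) (f b) - (a - b).ofLp ⬝ᵥ Amat μ f γ θ₀ *ᵥ (a - b).ofLp|
        ≤ ε * (‖a - θ₀‖ ^ 2 + ‖b - θ₀‖ ^ 2) := by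
  have hK : 0 < |(sDivCoeff γ lam).1| + |(sDivCoeff γ lam).2.1| + |(sDivCoeff γ lam).2.2| + 1 := by
    positivity
  have hε' := div_pos hε (mul_pos two_pos hK)
  obtain ⟨δ₁, hδ₁, t1⟩ := d1.exists_taylor hU hθU hε'
  obtain ⟨δ₂, hδ₂, t2⟩ := d2.exists_taylor (hU.prod hU) (Set.mk_mem_prod hθU hθU) hε'
  refine ⟨min δ₁ δ₂, by positivity, fun a b ha hb => ?_⟩
  have ta := t1 (a - θ₀) (ha.trans_le (min_le_left _ _))
  have tb := t1 (b - θ₀) (hb.trans_le (min_le_left _ _))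
  have hvn : ‖((a - θ₀, b - θ₀) : EuclideanSpace ℝ (Fin p) × EuclideanSpace ℝ (Fin p))‖
      = max ‖a - θ₀‖ ‖b - θ₀‖ := rfl
  have tc := t2 (a - θ₀, b - θ₀) (by
    rw [hvn]
    exact max_lt (ha.trans_le (min_le_right _ _)) (hb.trans_le (min_le_right _ _)))
  have hmax : ‖((a - θ₀, b - θ₀) : EuclideanSpace ℝ (Fin p) × EuclideanSpace ℝ (Fin p))‖ ^ 2
      ≤ ‖a - θ₀‖ ^ 2 + ‖b - θ₀‖ ^ 2 := by
    rw [hvn]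
    rcases max_choice ‖a - θ₀‖ ‖b - θ₀‖ with e | e <;> rw [e] <;> nlinarith [sq_nonneg ‖a - θ₀‖, sq_nonneg ‖b - θ₀‖]
  obtain ⟨-, hquad⟩ := h.score_quadratic (lam := lam) hγ hθU d1 d2 (a - θ₀, b - θ₀)
  have hQ := (quadratic_eq_integral (μ := μ) (s := fun k x => score f θ₀ x k)
    (w := fun x => f θ₀ x ^ (1 + γ)) (J := Jmat μ f γ θ₀)
    (h.score_power_mul_integrable hγ hθU d1 d2) (fun k l => rfl) (a - b).ofLp).2
  have hae := h.crossTerm_fderiv (lam := lam) hγ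
  -- Terms of order zero and one cancel pointwise, hence also after integration. The three Taylor
  -- expansions may therefore be combined with only their second-order terms left.
  have hz := (integral_lincomb (d1.integrable hθU) (d2.integrable (Set.mk_mem_prod hθU hθU))
    (d1.integrable hθU) (sDivCoeff γ lam).1 (sDivCoeff γ lam).2.1 (sDivCoeff γ lam).2.2).2.symm.trans
    (integral_eq_zero_of_ae (hae.mono fun x hx => hx.1))
  have hz1 := (integral_lincomb (((d1.2.2 (b - θ₀)).2).integrable hθU)
    (((d2.2.2 (a - θ₀, b - θ₀)).2).integrable (Set.mk_mem_prod hθU hθU))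
    (((d1.2.2 (a - θ₀)).2).integrable hθU)
    (sDivCoeff γ lam).1 (sDivCoeff γ lam).2.1 (sDivCoeff γ lam).2.2).2.symm.trans
    (integral_eq_zero_of_ae (hae.mono fun x hx => (hx.2 (a - θ₀, b - θ₀)).1))
  have hA : (a - b).ofLp ⬝ᵥ Amat μ f γ θ₀ *ᵥ (a - b).ofLp
      = (1 + γ) * ∫ x, (∑ k, (a - b) k * score f θ₀ x k) ^ 2 * f θ₀ x ^ (1 + γ) ∂μ := by
    rw [Amat, smul_mulVec, dotProduct_smul, smul_eq_mul, hQ]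
  simp only [sub_sub_sub_cancel_right] at hquad
  rw [hA, sDiv_eq, hquad]
  simp only [add_sub_cancel, Prod.mk_add_mk] at ta tb tc
  refine abs_expansion_le hz hz1 hε.le (by positivity) (ta.trans ?_) (tb.trans ?_) (tc.trans ?_)
  · exact mul_le_mul_of_nonneg_left (le_add_of_nonneg_right (sq_nonneg _)) hε'.le
  · exact mul_le_mul_of_nonneg_left (le_add_of_nonneg_left (sq_nonneg _)) hε'.le
  · exact mul_le_mul_of_nonneg_left hmax hε'.le

end LocalModel

/-! ### Events of probability tending to one. -/

section HighProbability

variable {Ω : Type*} [MeasurableSpace Ω] {P : Measure Ω} {S T : ℕ → Ω → Prop}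

/-- The event `S n` holds with probability tending to one. -/
def HighProbability (P : Measure Ω) (S : ℕ → Ω → Prop) : Prop :=
  Tendsto (fun n => P {w | ¬ S n w}) atTop (𝓝 0)

namespace HighProbability

lemma of_imp (hS : HighProbability P S) (hST : ∀ᶠ n in atTop, ∀ᵐ w ∂P, S n w → T n w) :
    HighProbability P T := by
  refine tendsto_of_tendsto_of_tendsto_of_le_of_le' tendsto_const_nhds hS
    (Eventually.of_forall fun _ => zero_le) (hST.mono fun n hn => measure_mono_ae ?_)
  filter_upwards [hn] with w hw hT hs using hT (hw hs)

lemma mono (hS : HighProbability P S) (hST : ∀ n w, S n w → T n w) : HighProbability P T :=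
  hS.of_imp (Eventually.of_forall fun n => ae_of_all _ (hST n))

lemma and (hS : HighProbability P S) (hT : HighProbability P T) :
    HighProbability P fun n w => S n w ∧ T n w := by
  have h := hS.add hT
  rw [add_zero] at h
  refine tendsto_of_tendsto_of_tendsto_of_le_of_le tendsto_const_nhds h
    (fun _ => zero_le) fun n => (measure_mono fun w hw => ?_).trans (measure_union_le _ _)
  exact not_and_or.1 hw

lemma forall_finite {ι : Type*} [Fintype ι] {S : ι → ℕ → Ω → Prop}
    (hS : ∀ k, HighProbability P (S k)) : HighProbability P fun n w => ∀ k, S k n w := by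
  have h := tendsto_finsetSum Finset.univ fun k _ => hS k
  rw [Finset.sum_const_zero] at h
  refine tendsto_of_tendsto_of_tendsto_of_le_of_le tendsto_const_nhds h
    (fun _ => zero_le) fun n => (measure_mono fun w hw => ?_).trans
      (measure_biUnion_finset_le Finset.univ fun k => {w | ¬ S k n w})
  obtain ⟨k, hk⟩ := not_forall.1 hw
  exact Set.mem_biUnion (Finset.mem_univ k) hk

end HighProbability

lemma highProbability_dist_lt {E : Type*} [PseudoMetricSpace E] {Y : ℕ → Ω → E} {c : E}
    (h : TendstoInMeasure P Y atTop (fun _ => c)) {ε : ℝ} (hε : 0 < ε) :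
    HighProbability P fun n w => dist (Y n w) c < ε := by
  rw [tendstoInMeasure_iff_dist] at h
  simpa only [HighProbability, not_lt] using h ε hε

end HighProbability

/-! ### Tightness of standardized means, and negligible remainders. -/

section Sample

variable {𝒳 Ω : Type*} [MeasurableSpace 𝒳] [MeasurableSpace Ω] {P : Measure Ω}
  [IsProbabilityMeasure P] {X : ℕ → Ω → 𝒳} {ν : Measure 𝒳}

lemma highProbability_empMean (hX : ∀ i, Measurable (X i)) (hind : iIndepFun X P)
    (hlaw : ∀ i, P.map (X i) = ν) {F : 𝒳 → ℝ} (hF : Integrable F ν) {η : ℝ} (hη : 0 < η) :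
    HighProbability P fun n w =>
      |empMean F (fun i : Fin n => X i w) - ∫ x, F x ∂ν| < η := by
  simpa only [HighProbability, not_lt] using tendsto_measure_empMean_sub hX hind hlaw hF hη

/-- Chebyshev's inequality for standardized empirical means. -/
lemma measure_sqrt_mul_empMean_le (hX : ∀ i, Measurable (X i)) (hind : iIndepFun X P)
    (hlaw : ∀ i, P.map (X i) = ν) {F : 𝒳 → ℝ} (hF : MemLp F 2 ν) (hF0 : ∫ x, F x ∂ν = 0) {a : ℝ}
    (ha : 0 < a) (n : ℕ) : P {w | a ≤ |√n * empMean F (fun i : Fin n => X i w)|}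
      ≤ ENNReal.ofReal ((∫ x, F x ^ 2 ∂ν) / a ^ 2) := by
  have hm := hF.aestronglyMeasurable
  have hL : ∀ i, MemLp (fun w => F (X i w)) 2 P := fun i => by
    rw [← hlaw i] at hF
    exact hF.comp_measurePreserving ⟨hX i, rfl⟩
  have hsum : (fun w => √n * empMean F (fun i : Fin n => X i w))
      = fun w => (√n)⁻¹ * (∑ k ∈ Finset.range n, fun w => F (X k w)) w := by
    ext w
    rw [sqrt_mul_empMean F n (fun i => X i w), Finset.sum_apply]
  have hS : MemLp (fun w => √n * empMean F (fun i : Fin n => X i w)) 2 P := by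
    rw [hsum]
    exact (memLp_finsetSum' _ fun i _ => hL i).const_mul _
  have hE : ∫ w, √n * empMean F (fun i : Fin n => X i w) ∂P = 0 := by
    simp only [hsum, Finset.sum_apply]
    rw [integral_const_mul, integral_finsetSum _ fun i _ => (hL i).integrable one_le_two]
    simp [integral_comp_sample hX hlaw _ hm, hF0]
  have hVar : Var[fun w => √n * empMean F (fun i : Fin n => X i w); P] ≤ ∫ x, F x ^ 2 ∂ν := by
    rw [hsum, variance_const_mul, IndepFun.variance_sum (fun i _ => hL i)
      fun i _ j _ hij => (iIndepFun_comp hX hind hlaw hm.aemeasurable).indepFun hij]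
    have hv : ∀ i, Var[fun w => F (X i w); P] = ∫ x, F x ^ 2 ∂ν := fun i => by
      rw [variance_of_integral_eq_zero (hL i).aestronglyMeasurable.aemeasurable
        (by rw [integral_comp_sample hX hlaw i hm, hF0])]
      exact integral_comp_sample hX hlaw i (F := fun x => F x ^ 2) (hm.pow 2)
    simp only [hv, Finset.sum_const, Finset.card_range, nsmul_eq_mul, inv_pow]
    rw [Real.sq_sqrt (Nat.cast_nonneg n), ← mul_assoc]
    exact mul_le_of_le_one_left (integral_nonneg fun x => sq_nonneg _) inv_mul_le_one
  have := meas_ge_le_variance_div_sq hS ha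
  rw [hE] at this
  simp only [sub_zero] at this
  exact this.trans (ENNReal.ofReal_le_ofReal (by gcongr))

/-- Tightness of a vector of standardized empirical means. -/
lemma exists_measure_norm_empMean_le (hX : ∀ i, Measurable (X i)) (hind : iIndepFun X P)
    (hlaw : ∀ i, P.map (X i) = ν) {p : ℕ} {s : Fin p → 𝒳 → ℝ} (hs : ∀ k, MemLp (s k) 2 ν)
    (hs0 : ∀ k, ∫ x, s k x ∂ν = 0) :
    ∃ B : ℝ, 0 ≤ B ∧ ∀ a > 0, ∀ n : ℕ,
      P {w | a ≤ √n * ‖fun k => empMean (s k) (fun i : Fin n => X i w)‖}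
        ≤ ENNReal.ofReal (B / a ^ 2) := by
  refine ⟨∑ k, ∫ x, s k x ^ 2 ∂ν, Finset.sum_nonneg fun k _ => integral_nonneg fun x => sq_nonneg _,
    fun a ha n => ?_⟩
  rw [Finset.sum_div, ENNReal.ofReal_sum_of_nonneg fun k _ =>
    div_nonneg (integral_nonneg fun x => sq_nonneg _) (sq_nonneg a)]
  refine (measure_mono fun w hw => ?_).trans ((measure_biUnion_finset_le Finset.univ
    fun k => {w | a ≤ |√n * empMean (s k) (fun i : Fin n => X i w)|}).trans
    (Finset.sum_le_sum fun k _ => measure_sqrt_mul_empMean_le hX hind hlaw (hs k) (hs0 k) ha n))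
  by_contra hc
  simp only [Set.mem_iUnion, Finset.mem_univ, Set.mem_ofPred_eq, exists_prop, true_and, not_exists,
    not_le] at hc hw
  have : ‖√n • fun k => empMean (s k) (fun i : Fin n => X i w)‖ < a :=
    (pi_norm_lt_iff ha).2 hc
  rw [norm_smul, Real.norm_eq_abs, abs_of_nonneg (Real.sqrt_nonneg _)] at this
  linarith

/-- Replacing a statistic by another one at distance `o(‖ψ_n‖²)` does not affect the limit law at
rate `n`. -/
lemma tendstoInDistribution_of_quadratic_approx (hX : ∀ i, Measurable (X i)) (hind : iIndepFun X P)
    (hlaw : ∀ i, P.map (X i) = ν) {p : ℕ} {s : Fin p → 𝒳 → ℝ} (hs : ∀ k, MemLp (s k) 2 ν)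
    (hs0 : ∀ k, ∫ x, s k x ∂ν = 0) {Ω' : Type*} [MeasurableSpace Ω'] {P' : Measure Ω'}
    [IsProbabilityMeasure P'] {Z : Ω' → ℝ} {Y Q : ℕ → Ω → ℝ}
    (hQ : TendstoInDistribution (fun (n : ℕ) w => (n : ℝ) * Q n w) atTop Z (fun _ => P) P')
    (hY : ∀ n, AEMeasurable (Y n) P)
    (happ : ∀ ε > 0, HighProbability P fun n w =>
      |Y n w - Q n w| ≤ ε * ‖fun k => empMean (s k) (fun i : Fin n => X i w)‖ ^ 2) :
    TendstoInDistribution (fun (n : ℕ) w => (n : ℝ) * Y n w) atTop Z (fun _ => P) P' := by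
  refine tendstoInDistribution_of_tendstoInMeasure_sub (X := fun (n : ℕ) w => (n : ℝ) * Q n w)
    (fun (n : ℕ) w => (n : ℝ) * Y n w) Z hQ ?_ (fun n => (hY n).const_mul _)
  obtain ⟨B, hB, htight⟩ := exists_measure_norm_empMean_le hX hind hlaw hs hs0
  rw [tendstoInMeasure_iff_norm]
  intro e he
  rw [ENNReal.tendsto_nhds_zero]
  intro τ hτ
  -- `t` is the probability allowed for `√n ‖ψ‖` to exceed `√((B + 1) / t)`. Off that event `n ‖ψ‖²
  -- < (B + 1) / t`, so the relative accuracy `e * t / (B + 1)` yields an error below `e`. Using `B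
  -- + 1` covers `B = 0`.
  obtain ⟨t, ht0, htτ⟩ : ∃ t : ℝ, 0 < t ∧ ENNReal.ofReal t ≤ τ / 2 := by
    rcases eq_or_ne τ ⊤ with rfl | hτt
    · exact ⟨1, one_pos, by simp [ENNReal.top_div_of_ne_top]⟩
    · refine ⟨(τ / 2).toReal, ENNReal.toReal_pos (ENNReal.half_pos hτ.ne').ne'
        (ENNReal.div_ne_top hτt (by simp)), ?_⟩
      rw [ENNReal.ofReal_toReal (ENNReal.div_ne_top hτt (by simp))]
  have hε : 0 < e * t / (B + 1) := by positivity
  have h1 := ENNReal.tendsto_nhds_zero.1 (happ _ hε) (τ / 2) (ENNReal.half_pos hτ.ne')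
  filter_upwards [h1] with n hn
  have hsq : 0 < √((B + 1) / t) := Real.sqrt_pos.2 (by positivity)
  have h2 : P {w | √((B + 1) / t) ≤ √n * ‖fun k => empMean (s k) (fun i : Fin n => X i w)‖}
      ≤ τ / 2 := by
    refine (htight _ hsq n).trans ((ENNReal.ofReal_le_ofReal ?_).trans htτ)
    rw [Real.sq_sqrt (by positivity), div_div_eq_mul_div, div_le_iff₀ (by positivity)]
    nlinarith
  refine (measure_mono fun w hw => ?_).trans ((measure_union_le _ _).trans
    ((add_le_add hn h2).trans (ENNReal.add_halves τ).le))
  by_contra hc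
  rw [Set.mem_union, not_or] at hc
  simp only [Set.mem_ofPred_eq, Real.norm_eq_abs, Pi.sub_apply, Pi.zero_apply, sub_zero] at hw
  obtain ⟨hc1, hc2⟩ := hc
  rw [Set.mem_ofPred_eq, not_not] at hc1
  rw [Set.mem_ofPred_eq, not_le] at hc2
  set N := ‖fun k => empMean (s k) (fun i : Fin n => X i w)‖ with hN
  have hN0 : 0 ≤ N := norm_nonneg _
  have hn0 : (0 : ℝ) ≤ n := Nat.cast_nonneg n
  have h3 : (n : ℝ) * N ^ 2 < (B + 1) / t := by
    have := pow_lt_pow_left₀ hc2 (by positivity) two_ne_zero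
    rwa [mul_pow, Real.sq_sqrt hn0, Real.sq_sqrt (by positivity)] at this
  have h4 : |(n : ℝ) * Y n w - n * Q n w| ≤ e * t / (B + 1) * (n * N ^ 2) := by
    rw [← mul_sub, abs_mul, abs_of_nonneg hn0]
    nlinarith [mul_le_mul_of_nonneg_left hc1 hn0]
  have h5 : e * t / (B + 1) * (n * N ^ 2) < e := by
    calc e * t / (B + 1) * (n * N ^ 2) < e * t / (B + 1) * ((B + 1) / t) := by gcongr
      _ = e := by field_simp
  linarith

end Sample

/-! ### Existence and linear representation of the estimators. -/

section Estimation

variable {𝒳 Ω : Type*} [MeasurableSpace 𝒳] [MeasurableSpace Ω] {p r : ℕ} {μ : Measure 𝒳}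
  {f : EuclideanSpace ℝ (Fin p) → 𝒳 → ℝ} {Θ ω : Set (EuclideanSpace ℝ (Fin p))}
  {θ₀ : EuclideanSpace ℝ (Fin p)} {β : ℝ} {M : Fin p → Fin p → Fin p → 𝒳 → ℝ}
  {P : Measure Ω} {X : ℕ → Ω → 𝒳}

/-- The estimating function at the true parameter. -/
noncomputable def psiMean (μ : Measure 𝒳) (f : EuclideanSpace ℝ (Fin p) → 𝒳 → ℝ) (β : ℝ)
    (θ₀ : EuclideanSpace ℝ (Fin p)) {n : ℕ} (x : Fin n → 𝒳) : Fin p → ℝ :=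
  fun k => empMean (psi μ f β θ₀ k) x

/-- A sample whose objective function is close to its population counterpart near `θ₀`. -/
structure RegularSample (μ : Measure 𝒳) (f : EuclideanSpace ℝ (Fin p) → 𝒳 → ℝ) (β : ℝ)
    (ω : Set (EuclideanSpace ℝ (Fin p))) (θ₀ : EuclideanSpace ℝ (Fin p)) (δ M₀ η : ℝ) {n : ℕ}
    (x : Fin n → 𝒳) : Prop where
  expansion : ∃ b m, LocalExpansion (dpdObjective μ f β x) θ₀ δ
    (fun k => -(1 + β) * psiMean μ f β θ₀ x k) b m ∧ m ≤ M₀ ∧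
    ∀ k l, |b k l - (1 + β) * Jmat μ f β θ₀ k l| ≤ η
  estFun : ∀ θ ∈ ω, dpdEstFun μ f β x θ
    = fun k => -(1 / (1 + β)) * pderiv k (dpdObjective μ f β x) θ

namespace LocalModel

variable (h : LocalModel μ f β Θ ω θ₀ M)

include h

/-- The empty sample is excluded: there the objective is identically zero, while the estimating
function is `-ξ_β`. -/
lemma dpdEstFun_eq {n : ℕ} (hn : n ≠ 0) {x : Fin n → 𝒳}
    (hx : ∀ i, ContDiffOn ℝ 3 (fun θ => f θ (x i)) ω ∧ ∀ θ ∈ Θ, 0 < f θ (x i))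
    {θ : EuclideanSpace ℝ (Fin p)} (hθ : θ ∈ ω) : dpdEstFun μ f β x θ
      = fun k => -(1 / (1 + β)) * pderiv k (dpdObjective μ f β x) θ := by
  ext k
  have hn' : (n : ℝ) ≠ 0 := Nat.cast_ne_zero.2 hn
  have hp := h.one_add_pos.ne'
  have e : pderiv k (dpdObjective μ f β x) θ
      = empMean (fun y => pderiv k (fun t => dpdLoss μ f β t y) θ) x :=
    pderiv_empMean (ℓ := fun t y => dpdLoss μ f β t y) (fun i =>
      ((h.thriceDifferentiable_dpdLoss (hx i).1 (hx i).2).contDiffAt θ hθ).differentiableAt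
        (by norm_num)) k
  rw [e, empMean, dpdEstFun]
  simp only [fun i => h.pderiv_dpdLoss (hx i).1 (hx i).2 hθ k]
  rw [← Finset.mul_sum, Finset.sum_sub_distrib, Finset.sum_const, Finset.card_univ,
    Fintype.card_fin, nsmul_eq_mul]
  field_simp

/-- `δ` and `M₀` do not depend on `η`, so later arguments may choose `η` in terms of them. `M₀`
exceeds the mean of the dominating function by one, and the law of large numbers keeps the empirical
mean below it. -/
lemma exists_regularSample [IsProbabilityMeasure P] (hX : IsSample P X μ f θ₀) :
    ∃ δ > 0, Metric.ball θ₀ δ ⊆ ω ∧ ∃ M₀, 0 ≤ M₀ ∧ ∀ η > 0, HighProbability P fun n w =>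
      RegularSample μ f β ω θ₀ δ M₀ η (fun i : Fin n => X i w) := by
  obtain ⟨δ, hδ, hsub, hexp⟩ := h.exists_localExpansion
  refine ⟨δ, hδ, hsub, (∫ x, ((p : ℝ) + 1) ^ 3 * ∑ j, ∑ k, ∑ l, |M j k l x|
    ∂(densityLaw μ (f θ₀))) + 1, ?_, fun η hη => ?_⟩
  · have : 0 ≤ ∫ x, ((p : ℝ) + 1) ^ 3 * ∑ j, ∑ k, ∑ l, |M j k l x| ∂(densityLaw μ (f θ₀)) :=
      integral_nonneg fun x => by positivity
    linarith
  have h1 := highProbability_empMean hX.measurable hX.indep hX.law h.bound_sum_integrable one_pos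
  have h2 := HighProbability.forall_finite fun k => HighProbability.forall_finite fun l =>
    highProbability_empMean hX.measurable hX.indep hX.law (h.hessian_mean k l).1 hη
  refine (h1.and h2).of_imp ?_
  filter_upwards [eventually_ne_atTop 0] with n hn
  filter_upwards [ae_forall_sample hX.measurable hX.law (h.ae_good.and hexp)] with w hw hS
  obtain ⟨hS1, hS2⟩ := hS
  refine ⟨⟨Matrix.of fun k l => empMean
      (fun x => pderiv l (pderiv k (fun t => dpdLoss μ f β t x)) θ₀) (fun i : Fin n => X i w),
    empMean (fun x => ((p : ℝ) + 1) ^ 3 * ∑ j, ∑ k, ∑ l, |M j k l x|) (fun i : Fin n => X i w),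
    ?_, ?_, fun k l => ?_⟩, fun θ hθ => h.dpdEstFun_eq hn (fun i => (hw i).1) hθ⟩
  · have e : (fun k => -(1 + β) * psiMean μ f β θ₀ (fun i : Fin n => X i w) k)
        = fun k => empMean (fun x => pderiv k (fun t => dpdLoss μ f β t x) θ₀)
          (fun i : Fin n => X i w) := by
      ext k
      rw [psiMean, empMean, empMean]
      simp only [fun i => h.pderiv_dpdLoss (hw i).1.1 (hw i).1.2 h.mem k, ← Finset.mul_sum, psi]
      ring
    rw [e]
    exact LocalExpansion.empMean (ℓ := fun t y => dpdLoss μ f β t y)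
      (g := fun k x => pderiv k (fun t => dpdLoss μ f β t x) θ₀)
      (b := fun k l x => pderiv l (pderiv k (fun t => dpdLoss μ f β t x)) θ₀)
      (fun i => (hw i).2)
  · have := (abs_lt.1 hS1).2
    linarith
  · have := hS2 k l
    rw [(h.hessian_mean k l).2] at this
    exact this.le

lemma psi_memLp (k : Fin p) : MemLp (psi μ f β θ₀ k) 2 (densityLaw μ (f θ₀)) := by
  rw [memLp_two_iff_integrable_sq (h.psi_integrable k).aestronglyMeasurable]
  simpa only [sq] using h.psi_mul_psi_integrable k k

/-- Restricted estimators are asymptotically linear in the estimating function at `θ₀`. -/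
lemma restricted_representation [IsProbabilityMeasure P] (hX : IsSample P X μ f θ₀)
    {R : EuclideanSpace ℝ (Fin p) → EuclideanSpace ℝ (Fin r)} (hR : ContDiffAt ℝ 1 R θ₀)
    (hrank : (Hmat R θ₀).rank = r) (h0 : R θ₀ = 0)
    {est : (n : ℕ) → (Fin n → 𝒳) → EuclideanSpace ℝ (Fin p)}
    (hest : IsRestrictedMDPDE P X μ f R β Θ θ₀ est) {ε : ℝ} (hε : 0 < ε) :
    HighProbability P fun n w =>
      ‖(est n (fun i => X i w) - θ₀).ofLp - ((Jmat μ f β θ₀)⁻¹ -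
        projMat (Jmat μ f β θ₀) (Hmat R θ₀)) *ᵥ psiMean μ f β θ₀ (fun i : Fin n => X i w)‖
      ≤ ε * ‖psiMean μ f β θ₀ (fun i : Fin n => X i w)‖ := by
  have hc := h.one_add_pos
  obtain ⟨δ, hδ, hsub, M₀, hM₀, hreg⟩ := h.exists_regularSample hX
  obtain ⟨η₁, hη₁, hrep⟩ := exists_representation h.posDef hR h0 hrank hc hM₀ hδ hε
  obtain ⟨η₂, hη₂, hmult⟩ := exists_multiplier hR hrank hc
  have hclose := highProbability_dist_lt hest.consistent (lt_min hδ (lt_min hη₁ hη₂))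
  refine (((hreg η₁ hη₁).and hclose).and hest.isEstimator).mono fun n w hw => ?_
  obtain ⟨⟨⟨⟨b, m, hexp, hm, hb⟩, hfun⟩, hd⟩, he⟩ := hw
  set x : Fin n → 𝒳 := fun i => X i w
  set θ := est n x
  have hball : θ ∈ Metric.ball θ₀ δ := hd.trans_le (min_le_left _ _)
  rw [dist_eq_norm] at hd
  have hd1 := hd.trans_le ((min_le_right _ _).trans (min_le_left _ _))
  have hd2 := hd.trans_le ((min_le_right _ _).trans (min_le_right _ _))
  have hRθ : R θ = 0 := (hest.mem n x).2
  have hmul : ∃ m : Fin r → ℝ, (fun k => -(1 / (1 + β)) * pderiv k (dpdObjective μ f β x) θ)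
      + Hmat R θ *ᵥ m = 0 := by
    rcases he with ⟨m, hm⟩ | hmin
    · exact ⟨m, by rw [← hfun θ (hsub hball)]; exact hm⟩
    · refine hmult _ θ hd2 (hexp.contDiffAt θ hball) hRθ ?_
      -- Near `θ₀` the set `Θ` is a full neighbourhood, so a local minimizer over `Θ₀` is one over
      -- `{h = 0}`, and the multiplier rule applies.
      have hΘ : ∀ᶠ t in 𝓝 θ, t ∈ Θ :=
        mem_of_superset (h.isOpen.mem_nhds (hsub hball)) h.subset
      have hmin' := eventually_nhdsWithin_iff.1 hmin
      refine eventually_nhdsWithin_iff.2 ?_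
      filter_upwards [hΘ, hmin'] with t ht hmt hRt using hmt ⟨ht, hRt⟩
  obtain ⟨m', hm'⟩ := hmul
  have := hrep _ _ b m hexp hm hb θ hd1 hRθ m' hm'
  have e : (fun k => -(1 / (1 + β)) * (-(1 + β) * psiMean μ f β θ₀ x k))
      = psiMean μ f β θ₀ x := by
    ext k
    field_simp
  rwa [e] at this

lemma highProbability_norm_psiMean [IsProbabilityMeasure P] (hX : IsSample P X μ f θ₀) {η : ℝ}
    (hη : 0 < η) :
    HighProbability P fun n w => ‖psiMean μ f β θ₀ (fun i : Fin n => X i w)‖ < η := by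
  refine (HighProbability.forall_finite fun k => highProbability_empMean hX.measurable hX.indep
    hX.law (h.psi_integrable k) hη).mono fun n w hw => (pi_norm_lt_iff hη).2 fun k => ?_
  have := hw k
  rwa [h.psi_integral k, sub_zero] at this

lemma measurable_dpdLoss {θ : EuclideanSpace ℝ (Fin p)} (hθ : θ ∈ Θ) :
    Measurable (dpdLoss μ f β θ) := by
  have := h.density.measurable_apply hθ
  unfold dpdLoss
  split_ifs
  · exact this.log.neg
  · exact measurable_const.sub ((this.pow_const β).const_mul _)

/-- Restricted minimum density power divergence estimators exist. -/
lemma exists_isRestrictedMDPDE [IsProbabilityMeasure P] (hX : IsSample P X μ f θ₀)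
    {R : EuclideanSpace ℝ (Fin p) → EuclideanSpace ℝ (Fin r)} (hR : ContDiffAt ℝ 1 R θ₀)
    (h0 : R θ₀ = 0) : ∃ est, IsRestrictedMDPDE P X μ f R β Θ θ₀ est := by
  have hc := h.one_add_pos
  obtain ⟨δ, hδ, hsub, M₀, hM₀, hreg⟩ := h.exists_regularSample hX
  obtain ⟨ρ₀, hρ₀, η, hη, C, hC, hgrad⟩ := exists_norm_le_gradient h.posDef θ₀ hc hM₀ hδ
  obtain ⟨ρ₁, hρ₁, hcont⟩ := Metric.eventually_nhds_iff.1 (hR.eventually (by simp))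
  -- Within this radius the gradient bound applies, the ball stays in `ω`, and `R` is continuous,
  -- which makes `K` compact.
  set ρ := min ρ₀ (min (δ / 2) (ρ₁ / 2)) with hρ
  have hρ0 : 0 < ρ := by positivity
  have hρω : Metric.closedBall θ₀ ρ ⊆ ω := fun t ht => hsub (by
    have := (Metric.mem_closedBall.1 ht).trans ((min_le_right _ _).trans (min_le_left _ _))
    rw [Metric.mem_ball]; linarith)
  have hRc : ContinuousOn R (Metric.closedBall θ₀ ρ) := fun t ht => by
    have := (Metric.mem_closedBall.1 ht).trans ((min_le_right _ _).trans (min_le_right _ _))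
    exact (hcont (y := t) (by linarith)).continuousAt.continuousWithinAt
  set K := Metric.closedBall θ₀ ρ ∩ R ⁻¹' {0} with hK
  have hKc : IsCompact K := (isCompact_closedBall θ₀ ρ).of_isClosed_subset
    (hRc.preimage_isClosed_of_isClosed Metric.isClosed_closedBall isClosed_singleton)
    Set.inter_subset_left
  have hθ₀K : θ₀ ∈ K := ⟨Metric.mem_closedBall_self hρ0.le, h0⟩
  set ν := densityLaw μ (f θ₀) with hν
  -- On samples that meet the measurable null set `N` the objective is replaced by `0`; this makes
  -- it continuous in the parameter for every sample and measurable in the sample.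
  set N := toMeasurable ν {x | ¬ (ContDiffOn ℝ 3 (fun θ => f θ x) ω ∧ ∀ θ ∈ Θ, 0 < f θ x)} with hN
  have hN0 : ∀ᵐ x ∂ν, x ∉ N := by
    rw [ae_iff]
    simp only [not_not]
    exact (measure_toMeasurable _).trans (ae_iff.1 h.ae_good)
  have hNgood : ∀ x ∉ N, ContDiffOn ℝ 3 (fun θ => f θ x) ω ∧ ∀ θ ∈ Θ, 0 < f θ x := fun x hx => by
    by_contra hcon
    exact hx (subset_toMeasurable _ _ hcon)
  classical
  have hsel : ∀ n : ℕ, ∃ s : (Fin n → 𝒳) → EuclideanSpace ℝ (Fin p), Measurable s ∧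
      ∀ x, s x ∈ K ∧ ∀ k ∈ K, (if ∀ i, x i ∉ N then dpdObjective μ f β x (s x) else 0)
        ≤ if ∀ i, x i ∉ N then dpdObjective μ f β x k else 0 := by
    intro n
    refine exists_measurable_argmin hKc ⟨θ₀, hθ₀K⟩
      (F := fun x k => if ∀ i, x i ∉ N then dpdObjective μ f β x k else 0)
      (fun k hk => ?_) fun x => ?_
    · refine Measurable.ite ?_ ?_ measurable_const
      · have : {x : Fin n → 𝒳 | ∀ i, x i ∉ N} = ⋂ i, (fun x => x i) ⁻¹' Nᶜ := by
          ext x; simp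
        rw [this]
        exact MeasurableSet.iInter fun i =>
          measurable_pi_apply i (measurableSet_toMeasurable _ _).compl
      · have hm := h.measurable_dpdLoss (h.subset (hρω hk.1))
        unfold dpdObjective
        exact (Finset.measurable_fun_sum _ fun i _ => hm.comp (measurable_pi_apply i)).const_mul _
    · split_ifs with hx
      · unfold dpdObjective
        refine continuousOn_const.mul (continuousOn_finsetSum _ fun i _ k hk => ?_)
        obtain ⟨g1, g2⟩ := hNgood _ (hx i)
        exact ((h.thriceDifferentiable_dpdLoss g1 g2).contDiffAt k
          (hρω hk.1)).continuousAt.continuousWithinAt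
      · exact continuousOn_const
  choose est hmeas hest using hsel
  -- Since `θ₀ ∈ K`, the minimizer has no larger loss than `θ₀`, hence lies within `C (1 + β) ‖ψ‖`
  -- of it. For arbitrary `τ` this is consistency; for `τ = ρ` the minimizer is inside the open
  -- ball, so minimality over `K` is local minimality over `Θ₀`.
  have hkey : ∀ τ > 0, HighProbability P fun n w =>
      ‖est n (fun i => X i w) - θ₀‖ < τ ∧
      ∀ k ∈ K, dpdObjective μ f β (fun i : Fin n => X i w) (est n (fun i => X i w))
        ≤ dpdObjective μ f β (fun i : Fin n => X i w) k := by
    intro τ hτ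
    refine ((hreg η hη).and (h.highProbability_norm_psiMean hX
      (η := τ / (C * (1 + β))) (by positivity))).of_imp (Eventually.of_forall fun n => ?_)
    filter_upwards [ae_forall_sample hX.measurable hX.law hN0] with w hw hS
    obtain ⟨⟨⟨b, m, hexp, hm, hb⟩, -⟩, hψ⟩ := hS
    obtain ⟨hmem, hmin⟩ := hest n (fun i => X i w)
    simp only [hw, not_false_eq_true, implies_true, if_true] at hmin
    refine ⟨?_, hmin⟩
    have hn := hgrad _ _ b m hexp hm hb _ ((mem_closedBall_iff_norm.1 hmem.1).trans
      (min_le_left _ _)) (hmin θ₀ hθ₀K)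
    refine hn.trans_lt ?_
    have e : (fun k => -(1 + β) * psiMean μ f β θ₀ (fun i : Fin n => X i w) k)
        = -(1 + β) • psiMean μ f β θ₀ (fun i : Fin n => X i w) := rfl
    rw [e, norm_smul, norm_neg, Real.norm_eq_abs, abs_of_pos hc]
    rw [lt_div_iff₀ (by positivity)] at hψ
    linarith
  refine ⟨est, hmeas, fun n x => ⟨h.subset (hρω (hest n x).1.1), (hest n x).1.2⟩, ?_, ?_⟩
  · refine (hkey ρ hρ0).mono fun n w hw => Or.inr ?_
    refine eventually_nhdsWithin_iff.2 ?_
    filter_upwards [Metric.isOpen_ball.mem_nhds (mem_ball_iff_norm.2 hw.1)] with t ht hRt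
    exact hw.2 t ⟨Metric.ball_subset_closedBall ht, hRt.2⟩
  · rw [tendstoInMeasure_iff_norm]
    intro τ hτ
    simpa only [HighProbability, not_lt] using (hkey τ hτ).mono fun n w hw => hw.1

end LocalModel

lemma Hmat_const : Hmat (fun _ : EuclideanSpace ℝ (Fin p) => (0 : EuclideanSpace ℝ (Fin r)))
    θ₀ = 0 := by
  ext j k
  simp [Hmat]

/-- Unrestricted estimators are restricted estimators under an empty set of restrictions. -/
lemma isMDPDE_iff {est : (n : ℕ) → (Fin n → 𝒳) → EuclideanSpace ℝ (Fin p)} :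
    IsMDPDE P X μ f β Θ θ₀ est ↔
      IsRestrictedMDPDE P X μ f (fun _ => (0 : EuclideanSpace ℝ (Fin 0))) β Θ θ₀ est := by
  have e : ∀ (v : Fin p → ℝ) (θ : EuclideanSpace ℝ (Fin p)), (∃ m : Fin 0 → ℝ,
      v + Hmat (fun _ : EuclideanSpace ℝ (Fin p) => (0 : EuclideanSpace ℝ (Fin 0))) θ *ᵥ m = 0)
      ↔ v = 0 := fun v θ => by simp [Hmat_const]
  constructor
  · intro h
    refine ⟨h.measurable, fun n x => ⟨h.mem n x, rfl⟩, ?_, h.consistent⟩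
    simpa only [e, and_true, Set.ofPred_mem_eq] using h.isEstimator
  · intro h
    refine ⟨h.measurable, fun n x => (h.mem n x).1, ?_, h.consistent⟩
    simpa only [e, and_true, Set.ofPred_mem_eq] using h.isEstimator

end Estimation

/-! ### The divergence between the two estimators as a quadratic form. -/

section Limit

lemma abs_quadratic_sub_le {p : ℕ} (A : Matrix (Fin p) (Fin p) ℝ) :
    ∃ C : ℝ, 0 ≤ C ∧ ∀ u v, |u ⬝ᵥ A *ᵥ u - v ⬝ᵥ A *ᵥ v| ≤ C * ‖u - v‖ * (‖u - v‖ + 2 * ‖v‖) := by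
  obtain ⟨K, hK, hA⟩ := exists_mulVec_bound A
  have hdot : ∀ a b : Fin p → ℝ, |a ⬝ᵥ b| ≤ p * (‖a‖ * ‖b‖) := fun a b => by
    refine (Finset.abs_sum_le_sum_abs _ _).trans ?_
    refine (Finset.sum_le_card_nsmul _ _ (‖a‖ * ‖b‖) fun i _ => ?_).trans (by simp)
    rw [abs_mul]
    exact mul_le_mul (norm_le_pi_norm a i) (norm_le_pi_norm b i) (abs_nonneg _) (norm_nonneg _)
  have hbil : ∀ a b, |a ⬝ᵥ A *ᵥ b| ≤ p * K * ‖a‖ * ‖b‖ := fun a b =>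
    (hdot a _).trans (by
      have := mul_le_mul_of_nonneg_left (hA b) (norm_nonneg a)
      have := mul_le_mul_of_nonneg_left this (Nat.cast_nonneg (α := ℝ) p)
      linarith)
  refine ⟨p * K, by positivity, fun u v => ?_⟩
  have e : u ⬝ᵥ A *ᵥ u - v ⬝ᵥ A *ᵥ v = (u - v) ⬝ᵥ A *ᵥ (u - v) + (u - v) ⬝ᵥ A *ᵥ v
      + v ⬝ᵥ A *ᵥ (u - v) := by
    simp only [mulVec_sub, sub_dotProduct, dotProduct_sub]
    ring
  rw [e]
  refine (abs_add_three _ _ _).trans ?_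
  linarith [hbil (u - v) (u - v), hbil (u - v) v, hbil v (u - v)]

variable {𝒳 Ω : Type*} [MeasurableSpace 𝒳] [MeasurableSpace Ω] {p r : ℕ} {μ : Measure 𝒳}
  {f : EuclideanSpace ℝ (Fin p) → 𝒳 → ℝ} {Θ ω : Set (EuclideanSpace ℝ (Fin p))}
  {θ₀ : EuclideanSpace ℝ (Fin p)} {β γ lam : ℝ} {M : Fin p → Fin p → Fin p → 𝒳 → ℝ}
  {P : Measure Ω} {X : ℕ → Ω → 𝒳}

lemma measurable_crossTerm {α : Type*} [MeasurableSpace α] {a b : α → ℝ} (ha : Measurable a)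
    (hb : Measurable b) : Measurable fun x => crossTerm γ lam (a x) (b x) := by
  unfold crossTerm
  split_ifs
  · exact (hb.pow_const _).mul (hb.div ha).log
  · exact (ha.pow_const _).mul (ha.div hb).log
  · exact (hb.pow_const _).mul (ha.pow_const _)

/-- Joint measurability of the family lets random parameters be inserted; integrating out `x` over
the σ-finite `μ` then leaves a measurable function of `w`. -/
lemma IsDensityFamily.measurable_sDiv [SigmaFinite μ] (hf : IsDensityFamily μ f Θ)
    {s t : Ω → EuclideanSpace ℝ (Fin p)} (hs : Measurable s) (ht : Measurable t)
    (hsΘ : ∀ w, s w ∈ Θ) (htΘ : ∀ w, t w ∈ Θ) :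
    Measurable fun w => sDiv μ γ lam (f (s w)) (f (t w)) := by
  have hm : ∀ {s : Ω → EuclideanSpace ℝ (Fin p)}, Measurable s → (∀ w, s w ∈ Θ) →
      Measurable fun q : Ω × 𝒳 => f (s q.1) q.2 := fun {s} hs hsΘ =>
    hf.measurable.comp (((hs.comp measurable_fst).subtype_mk (h := fun q : Ω × 𝒳 =>
      hsΘ q.1)).prodMk measurable_snd)
  have hint : ∀ {F : Ω × 𝒳 → ℝ}, Measurable F → Measurable fun w => ∫ x, F (w, x) ∂μ :=
    fun hF => (hF.stronglyMeasurable.integral_prod_right' (ν := μ)).measurable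
  simp only [sDiv_eq]
  exact (((hint ((hm ht htΘ).pow_const (1 + γ))).const_mul _).add
    ((hint (measurable_crossTerm (hm hs hsΘ) (hm ht htΘ))).const_mul _)).add
    ((hint ((hm hs hsΘ).pow_const (1 + γ))).const_mul _)

namespace LocalModel

variable (h : LocalModel μ f β Θ ω θ₀ M)

include h

/-- The `S`-divergence between unrestricted and restricted estimators is asymptotically a quadratic
form in the estimating function at the true parameter. -/
lemma sDiv_quadratic_approx [IsProbabilityMeasure P] (hX : IsSample P X μ f θ₀) (hγ : 0 ≤ γ)
    (hS : SDivRegular μ f γ lam θ₀)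
    {R : EuclideanSpace ℝ (Fin p) → EuclideanSpace ℝ (Fin r)} (hR : ContDiffAt ℝ 1 R θ₀)
    (hrank : (Hmat R θ₀).rank = r) (h0 : R θ₀ = 0)
    {est estR : (n : ℕ) → (Fin n → 𝒳) → EuclideanSpace ℝ (Fin p)}
    (hest : IsMDPDE P X μ f β Θ θ₀ est) (hestR : IsRestrictedMDPDE P X μ f R β Θ θ₀ estR)
    {ε : ℝ} (hε : 0 < ε) :
    HighProbability P fun n w =>
      |2 * sDiv μ γ lam (f (est n (fun i => X i w))) (f (estR n (fun i => X i w)))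
        - psiMean μ f β θ₀ (fun i : Fin n => X i w) ⬝ᵥ
          (projMat (Jmat μ f β θ₀) (Hmat R θ₀) * Amat μ f γ θ₀ *
            projMat (Jmat μ f β θ₀) (Hmat R θ₀)) *ᵥ psiMean μ f β θ₀ (fun i : Fin n => X i w)|
      ≤ ε * ‖psiMean μ f β θ₀ (fun i : Fin n => X i w)‖ ^ 2 := by
  obtain ⟨U, hU, hθU, d1, d2⟩ := hS
  set J := Jmat μ f β θ₀
  set Q := projMat J (Hmat R θ₀)
  set A := Amat μ f γ θ₀
  obtain ⟨C₀, hC₀, hE⟩ := exists_norm_le_ofLp p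
  obtain ⟨C₁, hC₁, hJb⟩ := exists_mulVec_bound J⁻¹
  obtain ⟨C₂, hC₂, hRb⟩ := exists_mulVec_bound (J⁻¹ - Q)
  obtain ⟨C₃, hC₃, hQb⟩ := exists_mulVec_bound Q
  obtain ⟨C₄, hC₄, hAb⟩ := abs_quadratic_sub_le A
  -- `D * ‖ψ‖²` bounds the sum of the squared distances of both estimators from `θ₀`. `G * ε₁ *
  -- ‖ψ‖²` bounds the change of the form `A` when their difference is replaced by `Qψ`. Each error
  -- receives `ε / 2`.
  set D := C₀ ^ 2 * ((C₁ + 1) ^ 2 + (C₂ + 1) ^ 2) with hD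
  set G := C₄ * (2 * (2 + 2 * C₃)) with hG
  have hDpos : 0 ≤ D := by positivity
  have hGpos : 0 ≤ G := by positivity
  have hε₂ : 0 < ε / (2 * (D + 1)) := by positivity
  obtain ⟨δ, hδ, hexp⟩ := h.exists_sDiv_expansion hγ hU hθU d1 d2 hε₂
  set ε₁ := min 1 (ε / (2 * (G + 1))) with hε₁
  have hε₁0 : 0 < ε₁ := by positivity
  have hε₁1 : ε₁ ≤ 1 := min_le_left _ _
  have hε₁2 : ε₁ ≤ ε / (2 * (G + 1)) := min_le_right _ _
  have hu := h.restricted_representation hX (R := fun _ => (0 : EuclideanSpace ℝ (Fin 0)))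
    contDiffAt_const (by rw [Hmat_const, rank_zero]) rfl (isMDPDE_iff.1 hest) hε₁0
  have hr := h.restricted_representation hX hR hrank h0 hestR hε₁0
  -- Without restrictions the projection term is zero, and the representation reads `J⁻¹ψ`.
  have hproj : projMat J (Hmat (fun _ => (0 : EuclideanSpace ℝ (Fin 0))) θ₀) = 0 := by
    rw [Hmat_const, projMat, Matrix.mul_zero, Matrix.zero_mul, Matrix.zero_mul, Matrix.zero_mul]
  rw [hproj, sub_zero] at hu
  refine (((hu.and hr).and (highProbability_dist_lt hest.consistent hδ)).and
    (highProbability_dist_lt hestR.consistent hδ)).mono fun n w hw => ?_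
  obtain ⟨⟨⟨h1, h2⟩, h3⟩, h4⟩ := hw
  rw [dist_eq_norm] at h3 h4
  have hx := hexp _ _ h3 h4
  set a := est n (fun i => X i w)
  set b := estR n (fun i => X i w)
  set ψ := psiMean μ f β θ₀ (fun i : Fin n => X i w)
  have hψ : 0 ≤ ‖ψ‖ := norm_nonneg ψ
  have hψ1 : ε₁ * ‖ψ‖ ≤ ‖ψ‖ := mul_le_of_le_one_left hψ hε₁1
  have hna : ‖a - θ₀‖ ≤ C₀ * ((C₁ + 1) * ‖ψ‖) := by
    refine (hE _).trans (mul_le_mul_of_nonneg_left ?_ hC₀.le)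
    have := norm_le_norm_add_norm_sub' (a - θ₀).ofLp (J⁻¹ *ᵥ ψ)
    linarith [hJb ψ]
  have hnb : ‖b - θ₀‖ ≤ C₀ * ((C₂ + 1) * ‖ψ‖) := by
    refine (hE _).trans (mul_le_mul_of_nonneg_left ?_ hC₀.le)
    have := norm_le_norm_add_norm_sub' (b - θ₀).ofLp ((J⁻¹ - Q) *ᵥ ψ)
    linarith [hRb ψ]
  -- `J⁻¹ψ - (J⁻¹ - Q)ψ = Qψ`; the point `θ₀` drops out of the difference.
  have hdiff : ‖(a - b).ofLp - Q *ᵥ ψ‖ ≤ 2 * (ε₁ * ‖ψ‖) := by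
    have e : (a - b).ofLp - Q *ᵥ ψ = ((a - θ₀).ofLp - J⁻¹ *ᵥ ψ)
        - ((b - θ₀).ofLp - (J⁻¹ - Q) *ᵥ ψ) := by
      rw [sub_mulVec, WithLp.ofLp_sub, WithLp.ofLp_sub, WithLp.ofLp_sub]
      abel
    rw [e]
    exact (norm_sub_le _ _).trans (by linarith)
  have hq : ψ ⬝ᵥ (Q * A * Q) *ᵥ ψ = (Q *ᵥ ψ) ⬝ᵥ A *ᵥ (Q *ᵥ ψ) := by
    have hQt : Qᵀ = Q := projMat_transpose h.posDef _
    rw [← mulVec_mulVec, ← mulVec_mulVec, dotProduct_mulVec, ← mulVec_transpose, hQt]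
  have hquad : |(a - b).ofLp ⬝ᵥ A *ᵥ (a - b).ofLp - ψ ⬝ᵥ (Q * A * Q) *ᵥ ψ|
      ≤ ε / 2 * ‖ψ‖ ^ 2 := by
    rw [hq]
    refine (hAb _ _).trans ?_
    calc C₄ * ‖(a - b).ofLp - Q *ᵥ ψ‖ * (‖(a - b).ofLp - Q *ᵥ ψ‖ + 2 * ‖Q *ᵥ ψ‖)
        ≤ C₄ * (2 * (ε₁ * ‖ψ‖)) * (2 * ‖ψ‖ + 2 * (C₃ * ‖ψ‖)) := by
          gcongr
          · linarith
          · exact hQb ψ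
      _ = G * ε₁ * ‖ψ‖ ^ 2 := by rw [hG]; ring
      _ ≤ ε / 2 * ‖ψ‖ ^ 2 := by
          gcongr
          calc G * ε₁ ≤ (G + 1) * (ε / (2 * (G + 1))) := by gcongr; linarith
            _ = ε / 2 := by field_simp
  have hrem : ε / (2 * (D + 1)) * (‖a - θ₀‖ ^ 2 + ‖b - θ₀‖ ^ 2) ≤ ε / 2 * ‖ψ‖ ^ 2 := by
    calc ε / (2 * (D + 1)) * (‖a - θ₀‖ ^ 2 + ‖b - θ₀‖ ^ 2)
        ≤ ε / (2 * (D + 1)) * ((C₀ * ((C₁ + 1) * ‖ψ‖)) ^ 2 + (C₀ * ((C₂ + 1) * ‖ψ‖)) ^ 2) := by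
          gcongr
      _ = ε / (2 * (D + 1)) * (D * ‖ψ‖ ^ 2) := by rw [hD]; ring
      _ ≤ ε / (2 * (D + 1)) * ((D + 1) * ‖ψ‖ ^ 2) := by gcongr; linarith
      _ = ε / 2 * ‖ψ‖ ^ 2 := by field_simp
  have := abs_sub_le (2 * sDiv μ γ lam (f a) (f b)) ((a - b).ofLp ⬝ᵥ A *ᵥ (a - b).ofLp)
    (ψ ⬝ᵥ (Q * A * Q) *ᵥ ψ)
  linarith

end LocalModel

lemma inv_sub_Pmat (h : EuclideanSpace ℝ (Fin p) → EuclideanSpace ℝ (Fin r)) :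
    (Jmat μ f β θ₀)⁻¹ - Pmat μ f h β θ₀ = projMat (Jmat μ f β θ₀) (Hmat h θ₀) := by
  rw [Pmat, sub_sub_cancel, projMat]

end Limit

end SDT

/-! ### Assembly of the main theorem. -/

theorem theorem3 {𝒳 Ω : Type*} [MeasurableSpace 𝒳] [MeasurableSpace Ω] {p r : ℕ}
    (μ : Measure 𝒳) [SigmaFinite μ]
    (f : EuclideanSpace ℝ (Fin p) → 𝒳 → ℝ)
    (Θ : Set (EuclideanSpace ℝ (Fin p)))
    (h : EuclideanSpace ℝ (Fin p) → EuclideanSpace ℝ (Fin r))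
    (θ₀ : EuclideanSpace ℝ (Fin p))
    (P : Measure Ω) [IsProbabilityMeasure P] (X : ℕ → Ω → 𝒳)
    (γ lam β : ℝ) (hγ : γ ∈ Set.Icc (0 : ℝ) 1) (hβ : 0 ≤ β)
    -- the model and its regularity
    (hf : SDT.IsDensityFamily μ f Θ)
    (hLehmann : SDT.LehmannConditions μ f Θ θ₀)
    (hBasu : SDT.BasuConditions μ f β Θ θ₀)
    (hV : ∀ j k, Integrable
      (fun x => SDT.score f θ₀ x j * SDT.score f θ₀ x k * f θ₀ x ^ (1 + 2 * β)) μ)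
    (hS : SDT.SDivRegular μ f γ lam θ₀)
    -- the restrictions, and the null hypothesis
    (hh : ContDiffAt ℝ 1 h θ₀) (hrank : (SDT.Hmat h θ₀).rank = r)
    (hnull : h θ₀ = 0)
    (hX : SDT.IsSample P X μ f θ₀) :
    (∃ est, SDT.IsMDPDE P X μ f β Θ θ₀ est) ∧
    (∃ est, SDT.IsRestrictedMDPDE P X μ f h β Θ θ₀ est) ∧
    (SDT.Vmat μ f β θ₀ * ((SDT.Jmat μ f β θ₀)⁻¹ - SDT.Pmat μ f h β θ₀) * SDT.Amat μ f γ θ₀ *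
      ((SDT.Jmat μ f β θ₀)⁻¹ - SDT.Pmat μ f h β θ₀) * SDT.Vmat μ f β θ₀).rank = r ∧
    ∃ ζ : Fin r → ℝ,
      SDT.IsNonzeroEigenvalues (SDT.Amat μ f γ θ₀ * SDT.SigmaTilde μ f h β θ₀) ζ ∧
      ∀ est estR : (n : ℕ) → (Fin n → 𝒳) → EuclideanSpace ℝ (Fin p),
        SDT.IsMDPDE P X μ f β Θ θ₀ est →
        SDT.IsRestrictedMDPDE P X μ f h β Θ θ₀ estR →
        TendstoInDistribution
          (fun (n : ℕ) w => 2 * (n : ℝ) *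
            SDT.sDiv μ γ lam (f (est n (fun i => X i w))) (f (estR n (fun i => X i w))))
          atTop
          (fun z : Fin r → ℝ => ∑ i, ζ i * z i ^ 2)
          (fun _ => P) (Measure.pi (fun _ : Fin r => gaussianReal 0 1)) := by
  obtain ⟨ω₁, -, -, hω₁, -, hcent, -, hfish, -⟩ := hLehmann
  obtain ⟨hsupp, ω, hωo, hωΘ, hω, hsmooth, hpow, hcross, hJ, M, hM, hMi⟩ := hBasu
  have hm : SDT.LocalModel μ f β Θ ω θ₀ M :=
    { beta_nonneg := hβ
      density := hf
      support := hsupp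
      isOpen := hωo
      subset := hωΘ
      mem := hω
      smooth := hsmooth
      power := hpow
      cross := hcross
      posDef := hJ
      third_bound := hM
      bound_integrable := hMi
      score_integrable := fun j => (hcent θ₀ hω₁ j).1
      score_centred := fun j => (hcent θ₀ hω₁ j).2
      fisher_integrable := (hfish θ₀ hω₁).1
      fisher_posDef := (hfish θ₀ hω₁).2
      variance_integrable := hV }
  have hA : (SDT.Amat μ f γ θ₀).PosDef := by
    obtain ⟨U, -, hθU, d1, d2⟩ := hS
    exact hm.Amat_posDef hγ.1 hθU d1 d2
  have hVp := hm.Vmat_posDef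
  refine ⟨?_, hm.exists_isRestrictedMDPDE hX hh hnull, ?_, ?_⟩
  · obtain ⟨est, hest⟩ := hm.exists_isRestrictedMDPDE hX
      (R := fun _ => (0 : EuclideanSpace ℝ (Fin 0))) contDiffAt_const rfl
    exact ⟨est, SDT.isMDPDE_iff.2 hest⟩
  · have := SDT.rank_sandwich hJ hA hrank (SDT.isUnit_det_of_posDef hVp)
    rwa [SDT.transpose_eq_of_posDef hVp, ← SDT.inv_sub_Pmat] at this
  -- The weights depend only on the matrices at `θ₀`, so the same `ζ` serves every pair of
  -- estimators.
  obtain ⟨ζ, T, hζ, hT, hquad⟩ := SDT.exists_weights hJ hA hVp hrank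
  refine ⟨ζ, by rwa [SDT.SigmaTilde, SDT.inv_sub_Pmat], fun est estR hest hestR => ?_⟩
  have hlim := SDT.tendstoInDistribution_quadratic hX.measurable hX.indep hX.law
    hm.psi_integrable hm.psi_integral hm.psi_mul_psi_integrable hm.psi_covariance hT ζ
  have key := SDT.tendstoInDistribution_of_quadratic_approx hX.measurable hX.indep hX.law
    hm.psi_memLp hm.psi_integral hlim
    (Y := fun n w => 2 * SDT.sDiv μ γ lam (f (est n (fun i => X i w)))
      (f (estR n (fun i => X i w)))) (fun n => ?_) fun ε hε => ?_
  · convert! key using 3 with n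
    ring
  · have hXn : Measurable fun w => (fun i : Fin n => X i w) :=
      measurable_pi_lambda _ fun i => hX.measurable i
    exact ((hf.measurable_sDiv ((hest.measurable n).comp hXn) ((hestR.measurable n).comp hXn)
      (fun w => hest.mem n _) (fun w => (hestR.mem n _).1)).const_mul 2).aemeasurable
  · refine (hm.sDiv_quadratic_approx hX hγ.1 hS hh hrank hnull hest hestR hε).mono fun n w hw => ?_
    rw [hquad] at hw
    exact hw
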